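/- **Setting.** Let $\Sigma$ be a set of labels, either finite or countably infinite (concretely: a finite set of binary strings, or the set of all binary strings). A *knowledge base* $K=(V,E)$ is a finite edge-labelled directed graph: $V$ is a finite nonempty set of nodes and $E\subseteq V\times\Sigma\times V$ is finite. A *CRPQ* is an expression $Q(x_1,\dots,x_n)\leftarrow A_1\wedge\dots\wedge A_m$ whose atoms $A_i$ have the form $y\,R\,z$, with variables $y,z$ and a regular expression $R$ over $\Sigma$; each *distinguished* variable $x_j$ has to occur in some atom. A *satisfying homomorphism* from $Q$ to $K$ maps the variables of $Q$ to $V$ in such a way that, for every atom $y\,R\,z$, $K$ has a (possibly empty) directed path from the image of $y$ to the image of $z$ whose label word is in $L(R)$. The set $\mathrm{ans}(Q,K)$ consists of the images of $(x_1,\dots,x_n)$ under all satisfying homomorphisms from $Q$ to $K$, and $Q_1\subseteq Q_2$ means that $\mathrm{ans}(Q_1,K)\subseteq\mathrm{ans}(Q_2,K)$ for every knowledge base $K$. A *component* of $Q$ is a connected component of the undirected graph whose nodes are the variables of $Q$ and whose edges are the atoms of $Q$. $\mathrm{CRPQ}(A)$ is the set of CRPQs in which every atom uses an expression $a_1+\dots+a_k$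 with $k\ge 1$ and $a_i\in\Sigma$; $\mathrm{CRPQ}(a,a^*)$ is the set of CRPQs in which every atom uses an expression $a$ or $a^*$ with $a\in\Sigma$. Queries are written as words over a finite alphabet in a standard way, with names of labels and variables written out as binary strings. $\Pi_2^p$ is the second universal level of the polynomial hierarchy. **Proposition.** For each of the following two problems, the language of all (encoded) pairs $(Q_1,Q_2)$ of the indicated kind with $Q_1\subseteq Q_2$ is in $\Pi_2^p$: 1. $Q_1$ is an arbitrary CRPQ, $Q_2\in\mathrm{CRPQ}(A)$, and every component of $Q_1$ and every component of $Q_2$ contains at least one distinguished variable; 2. $Q_1$ is an arbitrary CRPQ, $Q_2\in\mathrm{CRPQ}(a,a^*)$, and every component of $Q_1$ and every component of $Q_2$ contains at least one distinguished variable. -/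

import Mathlib

namespace CRPQContainment

/-! ### Names, knowledge bases and paths -/

/-- Names of labels and of variables are finite bit strings. -/
abbrev Name : Type := List Bool

/-- A finite set of labelled directed edges on the node set `V`. Node sets of knowledge bases are
finite and nonempty; this is required where knowledge bases are quantified over. -/
structure KB (L V : Type) where
  edges : Set (V × L × V)
  finite_edges : edges.Finite

/-- `K.Path u w v`: the knowledge base `K` has a (possibly empty) path from `u` to `v` whose
sequence of edge labels is the word `w`. -/
inductive KB.Path {L V : Type} (K : KB L V) : V → List L → V → Prop
  | nil (v : V) : KB.Path K v [] v
  | cons {u v v' : V} {a : L} {w : List L} :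
      (u, a, v) ∈ K.edges → KB.Path K v w v' → KB.Path K u (a :: w) v'

/-! ### Conjunctive regular path queries -/

/-- An atom `y R z`. -/
structure Atom (L : Type) where
  source : Name
  regex : RegularExpression L
  target : Name

/-- A conjunctive regular path query `Q(x₁, …, xₙ) ← A₁ ∧ … ∧ Aₘ` with labels in `L`. -/
structure CRPQ (L : Type) where
  /-- the tuple `x₁, …, xₙ` of distinguished variables -/
  distinguished : List Name
  /-- the atoms `A₁, …, Aₘ` -/
  atoms : List (Atom L)
  /-- every distinguished variable occurs in some atom -/
  distinguished_occurs :
    ∀ x ∈ distinguished, ∃ A ∈ atoms, x = A.source ∨ x = A.target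

namespace CRPQ

variable {L V : Type}

/-- The variables of a query. -/
def vars (Q : CRPQ L) : Set Name :=
  {x | ∃ A ∈ Q.atoms, x = A.source ∨ x = A.target}

/-- `μ` is a satisfying homomorphism from `Q` to `K`. Values of `μ` outside the variables of `Q`
are irrelevant. -/
def IsEmbedding (Q : CRPQ L) (K : KB L V) (μ : Name → V) : Prop :=
  ∀ A ∈ Q.atoms, ∃ w ∈ A.regex.matches', K.Path (μ A.source) w (μ A.target)

/-- The set of answers of `Q` over `K`, a set of tuples of nodes. -/
def ans (Q : CRPQ L) (K : KB L V) : Set (List V) :=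
  {d | ∃ μ : Name → V, Q.IsEmbedding K μ ∧ d = Q.distinguished.map μ}

/-- Containment of queries: `ans Q₁ K ⊆ ans Q₂ K` for every knowledge base `K`. -/
def Contained (Q₁ Q₂ : CRPQ L) : Prop :=
  ∀ (V : Type) [Finite V] [Nonempty V] (K : KB L V), Q₁.ans K ⊆ Q₂.ans K

/-- The graph of a query: variables are nodes, atoms are (undirected) edges. -/
def graph (Q : CRPQ L) : SimpleGraph Name :=
  SimpleGraph.fromRel fun x y => ∃ A ∈ Q.atoms, A.source = x ∧ A.target = y

/-- Every connected component of `Q` contains at least one distinguished variable. -/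
def ComponentsDistinguished (Q : CRPQ L) : Prop :=
  ∀ x ∈ Q.vars, ∃ y ∈ Q.distinguished, Q.graph.Reachable x y

/-- Every atom of `Q` uses a regular expression from the class `C`. -/
def InFragment (C : Set (RegularExpression L)) (Q : CRPQ L) : Prop :=
  ∀ A ∈ Q.atoms, A.regex ∈ C

end CRPQ

/-- Disjunctions `a₁ + ⋯ + aₙ` of `n ≥ 1` symbols, with any bracketing. -/
inductive IsDisjunction {L : Type} : RegularExpression L → Prop
  | symbol (a : L) : IsDisjunction (.char a)
  | plus {R R' : RegularExpression L} :
      IsDisjunction R → IsDisjunction R' → IsDisjunction (.plus R R')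

/-- The class `A` of expressions: disjunctions of symbols. -/
def classA (L : Type) : Set (RegularExpression L) :=
  {R | IsDisjunction R}

/-- The class `a, a*` of expressions: single symbols and Kleene closures of single symbols. -/
def classSymbolStar (L : Type) : Set (RegularExpression L) :=
  {R | ∃ a : L, R = .char a ∨ R = .star (.char a)}

/-! ### Queries as words over a finite alphabet -/

/-- The finite alphabet over which queries are written. -/
inductive Token
  | bit (b : Bool)
  | endName
  | empty
  | epsilon
  | symbol
  | plus
  | comp
  | star
  | atom
  | distinguished
  | endQuery
  deriving DecidableEq, Fintype

/-- A name is written as its bits, followed by an end marker. -/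
def encodeName (x : Name) : List Token :=
  x.map Token.bit ++ [Token.endName]

/-- Regular expressions are written in prefix notation. -/
def encodeRegex {S : Set Name} : RegularExpression S → List Token
  | .zero => [Token.empty]
  | .epsilon => [Token.epsilon]
  | .char a => Token.symbol :: encodeName a
  | .plus R R' => Token.plus :: (encodeRegex R ++ encodeRegex R')
  | .comp R R' => Token.comp :: (encodeRegex R ++ encodeRegex R')
  | .star R => Token.star :: encodeRegex R

def encodeAtom {S : Set Name} (A : Atom S) : List Token :=
  Token.atom :: (encodeName A.source ++ encodeRegex A.regex ++ encodeName A.target)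

def encodeQuery {S : Set Name} (Q : CRPQ S) : List Token :=
  Q.distinguished.flatMap (fun x => Token.distinguished :: encodeName x) ++
    Q.atoms.flatMap encodeAtom ++ [Token.endQuery]

/-- The decision problem containment of `F₁` in `F₂`, for classes `F₁`, `F₂` of queries over the
label set `S`: the language of all words that encode a pair of queries `Q₁ ∈ F₁`, `Q₂ ∈ F₂` such
that `Q₁` is contained in `Q₂`. -/
def containmentProblem {S : Set Name} (F₁ F₂ : Set (CRPQ S)) : Language Token :=
  {w | ∃ Q₁ ∈ F₁, ∃ Q₂ ∈ F₂, w = encodeQuery Q₁ ++ encodeQuery Q₂ ∧ Q₁.Contained Q₂}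

/-! ### The complexity class `Π₂ᵖ` -/

/-- A word `x` and two certificates `y`, `z`, written one after the other with separators. -/
def encodeTriple {Γ : Type} (t : List Γ × List Bool × List Bool) : List (Option (Γ ⊕ Bool)) :=
  t.1.map (fun a => some (Sum.inl a)) ++
    none :: (t.2.1.map (fun b => some (Sum.inr b)) ++
      none :: t.2.2.map (fun b => some (Sum.inr b)))

/-- The second level `Π₂ᵖ` of the polynomial hierarchy: `x ∈ P` iff for all certificates `y` of
polynomial length there is a certificate `z` of polynomial length such that `(x, y, z)` is accepted
by a polynomial-time Turing machine. -/
def InPiTwoP {Γ : Type} [Finite Γ] (P : Language Γ) : Prop :=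
  ∃ (p : Polynomial ℕ) (R : List Γ × List Bool × List Bool → Bool),
    Nonempty (Turing.TM2ComputableInPolyTime encodeTriple Computability.encodeBool R) ∧
    ∀ x : List Γ, x ∈ P ↔
      ∀ y : List Bool, y.length ≤ p.eval x.length →
        ∃ z : List Bool, z.length ≤ p.eval x.length ∧ R (x, y, z) = true

end CRPQContainment

/-! Containment becomes a statement "for all y there is z" over polynomially long strings once the
knowledge bases to be tested may be taken of polynomial size. Two ingredients are needed: small
counterexamples, and a check of the certificates in polynomial time.

Small counterexamples (`exists_small_counterexample`). If `Q₁` is not contained in `Q₂`, replace the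
given knowledge base by paths, one for each atom of `Q₁`, that are labelled with words `ws i`
matching the regular expressions and meet only in images of variables. This graph maps
homomorphically to the knowledge base, so it is again a counterexample. Choose the total length of
the words minimal. An expression has only linearly many ways of splitting its words in two, so among
sufficiently many consecutive cutting positions two are interchangeable and the factor between them
can be deleted (`exists_pump`). It remains to see that an embedding of `Q₂` into the shortened graph
yields one into the original graph. If the word has a long run of one letter, the cut is made in the
run. Some node of the remaining run is not the image of the source of any atom, and the run is
lengthened again there: single edges survive, and paths for `a*` absorb the additional letters. If
the word has no long run, the cut is made in the middle, from where an end of the path is reached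
only after many changes of letters. Every atom of `Q₂` reads a word in one letter, so it changes
this distance (`level`) by at most one. As components contain distinguished variables, and these are
mapped to the ends of paths, all variables of `Q₂` have small level. Hence no atom uses the edge at
the cut, and the deleted factor can be inserted again.

The check. The first certificate lists the edges of a knowledge base, an assignment for `Q₁` and a
table of matches of subexpressions; another of its tables is a set of variables that tests the
condition on components. The second certificate contains tables for the syntax of the word, an
assignment and a table of matches for `Q₂`, and a comparison of the two answer tuples. Labels are
represented by positions in the word, which suffices because all labels of a small counterexample
occur in `Q₁`. All consistency conditions are local, so they form one fixed first-order formula over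
`{0, …, N - 1}` with `N` polynomial. Nested loops over unary counters evaluate it in polynomial time
(`inPiTwoP_of_formula`). The two directions of the equivalence are `exists_verifies` and
`contained_of_verifies`. -/

namespace CRPQContainment

open Turing

/-! ### Structured programs for stack machines -/

/-- Structured programs over a family of stacks. Tests look at the top of a stack. -/
inductive Cmd {K : Type} (Γ : K → Type) : Type
  | skip
  | push (k : K) (a : Γ k)
  | pop (k : K)
  | seq (c d : Cmd Γ)
  | ite (k : K) (t : Option (Γ k) → Bool) (c d : Cmd Γ)
  | loop (k : K) (t : Option (Γ k) → Bool) (c : Cmd Γ)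

namespace Cmd

variable {K : Type} {Γ : K → Type}

/-- Program points of a program. -/
def Label : Cmd Γ → Type
  | skip => Unit
  | push _ _ => Unit
  | pop _ => Unit
  | seq c d => c.Label ⊕ d.Label
  | ite _ _ c d => Option (c.Label ⊕ d.Label)
  | loop _ _ c => Option c.Label

/-- The point where the execution of a program starts. -/
def entry : (c : Cmd Γ) → c.Label
  | skip => ()
  | push _ _ => ()
  | pop _ => ()
  | seq c _ => Sum.inl c.entry
  | ite _ _ _ _ => none
  | loop _ _ _ => none

noncomputable instance fintypeLabel : (c : Cmd Γ) → Fintype c.Label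
  | skip => inferInstanceAs (Fintype Unit)
  | push _ _ => inferInstanceAs (Fintype Unit)
  | pop _ => inferInstanceAs (Fintype Unit)
  | seq c d =>
    letI := fintypeLabel c
    letI := fintypeLabel d
    inferInstanceAs (Fintype (c.Label ⊕ d.Label))
  | ite _ _ c d =>
    letI := fintypeLabel c
    letI := fintypeLabel d
    inferInstanceAs (Fintype (Option (c.Label ⊕ d.Label)))
  | loop _ _ c =>
    letI := fintypeLabel c
    inferInstanceAs (Fintype (Option c.Label))

/-- The machine code of a program; `ι` places its program points among the labels `Λ` of a machine,
and the execution continues at `exit`. -/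
def code {Λ : Type} : (c : Cmd Γ) → (ι : c.Label → Λ) → (exit : Λ) → c.Label → TM2.Stmt Γ Λ Bool
  | skip, _, exit, _ => .goto fun _ => exit
  | push k a, _, exit, _ => .push k (fun _ => a) (.goto fun _ => exit)
  | pop k, _, exit, _ => .pop k (fun s _ => s) (.goto fun _ => exit)
  | seq c d, ι, exit, l =>
    Sum.elim (code c (fun l => ι (.inl l)) (ι (.inr d.entry))) (code d (fun l => ι (.inr l)) exit) l
  | ite k t c d, ι, exit, l =>
    Option.elim l
      (.peek k (fun _ o => t o) (.branch id
        -- The result of the test is erased, so that the internal state is `false` at every program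
        -- point.
        (.load (fun _ => false) (.goto fun _ => ι (some (.inl c.entry))))
        (.load (fun _ => false) (.goto fun _ => ι (some (.inr d.entry))))))
      (Sum.elim (code c (fun l => ι (some (.inl l))) exit)
        (code d (fun l => ι (some (.inr l))) exit))
  | loop k t c, ι, exit, l =>
    Option.elim l
      (.peek k (fun _ o => t o) (.branch id
        (.load (fun _ => false) (.goto fun _ => ι (some c.entry)))
        (.load (fun _ => false) (.goto fun _ => exit))))
      (code c (fun l => ι (some l)) (ι none))

variable [DecidableEq K]

/-- `Exec c s s' t`: the program `c` transforms the stacks `s` into `s'` within time `t`. -/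
inductive Exec : Cmd Γ → (∀ k, List (Γ k)) → (∀ k, List (Γ k)) → ℕ → Prop
  | skip (s) : Exec skip s s 1
  | push (k a s) : Exec (push k a) s (Function.update s k (a :: s k)) 1
  | pop (k s) : Exec (pop k) s (Function.update s k (s k).tail) 1
  | seq {c d s s' s'' t t'} : Exec c s s' t → Exec d s' s'' t' → Exec (seq c d) s s'' (t + t')
  | ite_true {k test c d s s' t} : test (s k).head? = true → Exec c s s' t →
      Exec (ite k test c d) s s' (t + 1)
  | ite_false {k test c d s s' t} : test (s k).head? = false → Exec d s s' t →
      Exec (ite k test c d) s s' (t + 1)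
  | loop_true {k test c s s' s'' t t'} : test (s k).head? = true → Exec c s s' t →
      Exec (loop k test c) s' s'' t' → Exec (loop k test c) s s'' (t + t' + 1)
  | loop_false {k test c s} : test (s k).head? = false → Exec (loop k test c) s s 1
  | weaken {c s s' t t'} : Exec c s s' t → t ≤ t' → Exec c s s' t'

/-- `b` is reached from `a` in at most `t` steps. -/
def ReachesIn {Λ : Type} (M : Λ → TM2.Stmt Γ Λ Bool) (a b : TM2.Cfg Γ Λ Bool) (t : ℕ) : Prop :=
  ∃ n ≤ t, (flip bind (TM2.step M))^[n] (some a) = some b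

/-! ### Correctness of the compilation into machine code -/

section ReachesIn

variable {Λ : Type} {M : Λ → TM2.Stmt Γ Λ Bool}

theorem ReachesIn.trans {a b c : TM2.Cfg Γ Λ Bool} {t t' : ℕ}
    (h : ReachesIn M a b t) (h' : ReachesIn M b c t') : ReachesIn M a c (t + t') := by
  obtain ⟨n, hn, h⟩ := h
  obtain ⟨n', hn', h'⟩ := h'
  exact ⟨n' + n, by omega, by rw [Function.iterate_add_apply, h, h']⟩

theorem ReachesIn.mono {a b : TM2.Cfg Γ Λ Bool} {t t' : ℕ}
    (h : ReachesIn M a b t) (ht : t ≤ t') : ReachesIn M a b t' := by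
  obtain ⟨n, hn, h⟩ := h
  exact ⟨n, by omega, h⟩

theorem ReachesIn.step {a b : TM2.Cfg Γ Λ Bool} (h : TM2.step M a = some b) :
    ReachesIn M a b 1 :=
  ⟨1, le_rfl, h⟩

/-- Induction on the execution. The machine, the placement `ι` and the exit are quantified after the
execution, so that the hypothesis for a subprogram applies to its copy inside the larger machine. -/
theorem reachesIn_code {c : Cmd Γ} {s s' : ∀ k, List (Γ k)} {t : ℕ} (h : Exec c s s' t) :
    ∀ {Λ : Type} (M : Λ → TM2.Stmt Γ Λ Bool) (ι : c.Label → Λ) (exit : Λ),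
      (∀ l, M (ι l) = c.code ι exit l) →
      ReachesIn M ⟨some (ι c.entry), false, s⟩ ⟨some exit, false, s'⟩ t := by
  induction h with
  | skip s => 
    intro Λ M ι exit hM
    exact .step (by simp [hM, code])
  | push k a s => 
    intro Λ M ι exit hM
    exact .step (by simp [hM, code])
  | pop k s => 
    intro Λ M ι exit hM
    exact .step (by simp [hM, code])
  | seq _ _ ih ih' => 
    intro Λ M ι exit hM
    exact (ih M (fun l => ι (.inl l)) _ fun l => hM (.inl l)).trans
      (ih' M (fun l => ι (.inr l)) _ fun l => hM (.inr l))
  | @ite_true k test c d s s' t h _ ih =>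
    intro Λ M ι exit hM
    have h1 := ih M (fun l => ι (some (.inl l))) exit fun l => hM (some (.inl l))
    refine (ReachesIn.trans (.step ?_) h1).mono (by omega)
    have := hM none
    simp only [entry, TM2.step]
    rw [this]
    simp [code, h]
  | @ite_false k test c d s s' t h _ ih =>
    intro Λ M ι exit hM
    have h1 := ih M (fun l => ι (some (.inr l))) exit fun l => hM (some (.inr l))
    refine (ReachesIn.trans (.step ?_) h1).mono (by omega)
    have := hM none
    simp only [entry, TM2.step]
    rw [this]
    simp [code, h]
  | @loop_true k test c s s' s'' t t' h _ _ ih ih' =>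
    intro Λ M ι exit hM
    have h1 := ih M (fun l => ι (some l)) (ι none) fun l => hM (some l)
    refine (ReachesIn.trans (.step ?_) (h1.trans (ih' M ι exit hM))).mono (by omega)
    have := hM none
    simp only [entry, TM2.step]
    rw [this]
    simp [code, h]
  | @loop_false k test c s h =>
    intro Λ M ι exit hM
    refine .step ?_
    have := hM none
    simp only [entry, TM2.step]
    rw [this]
    simp [code, h]
  | weaken _ hle ih =>
    intro Λ M ι exit hM
    exact (ih M ι exit hM).mono hle

end ReachesIn

end Cmd

end CRPQContainment

namespace CRPQContainment

/-! ### Programs over stacks of bits -/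

/-- The stack `none` holds the input, all other stacks hold bits. -/
@[reducible]
def Alphabet (I : Type) {K : Type} : Option K → Type
  | none => I
  | some _ => Bool

/-- The stacks with input `s` and bit stacks `f`. -/
def bitStacks {I K : Type} (s : List I) (f : K → List Bool) : ∀ k : Option K, List (Alphabet I k)
  | none => s
  | some k => f k

abbrev BitCmd (I K : Type) : Type := Cmd (Alphabet I (K := K))

open Function (update)

variable {I K : Type} [DecidableEq K]

theorem update_bitStacks_some (s : List I) (f : K → List Bool) (k : K) (l : List Bool) :
    update (bitStacks s f) (some k) l = bitStacks s (update f k l) := by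
  funext x
  cases x with
  | none => rfl
  | some x =>
    by_cases h : x = k
    · subst h; simp [bitStacks]
    · simp [bitStacks, h]

theorem update_bitStacks_none (s s' : List I) (f : K → List Bool) :
    update (bitStacks s f) none s' = bitStacks s' f := by
  funext x
  cases x <;> rfl

namespace BitCmd

/-- `Run c f f' t`: the program `c` transforms the bit stacks `f` into `f'` within time `t`, without
using the input. -/
def Run (c : BitCmd I K) (f f' : K → List Bool) (t : ℕ) : Prop :=
  ∀ s : List I, Cmd.Exec c (bitStacks s f) (bitStacks s f') t

def push (k : K) (b : Bool) : BitCmd I K := Cmd.push (some k) b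

def pop (k : K) : BitCmd I K := Cmd.pop (some k)

def ite (k : K) (c d : BitCmd I K) : BitCmd I K :=
  Cmd.ite (some k) (fun o : Option Bool => o == some true) c d

def ifNonempty (k : K) (c d : BitCmd I K) : BitCmd I K :=
  Cmd.ite (some k) (fun o : Option Bool => o.isSome) c d

def loop (k : K) (c : BitCmd I K) : BitCmd I K :=
  Cmd.loop (some k) (fun o : Option Bool => o.isSome) c

variable {f g h : K → List Bool} {c d : BitCmd I K} {t t' : ℕ}

theorem Run.mono (hc : Run c f g t) (ht : t ≤ t') : Run c f g t' :=
  fun s => (hc s).weaken ht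

theorem Run.seq (hc : Run c f g t) (hd : Run d g h t') : Run (Cmd.seq c d) f h (t + t') :=
  fun s => (hc s).seq (hd s)

theorem run_skip : Run (Cmd.skip : BitCmd I K) f f 1 :=
  fun _ => .skip _

theorem run_push (k : K) (b : Bool) : Run (push k b : BitCmd I K) f (update f k (b :: f k)) 1 := by
  intro s
  rw [← update_bitStacks_some]
  exact .push _ _ _

theorem run_pop (k : K) : Run (pop k : BitCmd I K) f (update f k (f k).tail) 1 := by
  intro s
  rw [← update_bitStacks_some]
  exact .pop _ _

theorem Run.ite_true {k : K} {l : List Bool} (hk : f k = true :: l) (hc : Run c f g t) :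
    Run (ite k c d) f g (t + 1) :=
  fun s => .ite_true (by simp [bitStacks, hk]) (hc s)

theorem Run.ite_false {k : K} (hk : (f k).head? ≠ some true) (hd : Run d f g t) :
    Run (ite k c d) f g (t + 1) :=
  fun s => .ite_false (by simpa [bitStacks] using hk) (hd s)

theorem Run.ifNonempty_true {k : K} (hk : f k ≠ []) (hc : Run c f g t) :
    Run (ifNonempty k c d) f g (t + 1) :=
  fun s => .ite_true (by simpa [bitStacks, List.isSome_head?] using hk) (hc s)

theorem Run.ifNonempty_false {k : K} (hk : f k = []) (hd : Run d f g t) :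
    Run (ifNonempty k c d) f g (t + 1) :=
  fun s => .ite_false (by simp [bitStacks, hk]) (hd s)

/-- The loop invariant is an explicit sequence `g` of configurations, one for each number of
completed rounds; all later loops are verified by writing down such a sequence. -/
theorem Run.loop {k : K} {t : ℕ} : ∀ (n : ℕ) (g : ℕ → K → List Bool),
    (∀ i < n, g i k ≠ [] ∧ Run c (g i) (g (i + 1)) t) → g n k = [] →
    Run (loop k c) (g 0) (g n) (n * (t + 1) + 1)
  | 0, g, _, h0 => fun s => (Cmd.Exec.loop_false (by simp [bitStacks, h0])).weaken (by omega)
  | n + 1, g, hi, h0 => fun s => by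
    have h1 := Run.loop n (fun i => g (i + 1)) (fun i hin => hi (i + 1) (by omega)) h0 s
    refine (Cmd.Exec.loop_true ?_ ((hi 0 (by omega)).2 s) h1).weaken ?_
    · have := (hi 0 (by omega)).1
      simpa [bitStacks, List.isSome_head?] using this
    · ring_nf; omega

theorem Run.congr {g' : K → List Bool} (hc : Run c f g t) (hg : g = g') (ht : t ≤ t') :
    Run c f g' t' :=
  hg ▸ hc.mono ht

/-- Empty the stack `k`. -/
def clear (k : K) : BitCmd I K := loop k (pop k)

theorem run_clear (f : K → List Bool) (k : K) :
    Run (clear k : BitCmd I K) f (update f k []) (2 * (f k).length + 1) := by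
  have := Run.loop (I := I) (k := k) (c := pop k) (t := 1) (f k).length
    (fun i => update f k ((f k).drop i)) (fun i hi => by
      refine ⟨by simp; omega, (run_pop k).congr ?_ le_rfl⟩
      simp) (by simp)
  simp only [List.drop_zero, Function.update_eq_self, List.drop_length] at this
  exact this.mono (by omega)

/-- Move the contents of the stack `k` to the stack `k'`, reversing it. -/
def move (k k' : K) : BitCmd I K :=
  loop k (Cmd.seq (ite k (push k' true) (push k' false)) (pop k))

theorem run_move (f : K → List Bool) {k k' : K} (hk : k ≠ k') :
    Run (move k k' : BitCmd I K) f
      (update (update f k' ((f k).reverse ++ f k')) k []) (4 * (f k).length + 1) := by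
  have := Run.loop (I := I) (k := k) (c := Cmd.seq (ite k (push k' true) (push k' false)) (pop k))
    (t := 3) (f k).length
    (fun i => update (update f k' (((f k).take i).reverse ++ f k')) k ((f k).drop i))
    (fun i hi => by
      refine ⟨by simp; omega, ?_⟩
      have h1 : (f k).drop i = (f k)[i] :: (f k).drop (i + 1) := by simp
      have h2 : ((f k).take (i + 1)).reverse = (f k)[i] :: ((f k).take i).reverse := by
        rw [List.take_add_one]; simp [hi]
      have key : Run (ite k (push k' true) (push k' false) : BitCmd I K)
          (update (update f k' (((f k).take i).reverse ++ f k')) k ((f k).drop i))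
          (update (update f k' (((f k).take (i + 1)).reverse ++ f k')) k ((f k).drop i)) 2 := by
        rw [h2]
        cases hb : (f k)[i] with
        | true =>
          refine (Run.ite_true (l := (f k).drop (i + 1)) (by simp [h1, hb]) (run_push _ _)).congr
            ?_ le_rfl
          rw [Function.update_comm hk]
          simp [hk.symm]
        | false =>
          refine (Run.ite_false (by simp [h1, hb]) (run_push _ _)).congr ?_ le_rfl
          rw [Function.update_comm hk]
          simp [hk.symm]
      refine (key.seq (run_pop _)).congr ?_ le_rfl
      simp) (by simp)
  simp only [List.drop_zero, List.take_zero, List.reverse_nil, List.nil_append,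
    Function.update_eq_self, List.drop_length, List.take_length] at this
  exact this.mono (by omega)

/-- Add the number in the stack `k` to the number in the stack `k'`. -/
def add (k k' tmp : K) : BitCmd I K :=
  Cmd.seq (loop k (Cmd.seq (pop k) (Cmd.seq (push k' true) (push tmp true)))) (move tmp k)

/-- Numbers are in unary. The summand is consumed while it is copied to both `k'` and `tmp`, and is
then restored from `tmp`, so that it keeps its value. -/
theorem run_add (f : K → List Bool) {k k' tmp : K} {n : ℕ} (hn : f k = List.replicate n true)
    (h0 : f tmp = []) (h1 : k ≠ k') (h2 : k ≠ tmp) (h3 : k' ≠ tmp) :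
    Run (add k k' tmp : BitCmd I K) f
      (update f k' (List.replicate n true ++ f k')) (8 * n + 2) := by
  have := Run.loop (I := I) (k := k)
    (c := Cmd.seq (pop k) (Cmd.seq (push k' true) (push tmp true)))
    (t := 3) n
    (fun i => update (update (update f k' (List.replicate i true ++ f k')) tmp
      (List.replicate i true)) k (List.replicate (n - i) true))
    (fun i hi => by
      refine ⟨by simp; omega, ((run_pop _).seq ((run_push _ _).seq (run_push _ _))).congr ?_ le_rfl⟩
      funext x
      by_cases hx : x = k
      · subst hx; simp [h1, h2]; omega
      by_cases hx' : x = k'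
      · subst hx'; simp [h1.symm, h3, List.replicate_succ]
      by_cases hx'' : x = tmp
      · subst hx''; simp [h2.symm, h3.symm, List.replicate_succ]
      · simp [hx, hx', hx'']) (by simp)
  have start : update (update (update f k' (List.replicate 0 true ++ f k')) tmp
      (List.replicate 0 true)) k (List.replicate (n - 0) true) = f := by
    funext x
    simp only [Function.update_apply]
    split_ifs <;> simp_all
  rw [start] at this
  refine (this.seq (run_move _ h2.symm)).congr ?_ ?_
  · funext x
    by_cases hx : x = k
    · subst hx; simp [h1, h2, h2.symm, hn]
    by_cases hx' : x = k'
    · subst hx'; simp [h1.symm, h3]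
    by_cases hx'' : x = tmp
    · subst hx''; simp [h3.symm, h0]
    · simp [hx, hx', hx'']
  · simp [h2.symm]; omega

/-- Multiply the number in the stack `k` by the number in the stack `m`. -/
def mul (k m aux tmp : K) : BitCmd I K :=
  Cmd.seq (loop k (Cmd.seq (pop k) (add m aux tmp))) (move aux k)

theorem run_mul (f : K → List Bool) {k m aux tmp : K} {a n : ℕ} (ha : f k = List.replicate a true)
    (hn : f m = List.replicate n true) (h0 : f aux = []) (h0' : f tmp = [])
    (h1 : k ≠ m) (h2 : k ≠ aux) (h3 : k ≠ tmp) (h4 : m ≠ aux) (h5 : m ≠ tmp) (h6 : aux ≠ tmp) :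
    Run (mul k m aux tmp : BitCmd I K) f (update f k (List.replicate (a * n) true))
      (12 * (a * n) + 4 * a + 2) := by
  have := Run.loop (I := I) (k := k) (c := Cmd.seq (pop k) (add m aux tmp)) (t := 8 * n + 3) a
    (fun i => update (update f aux (List.replicate (i * n) true)) k (List.replicate (a - i) true))
    (fun i hi => by
      refine ⟨by simp; omega, ((run_pop _).seq (run_add _ (n := n) ?_ ?_ h4 h5 h6)).congr ?_
        (by omega)⟩
      · simp [h1.symm, h4, hn]
      · simp [h3.symm, h6.symm, h0']
      · funext x
        by_cases hx : x = k
        · subst hx; simp [h2]; omega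
        by_cases hx' : x = aux
        · subst hx'; simp [h2.symm, Nat.add_mul, add_comm]
        · simp [hx, hx']) (by simp)
  have start : update (update f aux (List.replicate (0 * n) true)) k
      (List.replicate (a - 0) true) = f := by
    funext x
    simp only [Function.update_apply]
    split_ifs <;> simp_all
  rw [start] at this
  refine (this.seq (run_move _ h2.symm)).congr ?_ ?_
  · funext x
    by_cases hx : x = k
    · subst hx; simp [h2, h2.symm]
    by_cases hx' : x = aux
    · subst hx'; simp [hx, h0]
    · simp [hx, hx']
  · simp [h2.symm]; ring_nf; omega

/-- Push the bit at the position given by the number in the stack `k` of the string in the stack `r`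
onto the stack `out`. -/
def lookup (k r mirror out : K) : BitCmd I K :=
  Cmd.seq
    (loop k (Cmd.seq (pop k) (ifNonempty r
      (Cmd.seq (ite r (push mirror true) (push mirror false)) (pop r)) Cmd.skip)))
    (Cmd.seq (ite r (push out true) (push out false)) (move mirror r))

theorem run_ite_push (f : K → List Bool) (r k : K) {b : Bool} (hb : b = ((f r).head? == some true)) :
    Run (ite r (push k true) (push k false) : BitCmd I K) f (update f k (b :: f k)) 2 := by
  subst hb
  by_cases h : (f r).head? = some true
  · obtain ⟨l, hl⟩ := List.head?_eq_some_iff.1 h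
    exact (Run.ite_true hl (run_push _ _)).congr (by simp [h]) le_rfl
  · refine (Run.ite_false h (run_push _ _)).congr ?_ le_rfl
    rw [beq_false_of_ne h]

/-- The first `i` bits are parked on `mirror`, the top is inspected, and the bits are moved back. An
index beyond the end leaves `r` empty and gives `false`, in accordance with `[i]?`. -/
theorem run_lookup (f : K → List Bool) {k r mirror out : K} {i : ℕ}
    (hi : f k = List.replicate i true) (h0 : f mirror = [])
    (h1 : k ≠ r) (h2 : k ≠ mirror) (h3 : k ≠ out) (h4 : r ≠ mirror) (h5 : r ≠ out)
    (h6 : mirror ≠ out) :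
    Run (lookup k r mirror out : BitCmd I K) f
      (update (update f k []) out (((f r)[i]? == some true) :: f out))
      (6 * i + 4 * (f r).length + 4) := by
  have := Run.loop (I := I) (k := k) (c := Cmd.seq (pop k) (ifNonempty r
      (Cmd.seq (ite r (push mirror true) (push mirror false)) (pop r)) Cmd.skip)) (t := 5) i
    (fun j => update (update (update f k (List.replicate (i - j) true)) mirror
      ((f r).take j).reverse) r ((f r).drop j))
    (fun j hj => by
      refine ⟨by simp [h1, h2]; omega, ?_⟩
      by_cases hr : j < (f r).length
      · have hd : (f r).drop j = (f r)[j] :: (f r).drop (j + 1) := by simp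
        have ht : ((f r).take (j + 1)).reverse = (f r)[j] :: ((f r).take j).reverse := by
          rw [List.take_add_one]; simp [hr]
        refine ((run_pop _).seq (Run.ifNonempty_true ?_
          ((run_ite_push _ r mirror (b := (f r)[j]) ?_).seq (run_pop _)))).congr ?_ (by omega)
        · simp [h1.symm]; omega
        · simp [h1.symm, hr]
        · funext x
          by_cases hx : x = k
          · subst hx; simp [h1, h2]; omega
          by_cases hx' : x = mirror
          · subst hx'; simp [h2.symm, h4.symm, ht]
          by_cases hx'' : x = r
          · subst hx''; simp [h1.symm, h4]
          · simp [hx, hx', hx'']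
      · refine ((run_pop _).seq (Run.ifNonempty_false ?_ run_skip)).congr ?_ (by omega)
        · simp [h1.symm]; omega
        · have e1 : (f r).drop j = (f r).drop (j + 1) := by
            rw [List.drop_of_length_le (by omega), List.drop_of_length_le (by omega)]
          have e2 : (f r).take j = (f r).take (j + 1) := by
            rw [List.take_of_length_le (by omega), List.take_of_length_le (by omega)]
          funext x
          by_cases hx : x = k
          · subst hx; simp [h1, h2]; omega
          by_cases hx' : x = mirror
          · subst hx'; simp [h2.symm, h4.symm, e2]
          by_cases hx'' : x = r
          · subst hx''; simp [h1.symm, e1]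
          · simp [hx, hx', hx'']) (by simp [h1, h2])
  have start : update (update (update f k (List.replicate (i - 0) true)) mirror
      ((f r).take 0).reverse) r ((f r).drop 0) = f := by
    funext x
    simp only [Function.update_apply]
    split_ifs <;> simp_all
  rw [start] at this
  refine (this.seq ((run_ite_push _ r out (b := (f r)[i]? == some true) ?_).seq
    (run_move _ h4.symm))).congr ?_ ?_
  · simp [List.head?_drop]
  · funext x
    by_cases hx : x = k
    · subst hx; simp [h1, h2, h3]
    by_cases hx' : x = mirror
    · subst hx'; simp [hx, h6, h0]
    by_cases hx'' : x = r
    · subst hx''; simp [hx, h4.symm, h5, h6, h4]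
    by_cases hx3 : x = out
    · subst hx3; simp [h3.symm, h5.symm, h6.symm]
    · simp [hx, hx', hx'', hx3]
  · simp [h4.symm, h6]; omega

/-- Push the result of the comparison `<` of the numbers in the stacks `i` and `j` onto `out`. -/
def less (i j acc aux tmp out : K) : BitCmd I K :=
  Cmd.seq (add i acc tmp) (Cmd.seq (add j aux tmp) (Cmd.seq
    (loop acc (Cmd.seq (pop acc) (pop aux)))
    (Cmd.seq (ite aux (push out true) (push out false)) (clear aux))))

/-- Copies of both numbers are decremented in parallel until the first is zero; by truncated
subtraction the second is then nonzero exactly if `a < b`. -/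
theorem run_less (f : K → List Bool) {i j acc aux tmp out : K} {a b : ℕ}
    (ha : f i = List.replicate a true) (hb : f j = List.replicate b true)
    (h0 : f acc = []) (h1 : f aux = []) (h2 : f tmp = [])
    (h3 : i ≠ acc) (h4 : i ≠ tmp) (h5 : j ≠ aux) (h6 : j ≠ tmp) (h7 : j ≠ acc)
    (h8 : acc ≠ aux) (h9 : acc ≠ tmp) (h10 : aux ≠ tmp) (h11 : acc ≠ out) (h12 : aux ≠ out) :
    Run (less i j acc aux tmp out : BitCmd I K) f (update f out (decide (a < b) :: f out))
      (11 * a + 10 * b + 8) := by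
  set f1 := update f acc (List.replicate a true)
  set f2 := update f1 aux (List.replicate b true)
  have e1 : Run (add i acc tmp : BitCmd I K) f f1 (8 * a + 2) :=
    (run_add f ha h2 h3 h4 h9).congr (by simp [h0, f1]) le_rfl
  have e2 : Run (add j aux tmp : BitCmd I K) f1 f2 (8 * b + 2) :=
    (run_add f1 (by simp [f1, h7, hb]) (by simp [f1, h9.symm, h2]) h5 h6 h10).congr
      (by simp [h1, f2, f1, h8.symm]) le_rfl
  have e3 := Run.loop (I := I) (k := acc) (c := Cmd.seq (pop acc) (pop aux)) (t := 2) a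
    (fun n => update (update f acc (List.replicate (a - n) true)) aux
      (List.replicate (b - n) true))
    (fun n hn => by
      refine ⟨by simp [h8]; omega, ((run_pop _).seq (run_pop _)).congr ?_ le_rfl⟩
      funext x
      by_cases hx : x = acc
      · subst hx; simp [h8]; omega
      by_cases hx' : x = aux
      · subst hx'; simp [h8.symm]; omega
      · simp [hx, hx']) (by simp [h8])
  refine (e1.seq (e2.seq (Run.seq e3 ((run_ite_push _ aux out (b := decide (a < b)) ?_).seq
    (run_clear _ _))))).congr ?_ ?_
  · by_cases hab : a < b
    · have : b - a = (b - a - 1) + 1 := by omega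
      simp only [Function.update_self, hab, decide_true]
      rw [this]; simp [List.replicate_succ]
    · have : b - a = 0 := by omega
      simp [hab, this]
  · funext x
    by_cases hx : x = acc
    · subst hx; simp [h8, h0, h11]
    by_cases hx' : x = aux
    · subst hx'; simp [h1, h12]
    by_cases hx'' : x = out
    · subst hx''; simp [h11.symm, h12.symm]
    · simp [hx, hx', hx'']
  · simp [h12]; omega

end BitCmd

end CRPQContainment

namespace CRPQContainment

open Function (update)

/-! ### First-order formulas over strings of bits -/

/-- First-order formulas with `k` free variables that range over numbers. The strings `r : ρ` of
bits are looked up at the positions `horner N c vs`, where `N` is the size of the domain. -/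
inductive Formula (ρ : Type) : ℕ → Type
  | bit {k : ℕ} (r : ρ) (c : ℕ) (vs : List (Fin k)) : Formula ρ k
  | less {k : ℕ} (i j : Fin k) : Formula ρ k
  | neg {k : ℕ} (φ : Formula ρ k) : Formula ρ k
  | and {k : ℕ} (φ ψ : Formula ρ k) : Formula ρ k
  | ex {k : ℕ} (φ : Formula ρ (k + 1)) : Formula ρ k

/-- A structure for formulas: the domain is `{0, …, size - 1}`. -/
structure BitStructure (ρ : Type) where
  size : ℕ
  bits : ρ → List Bool

/-- The number with leading digit `c` and further digits `l` in base `N`. -/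
def horner (N c : ℕ) (l : List ℕ) : ℕ :=
  l.foldl (fun a v => a * N + v) c

namespace Formula

variable {ρ : Type}

def eval (I : BitStructure ρ) : {k : ℕ} → Formula ρ k → (Fin k → ℕ) → Prop
  | _, bit r c vs, e => (I.bits r)[horner I.size c (vs.map e)]? = some true
  | _, less i j, e => e i < e j
  | _, neg φ, e => ¬ φ.eval I e
  | _, and φ ψ, e => φ.eval I e ∧ ψ.eval I e
  | k, ex φ, e => ∃ a < I.size, φ.eval I (Fin.snoc (α := fun _ : Fin (k + 1) => ℕ) e a)

def depth : {k : ℕ} → Formula ρ k → ℕ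
  | _, bit _ _ _ => 0
  | _, less _ _ => 0
  | _, neg φ => φ.depth
  | _, and φ ψ => max φ.depth ψ.depth
  | _, ex φ => φ.depth + 1

end Formula

/-- The bit stacks of the machine that evaluates formulas of depth at most `D`. -/
inductive Register (ρ : Type) (D : ℕ)
  | out
  | bits (r : ρ)
  | mirror (r : ρ)
  | var (v : Fin (D + 1))
  | counter (v : Fin (D + 1))
  | size
  | base
  | acc
  | aux
  | tmp
  deriving DecidableEq, Fintype

namespace Formula

open BitCmd

variable {ρ I : Type} {D : ℕ}

/-- The stack of the variable with number `v`. -/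
def reg (D v : ℕ) : Register ρ D := .var (Fin.ofNat (D + 1) v)

/-- The stack of the loop counter for the variable with number `v`. -/
def ctr (D v : ℕ) : Register ρ D := .counter (Fin.ofNat (D + 1) v)

/-- Numbers of variables are reduced modulo `D + 1`, so stacks are distinct only up to `D`; this is
why the depth of formulas is bounded by `D`. -/
theorem reg_inj {v w : ℕ} (hv : v ≤ D) (hw : w ≤ D) : (reg D v : Register ρ D) = reg D w ↔ v = w := by
  simp [reg, Fin.ext_iff, Nat.mod_eq_of_lt (Nat.lt_succ_of_le hv),
    Nat.mod_eq_of_lt (Nat.lt_succ_of_le hw)]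

theorem ctr_inj {v w : ℕ} (hv : v ≤ D) (hw : w ≤ D) : (ctr D v : Register ρ D) = ctr D w ↔ v = w := by
  simp [ctr, Fin.ext_iff, Nat.mod_eq_of_lt (Nat.lt_succ_of_le hv),
    Nat.mod_eq_of_lt (Nat.lt_succ_of_le hw)]

theorem reg_ne_ctr (v w : ℕ) : (reg D v : Register ρ D) ≠ ctr D w := nofun

theorem reg_ne_out (v : ℕ) : (reg D v : Register ρ D) ≠ .out := nofun

theorem out_ne_ctr (v : ℕ) : Register.out ≠ (ctr D v : Register ρ D) := nofun

variable [DecidableEq ρ]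

def pushes {K : Type} (k : K) : ℕ → BitCmd I K
  | 0 => .skip
  | n + 1 => .seq (BitCmd.push k true) (pushes k n)

theorem run_pushes {K : Type} [DecidableEq K] (k : K) : ∀ (n : ℕ) (f : K → List Bool),
    Run (pushes k n : BitCmd I K) f (update f k (List.replicate n true ++ f k)) (n + 1)
  | 0, f => run_skip.congr (by simp) le_rfl
  | n + 1, f => ((run_push k true).seq (run_pushes k n _)).congr
      (by simp [List.replicate_succ', ]) (by omega)

/-- Multiply the accumulator by the size of the domain and add a number. -/
def hornerStep (k : Register ρ D) : BitCmd I (Register ρ D) :=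
  .seq (mul .acc .size .aux .tmp) (BitCmd.add k .acc .tmp)

def hornerSteps : List (Register ρ D) → BitCmd I (Register ρ D)
  | [] => .skip
  | k :: l => .seq (hornerStep k) (hornerSteps l)

/-- The program that pushes the truth value of a formula onto the stack `out`. -/
def prog (D : ℕ) : {k : ℕ} → Formula ρ k → BitCmd I (Register ρ D)
  | _, bit r c vs => .seq (pushes .acc c) (.seq (hornerSteps (vs.map fun v => reg D v.val))
      (lookup .acc (.bits r) (.mirror r) .out))
  | _, less i j => BitCmd.less (reg D i) (reg D j) .acc .aux .tmp .out
  | _, neg φ => .seq (prog D φ)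
      (BitCmd.ite .out (.seq (BitCmd.pop .out) (BitCmd.push .out false))
        (.seq (BitCmd.pop .out) (BitCmd.push .out true)))
  | _, and φ ψ => .seq (prog D φ) (.seq (prog D ψ)
      (BitCmd.ite .out (BitCmd.pop .out)
        (.seq (BitCmd.pop .out) (.seq (BitCmd.pop .out) (BitCmd.push .out false)))))
  | k, ex φ => .seq (BitCmd.push .out false) (.seq (BitCmd.add .size (ctr D k) .tmp) (.seq
      (BitCmd.loop (ctr D k) (.seq (BitCmd.pop (ctr D k)) (.seq (prog D φ) (.seq
        (BitCmd.ite .out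
          (.seq (BitCmd.pop .out) (.seq (BitCmd.pop .out) (BitCmd.push .out true)))
          (BitCmd.pop .out))
        (BitCmd.push (reg D k) true)))))
      (clear (reg D k))))

/-- The stacks `f` represent the structure `S` and the values `e` of the free variables. -/
structure Represents (S : BitStructure ρ) {k : ℕ} (e : Fin k → ℕ)
    (f : Register ρ D → List Bool) : Prop where
  bits : ∀ r, f (.bits r) = S.bits r
  mirror : ∀ r, f (.mirror r) = []
  size : f .size = List.replicate S.size true
  acc : f .acc = []
  aux : f .aux = []
  tmp : f .tmp = []
  var : ∀ i : Fin k, f (reg D i) = List.replicate (e i) true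
  var_free : ∀ v, k ≤ v → v ≤ D → f (reg D v) = []
  counter_free : ∀ v, k ≤ v → v ≤ D → f (ctr D v) = []

theorem Represents.update_out {S : BitStructure ρ} {k : ℕ} {e : Fin k → ℕ}
    {f : Register ρ D → List Bool} (h : Represents S e f) (l : List Bool) :
    Represents S e (update f .out l) where
  bits r := by simpa using h.bits r
  mirror r := by simpa using h.mirror r
  size := by simpa using h.size
  acc := by simpa using h.acc
  aux := by simpa using h.aux
  tmp := by simpa using h.tmp
  var i := by simpa [reg] using h.var i
  var_free v hv hv' := by simpa [reg] using h.var_free v hv hv'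
  counter_free v hv hv' := by simpa [ctr] using h.counter_free v hv hv'

theorem run_hornerStep (f : Register ρ D → List Bool) {k : Register ρ D} {a n v : ℕ}
    (ha : f .acc = List.replicate a true) (hn : f .size = List.replicate n true)
    (h0 : f .aux = []) (h0' : f .tmp = []) (hk : f k = List.replicate v true)
    (h1 : k ≠ .acc) (h2 : k ≠ .tmp) :
    Run (hornerStep k : BitCmd I (Register ρ D)) f
      (update f .acc (List.replicate (a * n + v) true)) (12 * (a * n) + 4 * a + 8 * v + 4) := by
  refine ((run_mul f ha hn h0 h0' nofun nofun nofun nofun nofun nofun).seq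
    (run_add _ (n := v) ?_ ?_ h1 h2 nofun)).congr ?_ ?_
  · simp [h1, hk]
  · simp [h0']
  · simp [add_comm]
  · omega

/-- The bound on the value is proved along with the run, since unary arithmetic takes time
proportional to the numbers involved. One step turns `a + 1` into at most `(a + 1) * (n + 1)`. -/
theorem run_hornerSteps {n : ℕ} : ∀ (l : List (Register ρ D)) (f : Register ρ D → List Bool)
    (val : Register ρ D → ℕ) (a : ℕ),
    f .acc = List.replicate a true → f .size = List.replicate n true →
    f .aux = [] → f .tmp = [] → (∀ k ∈ l, f k = List.replicate (val k) true) →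
    (∀ k ∈ l, val k < n) → (∀ k ∈ l, k ≠ .acc ∧ k ≠ .tmp) →
    horner n a (l.map val) ≤ (a + 1) * (n + 1) ^ l.length ∧
    Run (hornerSteps l : BitCmd I (Register ρ D)) f
      (update f .acc (List.replicate (horner n a (l.map val)) true))
      (l.length * (30 * ((a + 1) * (n + 1) ^ l.length)) + 1)
  | [], f, val, a, ha, _, _, _, _, _, _ => by
    refine ⟨by simp [horner], run_skip.congr ?_ (by simp)⟩
    simp [horner, ← ha]
  | k :: l, f, val, a, ha, hn, h0, h0', hf, hv, hk => by
    have hkk := hk k (by simp)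
    have hvk := hv k (by simp)
    obtain ⟨i1, i2⟩ := run_hornerSteps l (update f .acc (List.replicate (a * n + val k) true)) val
      (a * n + val k) (by simp) (by simpa using hn) (by simpa using h0) (by simpa using h0')
      (fun k' hk' => by simpa [(hk k' (by simp [hk'])).1] using hf k' (by simp [hk']))
      (fun k' hk' => hv k' (by simp [hk'])) (fun k' hk' => hk k' (by simp [hk']))
    have hle : (a * n + val k + 1) ≤ (a + 1) * (n + 1) := by nlinarith
    have hle' : (a * n + val k + 1) * (n + 1) ^ l.length ≤ (a + 1) * (n + 1) ^ (l.length + 1) := by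
      calc _ ≤ (a + 1) * (n + 1) * (n + 1) ^ l.length := Nat.mul_le_mul_right _ hle
        _ = _ := by ring
    refine ⟨i1.trans hle', ((run_hornerStep f ha hn h0 h0' (hf k (by simp)) hkk.1 hkk.2).seq
      i2).congr ?_ ?_⟩
    · simp [horner]
    · have h3 : (a + 1) * (n + 1) ≤ (a + 1) * (n + 1) ^ (l.length + 1) :=
        Nat.mul_le_mul_left _ (Nat.le_self_pow (by omega) _)
      have h4 : 12 * (a * n) + 4 * a + 8 * val k + 4 ≤ 30 * ((a + 1) * (n + 1)) := by nlinarith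
      have h5 := Nat.mul_le_mul_left (l.length * 30) hle'
      simp only [List.length_cons]
      nlinarith

/-- The program for the formula `φ` is correct and runs in polynomial time. -/
def ProgCorrect (I : Type) (D : ℕ) {k : ℕ} (φ : Formula ρ k) : Prop :=
  ∃ p : Polynomial ℕ,
    ∀ (M : ℕ) (S : BitStructure ρ) (e : Fin k → ℕ) (f : Register ρ D → List Bool),
      S.size ≤ M → (∀ r, (S.bits r).length ≤ M) → (∀ i, e i < S.size) → Represents S e f →
      ∃ b : Bool, (b = true ↔ φ.eval S e) ∧
        Run (prog D φ : BitCmd I (Register ρ D)) f (update f .out (b :: f .out)) (p.eval M)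

theorem progCorrect_bit {k : ℕ} (r : ρ) (c : ℕ) (vs : List (Fin k)) :
    ProgCorrect I D (bit r c vs) := by
  refine ⟨(Polynomial.C (vs.length * 30 + 6) * (Polynomial.C (c + 1) *
    (Polynomial.X + 1) ^ vs.length)) + 4 * Polynomial.X + Polynomial.C (c + 6),
    fun M S e f hN hM he hf => ⟨_, beq_iff_eq, ?_⟩⟩
  have hrl : ∀ v : Fin k, (f (reg D v)).length = e v := fun v => by simp [hf.var]
  obtain ⟨i1, i2⟩ := run_hornerSteps (I := I) (n := S.size) (vs.map fun v => reg D v.val)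
    (update f .acc (List.replicate c true)) (fun x => (f x).length) c
    (by simp) (by simpa using hf.size) (by simpa using hf.aux) (by simpa using hf.tmp)
    (fun x hx => by
      obtain ⟨v, -, rfl⟩ := List.mem_map.1 hx
      have h2 : (reg D v : Register ρ D) ≠ .acc := nofun
      rw [Function.update_of_ne h2, hrl, hf.var])
    (fun x hx => by
      obtain ⟨v, -, rfl⟩ := List.mem_map.1 hx
      simpa [hrl] using he v)
    (fun x hx => by
      obtain ⟨v, -, rfl⟩ := List.mem_map.1 hx
      simp [reg])
  have hv : (List.map (fun v : Fin k => (reg D v : Register ρ D)) vs).map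
      (fun x => (f x).length) = vs.map e := by simp [hrl, Function.comp_def]
  rw [hv] at i1 i2
  simp only [List.length_map] at i1 i2
  have i3 : (c + 1) * (S.size + 1) ^ vs.length ≤ (c + 1) * (M + 1) ^ vs.length :=
    Nat.mul_le_mul_left _ (Nat.pow_le_pow_left (by omega) _)
  have i4 := hM r
  have i0 := run_pushes (I := I) Register.acc c f
  rw [hf.acc, List.append_nil] at i0
  refine (i0.seq (i2.seq (run_lookup _ (k := .acc) (r := .bits r)
    (mirror := .mirror r) (out := .out) (i := horner S.size c (vs.map e)) (by simp) ?_ nofun nofun nofun nofun nofun nofun))).congr ?_ ?_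
  · simp [hf.mirror]
  · simp [hf.bits, ← hf.acc]
  · have i5 : (S.bits r).length ≤ M := hM r
    simp only [ne_eq, reduceCtorEq, not_false_eq_true,
      Function.update_of_ne, hf.bits, Polynomial.eval_add, Polynomial.eval_mul, Polynomial.eval_C,
      Polynomial.eval_pow, Polynomial.eval_X, Polynomial.eval_one, Polynomial.eval_ofNat]
    have i6 := Nat.mul_le_mul_left (vs.length * 30) i3
    nlinarith

theorem progCorrect_less {k : ℕ} (i j : Fin k) : ProgCorrect (ρ := ρ) I D (less i j) := by
  refine ⟨11 * Polynomial.X + 10 * Polynomial.X + 8, fun M S e f hN hM he hf =>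
    ⟨decide (e i < e j), by simp [eval], ?_⟩⟩
  refine (run_less f (out := .out) (hf.var i) (hf.var j) hf.acc hf.aux hf.tmp (by simp [reg])
    (by simp [reg]) (by simp [reg]) (by simp [reg]) (by simp [reg]) nofun nofun nofun nofun
    nofun).mono ?_
  have := he i
  have := he j
  simp
  omega

theorem progCorrect_neg {k : ℕ} {φ : Formula ρ k} (h : ProgCorrect I D φ) :
    ProgCorrect I D (neg φ) := by
  obtain ⟨p, hp⟩ := h
  refine ⟨p + 3, fun M S e f hN hM he hf => ?_⟩
  obtain ⟨b, hb, hr⟩ := hp M S e f hN hM he hf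
  refine ⟨!b, by simp [eval, ← hb], ?_⟩
  cases b with
  | true =>
    exact (hr.seq (Run.ite_true (l := f .out) (by simp) ((run_pop _).seq (run_push _ _)))).congr
      (by simp) (by simp)
  | false =>
    exact (hr.seq (Run.ite_false (by simp) ((run_pop _).seq (run_push _ _)))).congr
      (by simp) (by simp)

theorem progCorrect_and {k : ℕ} {φ ψ : Formula ρ k} (h : ProgCorrect I D φ)
    (h' : ProgCorrect I D ψ) : ProgCorrect I D (and φ ψ) := by
  obtain ⟨p, hp⟩ := h
  obtain ⟨q, hq⟩ := h'
  refine ⟨p + q + 4, fun M S e f hN hM he hf => ?_⟩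
  obtain ⟨b, hb, hr⟩ := hp M S e f hN hM he hf
  obtain ⟨b', hb', hr'⟩ := hq M S e _ hN hM he (hf.update_out (b :: f .out))
  refine ⟨b && b', by simp [eval, ← hb, ← hb'], ?_⟩
  cases b' with
  | true =>
    exact (hr.seq (hr'.seq (Run.ite_true (l := b :: f .out) (by simp) (run_pop _)))).congr
      (by simp) (by simp; omega)
  | false =>
    exact (hr.seq (hr'.seq (Run.ite_false (by simp)
      ((run_pop _).seq ((run_pop _).seq (run_push _ _)))))).congr
      (by simp) (by simp; omega)

/-- The variable bound by a quantifier in a formula with `k` free variables has number `k`, and its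
stacks are free. The changes to `out` and to the loop counter do not affect the representation. -/
theorem Represents.snoc {S : BitStructure ρ} {k : ℕ} {e : Fin k → ℕ}
    {f : Register ρ D → List Bool} (hf : Represents S e f) (hkD : k < D) (a : ℕ) (l l' : List Bool) :
    Represents S (Fin.snoc (α := fun _ : Fin (k + 1) => ℕ) e a)
      (update (update (update f (ctr D k) l) .out l') (reg D k) (List.replicate a true)) := by
  have hvne : ∀ v, v ≤ D → v ≠ k → (reg D v : Register ρ D) ≠ reg D k := fun v hv hvk h =>
    hvk ((reg_inj hv hkD.le).1 h)
  have hcne : ∀ v, v ≤ D → v ≠ k → (ctr D v : Register ρ D) ≠ ctr D k := fun v hv hvk h =>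
    hvk ((ctr_inj hv hkD.le).1 h)
  refine ⟨?_, ?_, ?_, ?_, ?_, ?_, ?_, ?_, ?_⟩
  · intro r; simpa [ctr, reg] using hf.bits r
  · intro r; simpa [ctr, reg] using hf.mirror r
  · simpa [ctr, reg] using hf.size
  · simpa [ctr, reg] using hf.acc
  · simpa [ctr, reg] using hf.aux
  · simpa [ctr, reg] using hf.tmp
  · intro v
    refine Fin.lastCases ?_ (fun v => ?_) v
    · simp
    · have h1 := hvne v (by omega) (by omega)
      simp [reg_ne_ctr, h1, reg_ne_out, hf.var]
  · intro v hv hv'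
    have h1 := hvne v (by omega) (by omega)
    simp [reg_ne_ctr, h1, reg_ne_out, hf.var_free v (by omega) hv']
  · intro v hv hv'
    have h1 := hcne v (by omega) (by omega)
    simp [(reg_ne_ctr _ _).symm, h1, (out_ne_ctr _).symm, hf.counter_free v (by omega) hv']

theorem progCorrect_ex {k : ℕ} {φ : Formula ρ (k + 1)} (h : ProgCorrect I D φ) (hkD : k < D) :
    ProgCorrect I D (ex φ) := by
  obtain ⟨p, hp⟩ := h
  refine ⟨Polynomial.X * (p + 8) + 10 * Polynomial.X + 10, fun M S e f hN hM he hf => ?_⟩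
  classical
  set P : ℕ → Bool := fun a => decide (φ.eval S (Fin.snoc (α := fun _ : Fin (k + 1) => ℕ) e a))
    with hP
  let any : ℕ → Bool := fun a => decide (∃ b < a, P b = true)
  -- The configuration after the values below `a` have been tried: the top of `out` records whether
  -- one of them was a witness.
  let g : ℕ → Register ρ D → List Bool := fun a =>
    update (update (update f (ctr D k) (List.replicate (S.size - a) true))
      .out (any a :: f .out)) (reg D k) (List.replicate a true)
  have hco := out_ne_ctr (ρ := ρ) (D := D) k
  have hro := reg_ne_out (ρ := ρ) (D := D) k
  have hrc := reg_ne_ctr (ρ := ρ) (D := D) k k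
  have hbody : ∀ i < S.size, g i (ctr D k) ≠ [] ∧ Run (I := I)
      (.seq (BitCmd.pop (ctr D k)) (.seq (prog D φ) (.seq
      (BitCmd.ite .out
        (.seq (BitCmd.pop .out) (.seq (BitCmd.pop .out) (BitCmd.push .out true)))
        (BitCmd.pop .out))
      (BitCmd.push (reg D k) true)))) (g i) (g (i + 1)) (p.eval M + 6) := by
    intro i hi
    refine ⟨by simp [g, hco.symm, hrc.symm]; omega, ?_⟩
    let g' := update (update (update f (ctr D k) (List.replicate (S.size - (i + 1)) true))
      .out (any i :: f .out)) (reg D k) (List.replicate i true)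
    have hpop : Run (I := I) (BitCmd.pop (ctr D k)) (g i) g' 1 := by
      refine (run_pop _).congr ?_ le_rfl
      funext x
      by_cases hx : x = ctr D k
      · subst hx; simp [g, g', hco.symm, hrc.symm]; omega
      by_cases hx' : x = .out
      · subst hx'; simp [g, g', hco, hro.symm]
      by_cases hx'' : x = reg D k
      · subst hx''; simp [g, g', hrc]
      · simp [g, g', hx, hx', hx'']
    obtain ⟨b, hb, hr⟩ := hp M S _ _ hN hM (fun v => by
      refine Fin.lastCases ?_ (fun v => ?_) v
      · simpa using hi
      · simpa using he v) (hf.snoc hkD i (List.replicate (S.size - (i + 1)) true) (any i :: f .out))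
    have hPb : b = P i := by
      rw [Bool.eq_iff_iff, hb]; simp [P]
    have hany : any (i + 1) = (any i || b) := by
      rw [Bool.eq_iff_iff]
      simp only [any, hPb, decide_eq_true_iff, Bool.or_eq_true]
      exact Nat.exists_lt_succ_right
    have hgi : g (i + 1) = update (update g' .out ((any i || b) :: f .out)) (reg D k)
        (true :: g' (reg D k)) := by
      rw [← hany]
      funext x
      by_cases hx : x = reg D k
      · subst hx; simp [g, g', List.replicate_succ]
      by_cases hx' : x = .out
      · subst hx'; simp [g, g', hro.symm]
      by_cases hx'' : x = ctr D k
      · subst hx''; simp [g, g', hx, hx']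
      · simp [g, g', hx, hx', hx'']
    rw [hgi]
    have hout : g' .out = any i :: f .out := by simp [g', hro.symm]
    cases b with
    | true =>
      refine (hpop.seq (hr.seq ((Run.ite_true (l := g' .out) (by simp [g'])
        ((run_pop _).seq ((run_pop _).seq (run_push _ _)))).seq (run_push _ _)))).congr
        ?_ (by omega)
      rw [show (update (update (update f (ctr D k) (List.replicate (S.size - (i + 1)) true))
      .out (any i :: f .out)) (reg D k) (List.replicate i true)) = g' from rfl]
      simp [hout, hro]
    | false =>
      refine (hpop.seq (hr.seq ((Run.ite_false (by simp)
        (run_pop _)).seq (run_push _ _)))).congr ?_ (by omega)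
      rw [show (update (update (update f (ctr D k) (List.replicate (S.size - (i + 1)) true))
      .out (any i :: f .out)) (reg D k) (List.replicate i true)) = g' from rfl]
      simp [hout, hro]
  have hloop := Run.loop (I := I) S.size g hbody (by simp [g, hco.symm, hrc.symm])
  refine ⟨any S.size, by simp [any, P, eval], ?_⟩
  refine ((run_push _ false).seq (((run_add _ (k := .size) (k' := ctr D k) (tmp := .tmp)
    (n := S.size) ?_ ?_ nofun nofun nofun).congr
    (g' := g 0) ?_ le_rfl).seq
    (Run.seq (f := g 0) hloop (run_clear _ _)))).congr ?_ ?_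
  · simpa using hf.size
  · simpa using hf.tmp
  · funext x
    by_cases hx : x = reg D k
    · subst hx; simp [g, hro, hrc, hf.var_free k le_rfl hkD.le]
    by_cases hx' : x = .out
    · subst hx'; simp [g, hro.symm, hco, any]
    by_cases hx'' : x = ctr D k
    · subst hx''; simp [g, hx, hx', hf.counter_free k le_rfl hkD.le]
    · simp [g, hx, hx', hx'']
  · funext x
    by_cases hx : x = reg D k
    · subst hx; simp [g, hro, hf.var_free k le_rfl hkD.le]
    by_cases hx' : x = .out
    · subst hx'; simp [g, hro.symm]
    by_cases hx'' : x = ctr D k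
    · subst hx''; simp [g, hx, hx', hf.counter_free k le_rfl hkD.le]
    · simp [g, hx, hx', hx'']
  · have := Nat.mul_le_mul_right (p.eval M + 8) hN
    simp [g]
    nlinarith

theorem progCorrect : ∀ {k : ℕ} (φ : Formula ρ k), k + φ.depth ≤ D → ProgCorrect I D φ
  | _, bit r c vs, _ => progCorrect_bit r c vs
  | _, less i j, _ => progCorrect_less i j
  | _, neg φ, h => progCorrect_neg (progCorrect φ h)
  | _, and φ ψ, h =>
    have h : _ + max φ.depth ψ.depth ≤ D := h
    progCorrect_and (progCorrect φ (by omega)) (progCorrect ψ (by omega))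
  | k, ex φ, h =>
    have h : k + (φ.depth + 1) ≤ D := h
    progCorrect_ex (progCorrect φ (by omega)) (by omega)

end Formula

end CRPQContainment

namespace CRPQContainment

open Function (update)
open Turing BitCmd

/-! ### The machine that evaluates a formula on a word and two certificates -/

namespace Cmd

variable {K : Type} {Γ : K → Type} {α : Type}

theorem Exec.congr [DecidableEq K] {c : Cmd Γ} {s s' s'' : ∀ k, List (Γ k)} {t t' : ℕ}
    (h : Exec c s s' t) (hs : s' = s'') (ht : t ≤ t') : Exec c s s'' t' :=
  hs ▸ h.weaken ht

/-- Run `c a` for all `a` in a list. -/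
def each (c : α → Cmd Γ) : List α → Cmd Γ
  | [] => skip
  | a :: l => seq (c a) (each c l)

/-- Configurations are indexed by the part of the list that has been processed, in analogy to
`Run.loop`. -/
theorem exec_each [DecidableEq K] {c : α → Cmd Γ} {t : ℕ} (F : List α → ∀ k, List (Γ k)) :
    ∀ (l pre : List α), (∀ p a q, p ++ a :: q = pre ++ l → Exec (c a) (F p) (F (p ++ [a])) t) →
      Exec (each c l) (F pre) (F (pre ++ l)) (l.length * t + 1)
  | [], pre, _ => by simpa [each] using Exec.skip (F pre)
  | a :: l, pre, h => by
    have h1 := exec_each F l (pre ++ [a]) (fun p b q hp => h p b q (by simpa using hp))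
    have h2 := (h pre a l rfl).seq h1
    simp only [List.append_assoc, List.singleton_append] at h2
    refine h2.weaken ?_
    simp only [List.length_cons]
    ring_nf
    omega

end Cmd

theorem BitCmd.run_each {I K α : Type} [DecidableEq K] {c : α → BitCmd I K} {t : ℕ}
    (F : List α → K → List Bool) (l : List α)
    (h : ∀ p a q, p ++ a :: q = l → Run (c a) (F p) (F (p ++ [a])) t) :
    Run (Cmd.each c l) (F []) (F l) (l.length * t + 1) := by
  intro s
  exact Cmd.exec_each (fun p => bitStacks s (F p)) l [] (fun p a q hp => h p a q (by simpa using hp) s)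

/-- The structure in which formulas about the word `x` and the certificates `y` and `z` are
evaluated. -/
def wordStructure {Γ : Type} [DecidableEq Γ] (d : ℕ) (x : List Γ) (y z : List Bool) :
    BitStructure (Γ ⊕ Bool) where
  size := (x.length + 2) ^ d
  bits
    | .inl a => x.map fun c => decide (c = a)
    | .inr false => y
    | .inr true => z

namespace Formula

variable {Γ : Type} [DecidableEq Γ] {D : ℕ}

abbrev InputSymbol (Γ : Type) : Type := Option (Γ ⊕ Bool)

abbrev Program (Γ : Type) (D : ℕ) : Type := BitCmd (InputSymbol Γ) (Register (Γ ⊕ Bool) D)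

/-- Record whether the next input symbol is `q`. -/
def mark (r q : Γ ⊕ Bool) : Program Γ D :=
  Cmd.ite none (fun o : Option (InputSymbol Γ) => decide (o = some (some q))) (BitCmd.push (.mirror r) true)
    (BitCmd.push (.mirror r) false)

theorem exec_mark (r q : Γ ⊕ Bool) (c : InputSymbol Γ) (s : List (InputSymbol Γ))
    (f : Register (Γ ⊕ Bool) D → List Bool) :
    Cmd.Exec (mark r q : Program Γ D) (bitStacks (c :: s) f)
      (bitStacks (c :: s) (update f (.mirror r) (decide (c = some q) :: f (.mirror r)))) 2 := by
  by_cases h : c = some q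
  · refine Cmd.Exec.ite_true (by simp [bitStacks, h]) ?_
    have := run_push (I := InputSymbol Γ) (f := f) (.mirror r) true (c :: s)
    simpa [h] using this
  · refine Cmd.Exec.ite_false (by simp [bitStacks, h]) ?_
    have := run_push (I := InputSymbol Γ) (f := f) (.mirror r) false (c :: s)
    simpa [h] using this

/-- Read input symbols up to the next separator. -/
def read (c : Program Γ D) : Program Γ D :=
  -- By `getD none` the end of the input acts as a separator, which is needed for the second
  -- certificate.
  Cmd.loop none (fun o : Option (InputSymbol Γ) => (o.getD none).isSome) (Cmd.seq c (Cmd.pop none))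

theorem exec_read {c : Program Γ D} {t : ℕ} {s : List (InputSymbol Γ)}
    (hs : s.head?.getD none = none) :
    ∀ (l : List (Γ ⊕ Bool)) (F : List (Γ ⊕ Bool) → Register (Γ ⊕ Bool) D → List Bool),
    (∀ p a q, p ++ a :: q = l → ∀ s, Cmd.Exec c (bitStacks (some a :: s) (F p))
      (bitStacks (some a :: s) (F (p ++ [a]))) t) →
    Cmd.Exec (read c) (bitStacks (l.map some ++ s) (F [])) (bitStacks s (F l))
      (l.length * (t + 2) + 1)
  | [], F, _ => (Cmd.Exec.loop_false (by simp [bitStacks, hs])).weaken (by simp)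
  | a :: l, F, h => by
    have h1 := exec_read (t := t) hs l (fun p => F (a :: p))
      (fun p b q hp => h (a :: p) b q (by simp [hp]))
    have h2 : Cmd.Exec (Cmd.pop none : Program Γ D) (bitStacks (some a :: (l.map some ++ s)) (F [a]))
        (bitStacks (l.map some ++ s) (F [a])) 1 := by
      have := Cmd.Exec.pop (Γ := Alphabet (InputSymbol Γ) (K := Register (Γ ⊕ Bool) D)) none
        (bitStacks (some a :: (l.map some ++ s)) (F [a]))
      rwa [update_bitStacks_none] at this
    refine (Cmd.Exec.loop_true (by simp [bitStacks]) ((h [] a l rfl _).seq h2) h1).weaken ?_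
    simp only [List.length_cons]
    ring_nf
    omega

/-- Read the certificate number `i`. -/
def readBits (Γ : Type) [DecidableEq Γ] (D : ℕ) (i : Bool) : Program Γ D :=
  read (mark (.inr i) (.inr true))

theorem exec_readBits (i : Bool) (y : List Bool) (s : List (InputSymbol Γ))
    (hs : s.head?.getD none = none) (f : Register (Γ ⊕ Bool) D → List Bool) :
    Cmd.Exec (readBits Γ D i) (bitStacks ((y.map Sum.inr).map some ++ s) f)
      (bitStacks s (update f (.mirror (.inr i)) (y.reverse ++ f (.mirror (.inr i)))))
      (y.length * 4 + 1) := by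
  let F : List (Γ ⊕ Bool) → Register (Γ ⊕ Bool) D → List Bool := fun p =>
    update f (.mirror (.inr i)) ((p.map fun c => decide (c = .inr true)).reverse ++ f (.mirror (.inr i)))
  have h := exec_read (t := 2) (c := mark (.inr i) (.inr true)) hs (y.map Sum.inr) F ?_
  · simp only [List.map_nil, List.reverse_nil, List.nil_append, Function.update_eq_self, F] at h
    exact h.congr (by simp [Function.comp_def]) (by simp)
  · intro p a q _ s
    have h1 := exec_mark (.inr i) (.inr true) (some a) s (F p)
    exact h1.congr (by simp [F]) le_rfl

theorem exec_separator {s : List (InputSymbol Γ)} (f : Register (Γ ⊕ Bool) D → List Bool) :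
    Cmd.Exec (Cmd.pop none : Program Γ D) (bitStacks (none :: s) f) (bitStacks s f) 1 := by
  have := Cmd.Exec.pop (Γ := Alphabet (InputSymbol Γ) (K := Register (Γ ⊕ Bool) D)) none
    (bitStacks (none :: s) f)
  rwa [update_bitStacks_none] at this

/-- Compute the `d`-th power of the number in the stack `base`. -/
def power {Γ : Type} {D : ℕ} [DecidableEq Γ] : ℕ → Program Γ D
  | 0 => BitCmd.push .size true
  | d + 1 => Cmd.seq (power d) (mul .size .base .aux .tmp)

theorem run_power (n : ℕ) : ∀ (d : ℕ) (f : Register (Γ ⊕ Bool) D → List Bool),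
    f .base = List.replicate n true → f .size = [] → f .aux = [] → f .tmp = [] →
    Run (power d : Program Γ D) f (update f .size (List.replicate (n ^ d) true))
      (d * (18 * (n + 1) ^ d) + 1)
  | 0, f, _, hs, _, _ => (run_push _ _).congr (by simp [hs]) (by simp)
  | d + 1, f, hb, hs, ha, ht => by
    refine ((run_power n d f hb hs ha ht).seq (run_mul _ (k := .size) (m := .base)
      (aux := .aux) (tmp := .tmp) (a := n ^ d) (n := n) ?_ ?_ ?_ ?_ nofun nofun nofun nofun
      nofun nofun)).congr ?_ ?_
    · simp
    · simp [hb]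
    · simp [ha]
    · simp [ht]
    · simp [pow_succ]
    · have h1 : n ^ d * n ≤ (n + 1) ^ (d + 1) := by
        rw [← pow_succ]; exact Nat.pow_le_pow_left (by omega) _
      have h2 : n ^ d ≤ (n + 1) ^ (d + 1) :=
        (Nat.pow_le_pow_left (by omega) _).trans (Nat.pow_le_pow_right (by omega) (by omega))
      have h3 : (n + 1) ^ d ≤ (n + 1) ^ (d + 1) := Nat.pow_le_pow_right (by omega) (by omega)
      have h4 : 1 ≤ (n + 1) ^ (d + 1) := Nat.one_le_pow _ _ (by omega)
      have h5 := Nat.mul_le_mul_left (d * 18) h3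
      nlinarith

variable [Fintype Γ]

/-- Read the word `x`. -/
noncomputable def readWord (Γ : Type) [DecidableEq Γ] [Fintype Γ] (D : ℕ) : Program Γ D :=
  read (Cmd.seq (BitCmd.push .base true)
    (Cmd.each (fun a : Γ => mark (.inl a) (.inl a)) Finset.univ.toList))

/-- The word is split into one indicator string for each letter, as formulas only see bits; `base`
counts the letters. Pushing reverses the strings, hence they are collected in the mirror stacks. -/
theorem exec_readWord (x : List Γ) (s : List (InputSymbol Γ)) (hs : s.head?.getD none = none) :
    Cmd.Exec (readWord Γ D) (bitStacks ((x.map Sum.inl).map some ++ s) fun _ => [])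
      (bitStacks s (fun
        | .base => List.replicate x.length true
        | .mirror (.inl a) => (x.map fun c => decide (c = a)).reverse
        | _ => []))
      (x.length * (2 * Fintype.card Γ + 4) + 1) := by
  let F : List (Γ ⊕ Bool) → Register (Γ ⊕ Bool) D → List Bool := fun p k => match k with
    | .base => List.replicate p.length true
    | .mirror (.inl a) => (p.map fun c => decide (c = .inl a)).reverse
    | _ => []
  have h := exec_read (t := 2 * Fintype.card Γ + 2) (c := Cmd.seq (BitCmd.push .base true)
    (Cmd.each (fun a : Γ => mark (.inl a) (.inl a)) Finset.univ.toList)) hs (x.map Sum.inl) F ?_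
  · have e1 : F [] = fun _ => [] := by
      funext k
      rcases k with _ | _ | ⟨_ | _⟩ | _ | _ | _ | _ | _ | _ | _ <;> rfl
    rw [e1] at h
    refine h.congr ?_ (by simp)
    congr 1
    funext k
    rcases k with _ | _ | ⟨_ | _⟩ | _ | _ | _ | _ | _ | _ | _ <;> simp [F, Function.comp_def]
  · intro p a q _ s
    let G : List Γ → Register (Γ ⊕ Bool) D → List Bool := fun l k => match k with
      | .base => List.replicate (p.length + 1) true
      | .mirror (.inl b) => if b ∈ l then (decide (a = .inl b) :: (p.map fun c => decide (c = .inl b)).reverse)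
          else (p.map fun c => decide (c = .inl b)).reverse
      | _ => []
    have h1 := Cmd.exec_each (c := fun a : Γ => (mark (.inl a) (.inl a) : Program Γ D)) (t := 2)
      (fun l => bitStacks (some a :: s) (G l)) Finset.univ.toList [] ?_
    · have h2 := run_push (I := InputSymbol Γ) (f := F p) .base true (some a :: s)
      have e1 : update (F p) .base (true :: F p .base) = G [] := by
        funext k
        rcases k with _ | _ | ⟨_ | _⟩ | _ | _ | _ | _ | _ | _ | _ <;> simp [F, G, List.replicate_succ]
      have e2 : F (p ++ [a]) = G Finset.univ.toList := by
        funext k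
        rcases k with _ | _ | ⟨_ | _⟩ | _ | _ | _ | _ | _ | _ | _ <;> simp [F, G]
      rw [e1] at h2
      rw [e2]
      refine (h2.seq h1).weaken ?_
      simp
      omega
    · intro l b q hl
      have hb : b ∉ l := by
        have := Finset.nodup_toList (Finset.univ : Finset Γ)
        simp only [List.nil_append] at hl
        rw [← hl, List.nodup_append] at this
        intro hbl
        exact this.2.2 b hbl b (by simp) rfl
      have e1 : G (l ++ [b]) = update (G l) (.mirror (.inl b))
          (decide (some a = some (.inl b)) :: G l (.mirror (.inl b))) := by
        funext k
        rcases k with _ | _ | ⟨c | _⟩ | _ | _ | _ | _ | _ | _ | _ <;> simp [G]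
        by_cases hc : c = b
        · subst hc; simp [hb]
        · simp [hc]
      rw [e1]
      exact exec_mark _ _ _ _ _

/-- Read the whole input. -/
noncomputable def readInput (Γ : Type) [DecidableEq Γ] [Fintype Γ] (D : ℕ) : Program Γ D :=
  Cmd.seq (readWord Γ D) (Cmd.seq (Cmd.pop none) (Cmd.seq (readBits Γ D false)
    (Cmd.seq (Cmd.pop none) (readBits Γ D true))))

theorem exec_readInput (x : List Γ) (y z : List Bool) :
    Cmd.Exec (readInput Γ D) (bitStacks (encodeTriple (x, y, z)) fun _ => [])
      (bitStacks [] (fun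
        | .base => List.replicate x.length true
        | .mirror r => ((wordStructure 0 x y z).bits r).reverse
        | _ => []))
      (x.length * (2 * Fintype.card Γ + 4) + y.length * 4 + z.length * 4 + 5) := by
  have h1 := exec_readWord (D := D) x
    (none :: ((y.map Sum.inr).map some ++ none :: ((z.map Sum.inr).map some ++ []))) rfl
  have h2 := fun f => exec_readBits (Γ := Γ) (D := D) false y
    (none :: ((z.map Sum.inr).map some ++ [])) rfl f
  have h3 := fun f => exec_readBits (Γ := Γ) (D := D) true z [] rfl f
  have e : encodeTriple (x, y, z) = (x.map Sum.inl).map some ++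
      none :: ((y.map Sum.inr).map some ++ none :: ((z.map Sum.inr).map some ++ [])) := by
    simp [encodeTriple, Function.comp_def]
  rw [e]
  have h4 := h1.seq ((exec_separator _).seq ((h2 _).seq ((exec_separator _).seq (h3 _))))
  refine h4.congr ?_ ?_
  · congr 1
    funext k
    rcases k with _ | _ | ⟨_ | (_ | _)⟩ | _ | _ | _ | _ | _ | _ | _ <;> simp [wordStructure]
  · omega

/-- The program that evaluates a formula on a word and two certificates. -/
noncomputable def machineProgram (d D : ℕ) (φ : Formula (Γ ⊕ Bool) 0) : Program Γ D :=
  Cmd.seq (readInput Γ D) <| Cmd.seq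
    (Cmd.each (fun r : Γ ⊕ Bool => (move (.mirror r) (.bits r) : Program Γ D)) Finset.univ.toList) <|
  Cmd.seq (pushes .base 2) <| Cmd.seq (power d) <| Cmd.seq (prog D φ) <|
  Cmd.each (fun k : Register (Γ ⊕ Bool) D => (clear k : Program Γ D)) (Finset.univ.erase .out).toList

/-- The strings are turned around, the domain size `(x.length + 2) ^ d` is computed, and
`progCorrect` is applied with a bound that is polynomial in the length of the input. -/
theorem exec_machineProgram (d : ℕ) (φ : Formula (Γ ⊕ Bool) 0) :
    ∃ p : Polynomial ℕ, ∀ (x : List Γ) (y z : List Bool), ∃ b : Bool,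
      (b = true ↔ φ.eval (wordStructure d x y z) Fin.elim0) ∧
      Cmd.Exec (machineProgram d φ.depth φ) (bitStacks (encodeTriple (x, y, z)) fun _ => [])
        (bitStacks [] (update (fun _ => []) .out [b])) (p.eval (encodeTriple (x, y, z)).length) := by
  classical
  set D := φ.depth with hD
  obtain ⟨p, hp⟩ := progCorrect (I := InputSymbol Γ) (D := D) φ (by omega)
  -- A common bound for the domain size and for all stack contents; the exponent is positive even
  -- for `d = 0`.
  let q : Polynomial ℕ := (Polynomial.X + 3) ^ (d + 1)
  refine ⟨Polynomial.X * Polynomial.C (2 * Fintype.card Γ + 4) + 8 * Polynomial.X + 5 +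
    (Polynomial.C (Fintype.card (Γ ⊕ Bool)) * (4 * Polynomial.X + 1) + 1) + 3 +
    (Polynomial.C d * (18 * (Polynomial.X + 3) ^ d) + 1) + p.comp q +
    (Polynomial.C (Fintype.card (Register (Γ ⊕ Bool) D)) * (2 * q + 1) + 1), fun x y z => ?_⟩
  have hx : x.length ≤ (encodeTriple (x, y, z)).length := by simp [encodeTriple]
  have hy : y.length ≤ (encodeTriple (x, y, z)).length := by simp [encodeTriple]; omega
  have hz : z.length ≤ (encodeTriple (x, y, z)).length := by simp [encodeTriple]; omega
  set M := (encodeTriple (x, y, z)).length with hM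
  have hbits : ∀ r, ((wordStructure d x y z).bits r).length ≤ M := by
    rintro (a | (_ | _)) <;> simp [wordStructure, hx, hy, hz]
  have hq : q.eval M = (M + 3) ^ (d + 1) := by simp [q]
  have hMq : M + 3 ≤ q.eval M := hq ▸ Nat.le_self_pow (by omega) _
  have hsize : (wordStructure d x y z).size ≤ q.eval M := by
    rw [hq]
    exact (Nat.pow_le_pow_left (by omega) _).trans (Nat.pow_le_pow_right (by omega) (by omega))
  let F : List (Γ ⊕ Bool) → Register (Γ ⊕ Bool) D → List Bool := fun l k => match k with
    | .base => List.replicate x.length true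
    | .mirror r => if r ∈ l then [] else ((wordStructure d x y z).bits r).reverse
    | .bits r => if r ∈ l then (wordStructure d x y z).bits r else []
    | _ => []
  have h1 := exec_readInput (D := D) x y z
  have e1 : (fun
        | .base => List.replicate x.length true
        | .mirror r => ((wordStructure 0 x y z).bits r).reverse
        | _ => [] : Register (Γ ⊕ Bool) D → List Bool) = F [] := by
    funext k
    rcases k with _ | _ | ⟨_ | (_ | _)⟩ | _ | _ | _ | _ | _ | _ | _ <;> simp [F, wordStructure]
  rw [e1] at h1
  have h2 := run_each (c := fun r : Γ ⊕ Bool => (move (.mirror r) (.bits r) : Program Γ D))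
    (t := 4 * M + 1) F Finset.univ.toList (fun l r l' hl => by
      have hr : r ∉ l := by
        have := Finset.nodup_toList (Finset.univ : Finset (Γ ⊕ Bool))
        rw [← hl, List.nodup_append] at this
        intro hbl
        exact this.2.2 r hbl r (by simp) rfl
      refine (run_move (F l) (k := Register.mirror r) (k' := Register.bits r) nofun).congr ?_ ?_
      · funext k
        rcases k with _ | r' | r' | _ | _ | _ | _ | _ | _ | _ <;> simp [F]
        · by_cases h : r' = r
          · subst h; simp [hr]
          · simp [h]
        · by_cases h : r' = r
          · subst h; simp
          · simp [h]
      · have := hbits r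
        simp only [F, hr, if_false, List.length_reverse]
        omega)
  have h3 := run_pushes (I := InputSymbol Γ) (.base : Register (Γ ⊕ Bool) D) 2 (F Finset.univ.toList)
  have h4 := run_power (Γ := Γ) (x.length + 2) d (update (F Finset.univ.toList) .base
    (List.replicate 2 true ++ F Finset.univ.toList .base)) (by simp [F, List.replicate_succ])
    (by simp [F]) (by simp [F]) (by simp [F])
  set f4 := update (update (F Finset.univ.toList) .base
    (List.replicate 2 true ++ F Finset.univ.toList .base)) .size
    (List.replicate ((x.length + 2) ^ d) true) with hf4
  have hrep : Represents (wordStructure d x y z) Fin.elim0 f4 := by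
    refine ⟨?_, ?_, ?_, ?_, ?_, ?_, ?_, ?_, ?_⟩
    · intro r; simp [f4, F]
    · intro r; simp [f4, F]
    · simp [f4, wordStructure]
    · simp [f4, F]
    · simp [f4, F]
    · simp [f4, F]
    · exact fun i => i.elim0
    · intro v _ _; simp [f4, F, reg]
    · intro v _ _; simp [f4, F, ctr]
  obtain ⟨b, hb, h5⟩ := hp (q.eval M) _ _ f4 hsize (fun r => (hbits r).trans (by omega))
    (fun i => i.elim0) hrep
  have hout : f4 .out = [] := by simp [f4, F]
  rw [hout] at h5
  let G : List (Register (Γ ⊕ Bool) D) → Register (Γ ⊕ Bool) D → List Bool := fun l k =>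
    if k ∈ l then [] else update f4 .out [b] k
  have hlen : ∀ k, (update f4 .out [b] k).length ≤ q.eval M := by
    intro k
    rcases k with _ | r | r | _ | _ | _ | _ | _ | _ | _ <;> simp [f4, F]
    · omega
    · have := hbits r; omega
    · exact hsize
    · omega
  -- A halting configuration in the sense of `haltList` has all stacks empty except the output.
  have h6 := run_each (c := fun k : Register (Γ ⊕ Bool) D => (clear k : Program Γ D))
    (t := 2 * q.eval M + 1) G (Finset.univ.erase .out).toList (fun l k l' hl => by
      refine (run_clear _ _).congr ?_ ?_
      · funext k'
        by_cases h : k' = k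
        · subst h; simp [G]
        · simp [G, h]
      · have := hlen k
        simp only [G]
        split_ifs
        · simp
        · omega)
  have e6 : G [] = update f4 .out [b] := by
    funext k; simp [G]
  have e6' : G (Finset.univ.erase .out).toList = update (fun _ => []) .out [b] := by
    funext k
    by_cases h : k = .out
    · subst h; simp [G]
    · simp [G, h]
  rw [e6, e6'] at h6
  refine ⟨b, hb, (h1.seq ((h2.seq (h3.seq (h4.seq (h5.seq h6)))) [])).weaken ?_⟩
  have c1 := Nat.mul_le_mul_right (2 * Fintype.card Γ + 4) hx
  have c2 : ((Finset.univ.erase (Register.out : Register (Γ ⊕ Bool) D)).toList.length) ≤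
      Fintype.card (Register (Γ ⊕ Bool) D) := by
    rw [Finset.length_toList]; exact Finset.card_le_univ _
  have c3 := Nat.mul_le_mul_right (2 * q.eval M + 1) c2
  have c4 : (x.length + 2 + 1) ^ d ≤ (M + 3) ^ d := Nat.pow_le_pow_left (by omega) _
  have c5 := Nat.mul_le_mul_left d (Nat.mul_le_mul_left 18 c4)
  have c6 : (Finset.univ : Finset (Γ ⊕ Bool)).toList.length = Fintype.card (Γ ⊕ Bool) := by
    rw [Finset.length_toList]; rfl
  rw [c6]
  simp only [Polynomial.eval_add, Polynomial.eval_mul, Polynomial.eval_C, Polynomial.eval_X,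
    Polynomial.eval_ofNat, Polynomial.eval_pow, Polynomial.eval_one, Polynomial.eval_comp]
  omega

/-- The machine that evaluates a formula on a word and two certificates. -/
noncomputable def machine (d : ℕ) (φ : Formula (Γ ⊕ Bool) 0) : FinTM2 where
  K := Option (Register (Γ ⊕ Bool) φ.depth)
  k₀ := none
  k₁ := some .out
  Γ := Alphabet (InputSymbol Γ)
  Λ := Option (machineProgram d φ.depth φ).Label
  main := some (machineProgram d φ.depth φ).entry
  σ := Bool
  initialState := false
  Γk₀Fin := inferInstanceAs (Fintype (InputSymbol Γ))
  m := fun l => Option.elim l .halt ((machineProgram d φ.depth φ).code some none)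

theorem nonempty_computable (d : ℕ) (φ : Formula (Γ ⊕ Bool) 0)
    (R : List Γ × List Bool × List Bool → Bool)
    (hR : ∀ x y z, R (x, y, z) = true ↔ φ.eval (wordStructure d x y z) Fin.elim0) :
    Nonempty (TM2ComputableInPolyTime encodeTriple Computability.encodeBool R) := by
  obtain ⟨p, hp⟩ := exec_machineProgram d φ
  -- The additional step executes `halt` at the exit label.
  refine ⟨⟨⟨machine d φ, Equiv.refl _, Equiv.refl _⟩, p + 1, fun a => ?_⟩⟩
  apply Classical.choice
  obtain ⟨x, y, z⟩ := a
  obtain ⟨b, hb, he⟩ := hp x y z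
  have hbR : b = R (x, y, z) := by rw [Bool.eq_iff_iff, hb, hR]
  have h1 := Cmd.reachesIn_code he (machine d φ).m some none fun _ => rfl
  have h2 := h1.trans (Cmd.ReachesIn.step (M := (machine d φ).m) (a := ⟨some none, false, _⟩)
    (b := ⟨none, false, bitStacks [] (update (fun _ => []) .out [b])⟩) rfl)
  obtain ⟨n, hn, h3⟩ := h2
  refine ⟨⟨⟨n, ?_⟩, by simpa using hn⟩⟩
  have e1 : initList (machine d φ) (encodeTriple (x, y, z)) =
      ⟨some (some (machineProgram d φ.depth φ).entry), false,
        bitStacks (encodeTriple (x, y, z)) fun _ => []⟩ := by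
    unfold initList
    congr 1
    funext k
    cases k <;> rfl
  have e2 : haltList (machine d φ) [R (x, y, z)] =
      ⟨none, false, bitStacks [] (update (fun _ => []) .out [b])⟩ := by
    unfold haltList
    congr 1
    funext k
    subst hbR
    rcases k with _ | k
    · rfl
    · cases k <;> rfl
  have e3 : (encodeTriple (x, y, z)).map (Equiv.refl (InputSymbol Γ)).invFun =
    encodeTriple (x, y, z) := by simp [Equiv.refl]
  exact (congrArg (fun c => (flip bind (machine d φ).step)^[n] (some c))
    ((congrArg (initList (machine d φ)) e3).trans e1)).trans (h3.trans (congrArg some e2.symm))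

end Formula

/-- A language that is defined by a first-order formula about the word and two certificates of
polynomial length, the first one quantified universally and the second one existentially, is in
`Π₂ᵖ`. -/
theorem inPiTwoP_of_formula {Γ : Type} [Fintype Γ] [DecidableEq Γ] {P : Language Γ} (d : ℕ)
    (p : Polynomial ℕ) (φ : Formula (Γ ⊕ Bool) 0)
    (h : ∀ x : List Γ, x ∈ P ↔ ∀ y : List Bool, y.length ≤ p.eval x.length →
      ∃ z : List Bool, z.length ≤ p.eval x.length ∧ φ.eval (wordStructure d x y z) Fin.elim0) :
    InPiTwoP P := by
  classical
  refine ⟨p, fun t => decide (φ.eval (wordStructure d t.1 t.2.1 t.2.2) Fin.elim0),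
    Formula.nonempty_computable d φ _ (by simp), fun x => ?_⟩
  simp [h]

end CRPQContainment

namespace CRPQContainment

/-! ### First-order definable properties of words and certificates -/

/-- The information about a word and two certificates that formulas have access to: the size of the
domain, the tokens of the word, and the relations `rel false c` and `rel true c` that are described
by the first and the second certificate. -/
structure Model where
  size : ℕ
  tok : Token → ℕ → Prop
  rel : Bool → ℕ → ℕ → ℕ → ℕ → ℕ → Prop

/-- One string holds all relations of a certificate: the number `c` of the relation is the leading
digit of the address in base `size`. -/
def BitStructure.model (S : BitStructure (Token ⊕ Bool)) : Model where
  size := S.size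
  tok a i := (S.bits (.inl a))[i]? = some true
  rel b c i j u v := (S.bits (.inr b))[horner S.size c [i, j, u, v]]? = some true

/-- Definability by a first-order formula. -/
def Definable (k : ℕ) (P : Model → (Fin k → ℕ) → Prop) : Prop :=
  ∃ φ : Formula (Token ⊕ Bool) k, ∀ S e, (∀ i, e i < S.size) → (φ.eval S e ↔ P S.model e)

namespace Definable

variable {k : ℕ} {P Q : Model → (Fin k → ℕ) → Prop}

theorem congr (h : Definable k P) (hPQ : ∀ M e, (∀ i, e i < M.size) → (P M e ↔ Q M e)) :
    Definable k Q := by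
  obtain ⟨φ, hφ⟩ := h
  exact ⟨φ, fun S e he => (hφ S e he).trans (hPQ _ _ he)⟩

theorem not (h : Definable k P) : Definable k fun M e => ¬ P M e := by
  obtain ⟨φ, hφ⟩ := h
  exact ⟨.neg φ, fun S e he => (hφ S e he).not⟩

theorem and (h : Definable k P) (h' : Definable k Q) : Definable k fun M e => P M e ∧ Q M e := by
  obtain ⟨φ, hφ⟩ := h
  obtain ⟨ψ, hψ⟩ := h'
  exact ⟨.and φ ψ, fun S e he => (hφ S e he).and (hψ S e he)⟩

theorem or (h : Definable k P) (h' : Definable k Q) : Definable k fun M e => P M e ∨ Q M e :=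
  (h.not.and h'.not).not.congr fun _ _ _ => by tauto

theorem imp (h : Definable k P) (h' : Definable k Q) : Definable k fun M e => P M e → Q M e :=
  (h.and h'.not).not.congr fun _ _ _ => by tauto

theorem iff (h : Definable k P) (h' : Definable k Q) : Definable k fun M e => (P M e ↔ Q M e) :=
  ((h.imp h').and (h'.imp h)).congr fun _ _ _ => by tauto

theorem ex {P : Model → (Fin k → ℕ) → ℕ → Prop}
    (h : Definable (k + 1) fun M e => P M (fun i => e i.castSucc) (e (Fin.last k))) :
    Definable k fun M e => ∃ a < M.size, P M e a := by
  obtain ⟨φ, hφ⟩ := h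
  refine ⟨.ex φ, fun S e he => ?_⟩
  refine exists_congr fun a => and_congr_right fun ha => ?_
  refine (hφ S _ fun i => ?_).trans ?_
  · refine Fin.lastCases ?_ (fun i => ?_) i
    · simpa using ha
    · simpa using he i
  · simp

theorem all {P : Model → (Fin k → ℕ) → ℕ → Prop}
    (h : Definable (k + 1) fun M e => P M (fun i => e i.castSucc) (e (Fin.last k))) :
    Definable k fun M e => ∀ a < M.size, P M e a :=
  (ex (P := fun M e a => ¬ P M e a) h.not).not.congr fun _ _ _ => by push Not; rfl

theorem tok (a : Token) (i : Fin k) : Definable k fun M e => M.tok a (e i) :=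
  ⟨.bit (.inl a) 0 [i], fun S e _ => by simp [Formula.eval, horner, BitStructure.model]⟩

theorem rel (b : Bool) (c : ℕ) (i j u v : Fin k) :
    Definable k fun M e => M.rel b c (e i) (e j) (e u) (e v) :=
  ⟨.bit (.inr b) c [i, j, u, v], fun S e _ => by simp [Formula.eval, BitStructure.model]⟩

theorem lt (i j : Fin k) : Definable k fun _ e => e i < e j :=
  ⟨.less i j, fun _ _ _ => Iff.rfl⟩

theorem le (i j : Fin k) : Definable k fun _ e => e i ≤ e j :=
  (lt j i).not.congr fun _ _ _ => not_lt

theorem eq (i j : Fin k) : Definable k fun _ e => e i = e j :=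
  ((le i j).and (le j i)).congr fun _ _ _ => le_antisymm_iff.symm

/-- The order is discrete, and a number strictly between two elements of the domain is itself in the
domain. -/
theorem succ (i j : Fin k) : Definable k fun _ e => e j = e i + 1 := by
  refine ((lt i j).and (ex (P := fun _ e a => e i < a ∧ a < e j) ?_).not).congr fun M e he => ?_
  · exact (lt i.castSucc (Fin.last k)).and (lt (Fin.last k) j.castSucc)
  · constructor
    · rintro ⟨h1, h2⟩
      by_contra h
      have := he j
      exact h2 ⟨e i + 1, by omega, by omega, by omega⟩
    · rintro h
      refine ⟨by omega, ?_⟩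
      rintro ⟨a, _, h1, h2⟩
      omega

theorem zero (i : Fin k) : Definable k fun _ e => e i = 0 := by
  refine (ex (P := fun _ e a => a < e i) (lt (Fin.last k) i.castSucc)).not.congr fun M e he => ?_
  constructor
  · intro h
    by_contra h0
    exact h ⟨0, by have := he i; omega, by omega⟩
  · rintro h ⟨a, _, h'⟩
    omega

theorem true : Definable k fun _ _ => True :=
  ⟨.neg (.and (.bit (.inr false) 0 []) (.neg (.bit (.inr false) 0 []))), fun S e _ => by
    simp [Formula.eval]⟩

theorem exists_list {α : Type} {P : α → Model → (Fin k → ℕ) → Prop} (l : List α)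
    (h : ∀ a ∈ l, Definable k (P a)) : Definable k fun M e => ∃ a ∈ l, P a M e := by
  induction l with
  | nil => exact true.not.congr fun _ _ _ => by simp
  | cons a l ih =>
    exact ((h a (by simp)).or (ih fun b hb => h b (by simp [hb]))).congr fun _ _ _ => by simp

end Definable

/-! ### Local conditions on the tables of the certificates -/

namespace Model

variable (M : Model)

def IsBit (i : ℕ) : Prop := M.tok (.bit false) i ∨ M.tok (.bit true) i

/-- A name is written from position `i` to position `j`. -/
def NameAt (i j : ℕ) : Prop :=
  ∃ e < M.size, j = e + 1 ∧ i ≤ e ∧ M.tok .endName e ∧ ∀ k < M.size, i ≤ k → k < e → M.IsBit k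

/-- The names at positions `i` and `j` are equal. -/
def SameName (i j : ℕ) : Prop := M.rel true 0 i j i j

/-- A regular expression is written from position `i` to position `j`. -/
def RegexAt (i j : ℕ) : Prop := M.rel true 1 i j i j

/-- A list of atoms that ends at `e` is written at position `i`. -/
def AtomsAt (i e : ℕ) : Prop := M.rel true 2 i e i e

/-- A query that ends at `e` has a part that is written at position `i`. -/
def QueryFrom (i e : ℕ) : Prop := M.rel true 3 i e i e

/-- The variable at position `p` is mapped to the node `u`. -/
def MapsTo (b : Bool) (p u : ℕ) : Prop := M.rel b 4 p u p u

/-- The regular expression at position `q` matches a path from `u` to `v`; `r` is an upper bound for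
the number of iterations of the outermost star. -/
def Matches (b : Bool) (q u v r : ℕ) : Prop := M.rel b 5 q u v r

/-- The lists of distinguished variables from positions `i` and `j` on are mapped to the same
tuple. -/
def SameTuple (i j : ℕ) : Prop := M.rel true 6 i j i j

/-- There is an edge from `u` to `v` with the label at position `p`. -/
def Edge (p u v : ℕ) : Prop := M.rel false 7 p u v v

/-- The variable at position `p` is in a set described by the first certificate. -/
def InSet (p : ℕ) : Prop := M.rel false 6 p p p p

/-- An equivalence, like `RegexSpec`: both tables also occur in hypotheses of other conditions, so
missing entries must be excluded as well as wrong ones. The recursion goes to the right in the word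
and hence determines the table. -/
def SameNameSpec : Prop :=
  ∀ i < M.size, ∀ j < M.size, (M.SameName i j ↔
    (M.tok .endName i ∧ M.tok .endName j) ∨
      ∃ i' < M.size, ∃ j' < M.size, i' = i + 1 ∧ j' = j + 1 ∧ M.SameName i' j' ∧
        ((M.tok (.bit false) i ∧ M.tok (.bit false) j) ∨
          (M.tok (.bit true) i ∧ M.tok (.bit true) j)))

def RegexSpec (label : Model → ℕ → Prop) : Prop :=
  ∀ i < M.size, ∀ j < M.size, (M.RegexAt i j ↔
    ∃ i' < M.size, i' = i + 1 ∧
      (((M.tok .empty i ∨ M.tok .epsilon i) ∧ j = i') ∨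
        (M.tok .symbol i ∧ M.NameAt i' j ∧ label M i') ∨
        ((M.tok .plus i ∨ M.tok .comp i) ∧ ∃ m < M.size, M.RegexAt i' m ∧ M.RegexAt m j) ∨
        (M.tok .star i ∧ M.RegexAt i' j)))

/-- An atom with name, regular expression, name at `i'`, `j`, `k` is written from `i` to `l`. -/
def AtomAt (i i' j k l : ℕ) : Prop :=
  M.tok .atom i ∧ i' = i + 1 ∧ M.NameAt i' j ∧ M.RegexAt j k ∧ M.NameAt k l

/-- An implication suffices here and in `QuerySpec` and `SameTupleSpec`: such entries are only ever
claimed, so each needs a justification, while absent entries do no harm. -/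
def AtomsSpec : Prop :=
  ∀ i < M.size, ∀ e < M.size, M.AtomsAt i e →
    (M.tok .endQuery i ∧ i = e) ∨
      ∃ i' < M.size, ∃ j < M.size, ∃ k < M.size, ∃ l < M.size,
        M.AtomAt i i' j k l ∧ M.AtomsAt l e

def QuerySpec : Prop :=
  ∀ i < M.size, ∀ e < M.size, M.QueryFrom i e →
    M.AtomsAt i e ∨ ∃ i' < M.size, ∃ j < M.size,
      M.tok .distinguished i ∧ i' = i + 1 ∧ M.NameAt i' j ∧ M.QueryFrom j e

/-- An atom of the query that is written from `s` to `e`. -/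
def AtomIn (s e i i' j k l : ℕ) : Prop := s ≤ i ∧ i < e ∧ M.AtomAt i i' j k l

/-- `p` is the position of a variable in an atom of the query that is written from `s` to `e`. -/
def VarPos (s e p : ℕ) : Prop :=
  ∃ i < M.size, ∃ i' < M.size, ∃ j < M.size, ∃ k < M.size, ∃ l < M.size,
    M.AtomIn s e i i' j k l ∧ (p = i' ∨ p = k)

/-- `p` is the position of a distinguished variable of the query that is written from `s` to `e`. -/
def DistinguishedPos (s e p : ℕ) : Prop :=
  ∃ i < M.size, s ≤ i ∧ i < e ∧ M.tok .distinguished i ∧ p = i + 1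

def DistinguishedOccur (s e : ℕ) : Prop :=
  ∀ p < M.size, M.DistinguishedPos s e p → ∃ q < M.size, M.VarPos s e q ∧ M.SameName p q

def NameInSet (p : ℕ) : Prop := ∃ q < M.size, M.SameName p q ∧ M.InSet q

/-- Membership is by name, so the certificate need not mark every occurrence of a variable. The sets
described here are, on the variables of the query, unions of components. -/
def SetClosed (s e : ℕ) : Prop :=
  ∀ i < M.size, ∀ i' < M.size, ∀ j < M.size, ∀ k < M.size, ∀ l < M.size,
    M.AtomIn s e i i' j k l → (M.NameInSet i' ↔ M.NameInSet k)

/-- The set comes from the universally quantified certificate; over all choices of it the condition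
says that every component contains a distinguished variable. -/
def ComponentSpec (s e : ℕ) : Prop :=
  M.SetClosed s e → (∃ p < M.size, M.VarPos s e p ∧ M.NameInSet p) →
    ∃ p < M.size, M.DistinguishedPos s e p ∧ M.NameInSet p

/-- Claimed matches must be justified by further matches. The justification is well-founded: it
passes to a proper subexpression, or stays at the same star and decreases `r`. This is what excludes
circular claims. -/
def MatchesSpec (b : Bool) : Prop :=
  ∀ q < M.size, ∀ u < M.size, ∀ v < M.size, ∀ r < M.size, M.Matches b q u v r →
    ∃ q' < M.size, q' = q + 1 ∧
      ((M.tok .epsilon q ∧ u = v) ∨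
        (M.tok .symbol q ∧ ∃ p < M.size, ∃ p' < M.size, M.tok .symbol p ∧ p' = p + 1 ∧
          M.SameName q' p' ∧ M.Edge p u v) ∨
        (M.tok .plus q ∧ ∃ m < M.size, ∃ r' < M.size, M.RegexAt q' m ∧
          (M.Matches b q' u v r' ∨ M.Matches b m u v r')) ∨
        (M.tok .comp q ∧ ∃ m < M.size, ∃ w < M.size, ∃ r' < M.size, ∃ r'' < M.size,
          M.RegexAt q' m ∧ M.Matches b q' u w r' ∧ M.Matches b m w v r'') ∨
        (M.tok .star q ∧ (u = v ∨ ∃ w < M.size, ∃ r' < M.size, ∃ r'' < M.size,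
          r' < r ∧ M.Matches b q' u w r'' ∧ M.Matches b q w v r')))

/-- The assignment is stored by positions; values must be unique and shared by all occurrences of a
name. -/
def MapSpec (b : Bool) : Prop :=
  ∀ p < M.size, ∀ q < M.size, ∀ u < M.size, ∀ v < M.size,
    M.SameName p q → M.MapsTo b p u → (M.MapsTo b q v → u = v) ∧ M.MapsTo b q u

def AtomsHold (b : Bool) (s e : ℕ) : Prop :=
  ∀ i < M.size, ∀ i' < M.size, ∀ j < M.size, ∀ k < M.size, ∀ l < M.size,
    M.AtomIn s e i i' j k l → ∃ u < M.size, ∃ v < M.size, ∃ r < M.size,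
      M.MapsTo b i' u ∧ M.MapsTo b k v ∧ M.Matches b j u v r

/-- The certificate `b` describes a satisfying homomorphism of the query from `s` to `e`. -/
def Satisfies (b : Bool) (s e : ℕ) : Prop :=
  M.MatchesSpec b ∧ M.MapSpec b ∧ M.AtomsHold b s e

def SameTupleSpec : Prop :=
  ∀ i < M.size, ∀ j < M.size, M.SameTuple i j →
    (¬ M.tok .distinguished i ∧ ¬ M.tok .distinguished j) ∨
      (M.tok .distinguished i ∧ M.tok .distinguished j ∧ ∃ i' < M.size, ∃ j' < M.size,
        ∃ k < M.size, ∃ l < M.size, ∃ u < M.size, i' = i + 1 ∧ j' = j + 1 ∧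
          M.MapsTo false i' u ∧ M.MapsTo true j' u ∧ M.NameAt i' k ∧ M.NameAt j' l ∧
          M.SameTuple k l)

def AtEnd (l : ℕ) : Prop := ¬ ∃ a ∈ (Finset.univ : Finset Token).toList, M.tok a l

/-- The property of a word and two certificates that is used to show that query containment is in
`Π₂ᵖ`. -/
def Verifies (label : Model → ℕ → Prop) (fragment : Model → ℕ → ℕ → Prop) : Prop :=
  ∃ o < M.size, ∃ e < M.size, ∃ s < M.size, ∃ f < M.size, ∃ l < M.size,
    (o = 0 ∧ s = e + 1 ∧ l = f + 1 ∧ M.AtEnd l) ∧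
    (M.SameNameSpec ∧ M.RegexSpec label ∧ M.AtomsSpec ∧ M.QuerySpec) ∧
    (M.QueryFrom o e ∧ M.QueryFrom s f) ∧
    (M.DistinguishedOccur o e ∧ M.DistinguishedOccur s f) ∧
    fragment M s f ∧
    (M.ComponentSpec o e ∧ M.ComponentSpec s f) ∧
    (M.Satisfies false o e → M.Satisfies true s f ∧ M.SameTupleSpec ∧ M.SameTuple o s)

/-- All regular expressions of the query from `s` to `f` are disjunctions of symbols. -/
def DisjunctionFragment (s f : ℕ) : Prop :=
  ∀ i < M.size, s ≤ i → i < f →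
    ¬ (M.tok .empty i ∨ M.tok .epsilon i ∨ M.tok .comp i ∨ M.tok .star i)

/-- All regular expressions of the query from `s` to `f` are symbols or closures of symbols. -/
def SymbolStarFragment (s f : ℕ) : Prop :=
  ∀ i < M.size, ∀ i' < M.size, ∀ j < M.size, ∀ k < M.size, ∀ l < M.size, M.AtomIn s f i i' j k l →
    M.tok .symbol j ∨ (M.tok .star j ∧ ∃ j' < M.size, j' = j + 1 ∧ M.tok .symbol j')

/-- The name `a` is written at position `i`. -/
def NameIs : Name → ℕ → Prop
  | [], i => M.tok .endName i
  | b :: a, i => M.tok (.bit b) i ∧ ∃ i' < M.size, i' = i + 1 ∧ NameIs a i'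

end Model

/-! ### First-order definability of the conditions -/

namespace Definable

variable {k : ℕ}

theorem nameAt (i j : Fin k) : Definable k fun M e => M.NameAt (e i) (e j) := by
  unfold Model.NameAt Model.IsBit
  -- The proofs of this kind follow the syntax of the condition; reducible transparency keeps named
  -- predicates folded, so that their own lemmas apply.
  repeat'
    beta_reduce
    with_reducible first
      | apply tok | apply le | apply lt | apply succ | apply ex | apply all | apply Definable.not
      | apply imp | apply Definable.and | apply Definable.or

theorem sameName (i j : Fin k) : Definable k fun M e => M.SameName (e i) (e j) := rel _ _ _ _ _ _

theorem regexAt (i j : Fin k) : Definable k fun M e => M.RegexAt (e i) (e j) := rel _ _ _ _ _ _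

theorem atomsAt (i j : Fin k) : Definable k fun M e => M.AtomsAt (e i) (e j) := rel _ _ _ _ _ _

theorem queryFrom (i j : Fin k) : Definable k fun M e => M.QueryFrom (e i) (e j) := rel _ _ _ _ _ _

theorem mapsTo (b : Bool) (i j : Fin k) : Definable k fun M e => M.MapsTo b (e i) (e j) :=
  rel _ _ _ _ _ _

theorem matches_ (b : Bool) (q u v r : Fin k) :
    Definable k fun M e => M.Matches b (e q) (e u) (e v) (e r) :=
  rel _ _ _ _ _ _

theorem sameTuple (i j : Fin k) : Definable k fun M e => M.SameTuple (e i) (e j) := rel _ _ _ _ _ _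

theorem edge (p u v : Fin k) : Definable k fun M e => M.Edge (e p) (e u) (e v) := rel _ _ _ _ _ _

theorem inSet (p : Fin k) : Definable k fun M e => M.InSet (e p) := rel _ _ _ _ _ _

theorem sameNameSpec : Definable k fun M _ => M.SameNameSpec := by
  unfold Model.SameNameSpec
  repeat'
    beta_reduce
    with_reducible first
      | apply tok | apply sameName | apply succ | apply ex | apply all | apply iff
      | apply Definable.and | apply Definable.or

theorem regexSpec {label : Model → ℕ → Prop}
    (h : ∀ {k : ℕ} (i : Fin k), Definable k fun M e => label M (e i)) :
    Definable k fun M _ => M.RegexSpec label := by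
  unfold Model.RegexSpec
  repeat'
    beta_reduce
    with_reducible first
      | apply tok | apply regexAt | apply nameAt | apply succ | apply eq | apply h | apply ex
      | apply all | apply iff | apply Definable.and | apply Definable.or

theorem atomAt (i i' j l m : Fin k) :
    Definable k fun M e => M.AtomAt (e i) (e i') (e j) (e l) (e m) := by
  unfold Model.AtomAt
  repeat'
    with_reducible first
      | apply tok | apply regexAt | apply nameAt | apply succ | apply Definable.and

theorem atomsSpec : Definable k fun M _ => M.AtomsSpec := by
  unfold Model.AtomsSpec
  repeat'
    beta_reduce
    with_reducible first
      | apply tok | apply atomAt | apply atomsAt | apply eq | apply ex | apply all | apply imp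
      | apply Definable.and | apply Definable.or

theorem querySpec : Definable k fun M _ => M.QuerySpec := by
  unfold Model.QuerySpec
  repeat'
    beta_reduce
    with_reducible first
      | apply tok | apply queryFrom | apply atomsAt | apply succ | apply nameAt | apply ex
      | apply all | apply imp | apply Definable.and | apply Definable.or

theorem atomIn (s f i i' j l m : Fin k) :
    Definable k fun M e => M.AtomIn (e s) (e f) (e i) (e i') (e j) (e l) (e m) := by
  unfold Model.AtomIn
  repeat'
    with_reducible first
      | apply le | apply lt | apply atomAt | apply Definable.and

theorem varPos (s f p : Fin k) : Definable k fun M e => M.VarPos (e s) (e f) (e p) := by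
  unfold Model.VarPos
  repeat'
    beta_reduce
    with_reducible first
      | apply atomIn | apply eq | apply ex | apply Definable.and | apply Definable.or

theorem distinguishedPos (s f p : Fin k) :
    Definable k fun M e => M.DistinguishedPos (e s) (e f) (e p) := by
  unfold Model.DistinguishedPos
  repeat'
    beta_reduce
    with_reducible first
      | apply le | apply lt | apply tok | apply succ | apply ex | apply Definable.and

theorem distinguishedOccur (s f : Fin k) :
    Definable k fun M e => M.DistinguishedOccur (e s) (e f) := by
  unfold Model.DistinguishedOccur
  repeat'
    beta_reduce
    with_reducible first
      | apply varPos | apply distinguishedPos | apply sameName | apply ex | apply all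
      | apply imp | apply Definable.and

theorem nameInSet (p : Fin k) : Definable k fun M e => M.NameInSet (e p) := by
  unfold Model.NameInSet
  repeat'
    beta_reduce
    with_reducible first
      | apply sameName | apply inSet | apply ex | apply Definable.and

theorem componentSpec (s f : Fin k) : Definable k fun M e => M.ComponentSpec (e s) (e f) := by
  unfold Model.ComponentSpec Model.SetClosed
  repeat'
    beta_reduce
    with_reducible first
      | apply atomIn | apply nameInSet | apply varPos | apply distinguishedPos | apply ex
      | apply all | apply iff | apply imp | apply Definable.and

theorem satisfies (b : Bool) (s f : Fin k) : Definable k fun M e => M.Satisfies b (e s) (e f) := by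
  unfold Model.Satisfies Model.MatchesSpec Model.MapSpec Model.AtomsHold
  repeat'
    beta_reduce
    with_reducible first
      | apply tok | apply matches_ | apply regexAt | apply sameName | apply mapsTo
      | apply atomIn | apply edge | apply succ | apply eq | apply lt | apply ex | apply all
      | apply imp | apply Definable.and | apply Definable.or

theorem sameTupleSpec : Definable k fun M _ => M.SameTupleSpec := by
  unfold Model.SameTupleSpec
  repeat'
    beta_reduce
    with_reducible first
      | apply tok | apply sameTuple | apply mapsTo | apply nameAt | apply succ | apply ex
      | apply all | apply Definable.not | apply imp | apply Definable.and | apply Definable.or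

theorem atEnd (l : Fin k) : Definable k fun M e => M.AtEnd (e l) :=
  (exists_list _ fun _ _ => tok _ _).not

theorem verifies {label : Model → ℕ → Prop} {fragment : Model → ℕ → ℕ → Prop}
    (h : ∀ {k : ℕ} (i : Fin k), Definable k fun M e => label M (e i))
    (h' : ∀ {k : ℕ} (i j : Fin k), Definable k fun M e => fragment M (e i) (e j)) :
    Definable k fun M _ => M.Verifies label fragment := by
  unfold Model.Verifies
  repeat'
    beta_reduce
    with_reducible first
      | apply zero | apply succ | apply atEnd | apply sameNameSpec | apply regexSpec h
      | apply atomsSpec | apply querySpec | apply queryFrom | apply distinguishedOccur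
      | apply h' | apply componentSpec | apply satisfies | apply sameTupleSpec | apply sameTuple
      | apply ex | apply imp | apply Definable.and

theorem disjunctionFragment (i j : Fin k) :
    Definable k fun M e => M.DisjunctionFragment (e i) (e j) := by
  unfold Model.DisjunctionFragment
  repeat'
    beta_reduce
    with_reducible first
      | apply tok | apply le | apply lt | apply all | apply Definable.not | apply imp
      | apply Definable.or

theorem symbolStarFragment (i j : Fin k) :
    Definable k fun M e => M.SymbolStarFragment (e i) (e j) := by
  unfold Model.SymbolStarFragment
  repeat'
    beta_reduce
    with_reducible first
      | apply tok | apply atomIn | apply succ | apply ex | apply all | apply imp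
      | apply Definable.and | apply Definable.or

theorem nameIs : ∀ (a : Name) {k : ℕ} (i : Fin k), Definable k fun M e => M.NameIs a (e i)
  | [], _, i => tok _ i
  | b :: a, _, i => (tok (.bit b) i).and
      (ex (P := fun M e p => p = e i + 1 ∧ M.NameIs a p)
        ((succ i.castSucc (Fin.last _)).and (nameIs a (Fin.last _))))

theorem exists_nameIs (l : List Name) (i : Fin k) :
    Definable k fun M e => ∃ a ∈ l, M.NameIs a (e i) :=
  exists_list l fun a _ => nameIs a i

end Definable

end CRPQContainment

namespace CRPQContainment

/-! ### Reading queries off words -/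

/-- The word `l` is written in `x` at position `i`. -/
def At (x : List Token) (i : ℕ) (l : List Token) : Prop := l <+: x.drop i

section At

variable {x : List Token} {i : ℕ}

theorem at_nil : At x i [] := List.nil_prefix

theorem at_cons {a : Token} {l : List Token} : At x i (a :: l) ↔ x[i]? = some a ∧ At x (i + 1) l := by
  unfold At
  by_cases h : i < x.length
  · rw [List.drop_eq_getElem_cons h, List.cons_prefix_cons, List.getElem?_eq_getElem h]
    simp [eq_comm]
  · rw [List.drop_eq_nil_of_le (by omega), List.getElem?_eq_none (by omega)]
    simp

theorem at_append {l l' : List Token} : At x i (l ++ l') ↔ At x i l ∧ At x (i + l.length) l' := by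
  induction l generalizing i with
  | nil => simp [at_nil]
  | cons a l ih =>
    rw [List.cons_append, at_cons, at_cons, ih, and_assoc, List.length_cons,
      show i + 1 + l.length = i + (l.length + 1) by omega]

theorem At.add_length_le {l : List Token} (h : At x i l) (hl : l ≠ []) : i + l.length ≤ x.length := by
  have := h.length_le
  have h2 : 0 < l.length := List.length_pos_of_ne_nil hl
  rw [List.length_drop] at this
  omega

theorem At.getElem? {l : List Token} (h : At x i l) {n : ℕ} (hn : n < l.length) :
    x[i + n]? = l[n]? := by
  obtain ⟨s, hs⟩ := h
  rw [← List.getElem?_drop, ← hs, List.getElem?_append_left hn]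

theorem At.mem {l : List Token} (h : At x i l) {j : ℕ} (hij : i ≤ j) (hj : j < i + l.length)
    {a : Token} (ha : x[j]? = some a) : a ∈ l := by
  have := h.getElem? (n := j - i) (by omega)
  rw [show i + (j - i) = j by omega, ha] at this
  exact List.mem_of_getElem? this.symm

theorem at_zero {s : List Token} (h : x = s) : At x 0 s := by
  simp [At, h]

/-- In a concatenation of blocks that start with `m` and do not contain `m` elsewhere, every
occurrence of `m` is the start of a block. -/
theorem exists_block {α : Type} {f : α → List Token} {m : Token} (j : ℕ) : ∀ (l : List α),
    (∀ a ∈ l, ∃ t, f a = m :: t ∧ m ∉ t) → ∀ {i : ℕ}, At x i (l.flatMap f) → i ≤ j →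
    j < i + (l.flatMap f).length → x[j]? = some m → ∃ a ∈ l, At x j (f a)
  | [], _, i, _, h1, h2, _ => by simp at h2; omega
  | a :: l, hf, i, h, h1, h2, hm => by
    rw [List.flatMap_cons, at_append] at h
    by_cases hj : j < i + (f a).length
    · obtain ⟨t, ht, hmt⟩ := hf a (by simp)
      have h3 := h.1
      by_cases hji : j = i
      · exact ⟨a, by simp, hji ▸ h3⟩
      · rw [ht, at_cons] at h3
        rw [ht, List.length_cons] at hj
        exact absurd (h3.2.mem (j := j) (by omega) (by omega) hm) hmt
    · rw [List.flatMap_cons, List.length_append] at h2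
      obtain ⟨b, hb, hb'⟩ := exists_block j l (fun b hb => hf b (by simp [hb])) h.2 (by omega)
        (by omega) hm
      exact ⟨b, by simp [hb], hb'⟩

theorem At.block {α : Type} {f : α → List Token} {l : List α} (h : At x i (l.flatMap f)) {a : α}
    (ha : a ∈ l) (hf : f a ≠ []) :
    ∃ j, i ≤ j ∧ j < i + (l.flatMap f).length ∧ At x j (f a) := by
  obtain ⟨l₁, l₂, rfl⟩ := List.append_of_mem ha
  rw [List.flatMap_append, List.flatMap_cons, at_append, at_append] at h
  refine ⟨_, by omega, ?_, h.2.1⟩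
  have := List.length_pos_of_ne_nil hf
  simp
  omega

end At

/-! ### Unique readability -/

section Encoding

variable {S : Set Name}

/-- The end marker makes the code of names prefix-free. The forms for expressions and queries also
carry arbitrary continuations, which is what the inductions need. -/
theorem encodeName_append_inj : ∀ {a b : Name} {s t : List Token},
    encodeName a ++ s = encodeName b ++ t → a = b ∧ s = t
  | [], [], s, t, h => by simpa [encodeName] using h
  | [], b :: bs, s, t, h => by simp [encodeName] at h
  | a :: as, [], s, t, h => by simp [encodeName] at h
  | a :: as, b :: bs, s, t, h => by
    simp only [encodeName, List.map_cons, List.cons_append, List.cons.injEq, Token.bit.injEq] at h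
    obtain ⟨h1, h2⟩ := encodeName_append_inj (a := as) (b := bs) (s := s) (t := t)
      (by simpa [encodeName] using h.2)
    exact ⟨by rw [h.1, h1], h2⟩

theorem length_encodeName (a : Name) : (encodeName a).length = a.length + 1 := by
  simp [encodeName]

theorem encodeName_ne_nil (a : Name) : encodeName a ≠ [] := by simp [encodeName]

theorem encodeRegex_append_inj : ∀ {R R' : RegularExpression S} {s t : List Token},
    encodeRegex R ++ s = encodeRegex R' ++ t → R = R' ∧ s = t := by
  intro R
  induction R with
  | zero => intro R' s t h; cases R' <;> simp_all [encodeRegex]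
  | epsilon => intro R' s t h; cases R' <;> simp_all [encodeRegex]
  | char a =>
    intro R' s t h
    cases R' <;> simp only [encodeRegex, List.cons_append, List.cons.injEq, reduceCtorEq,
      false_and, true_and] at h
    obtain ⟨h1, h2⟩ := encodeName_append_inj h
    exact ⟨by rw [Subtype.ext h1], h2⟩
  | plus R₁ R₂ ih₁ ih₂ =>
    intro R' s t h
    cases R' <;> simp only [encodeRegex, List.cons_append, List.cons.injEq, reduceCtorEq,
      false_and, true_and, List.append_assoc] at h
    obtain ⟨rfl, h2⟩ := ih₁ h
    obtain ⟨rfl, h3⟩ := ih₂ h2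
    exact ⟨rfl, h3⟩
  | comp R₁ R₂ ih₁ ih₂ =>
    intro R' s t h
    cases R' <;> simp only [encodeRegex, List.cons_append, List.cons.injEq, reduceCtorEq,
      false_and, true_and, List.append_assoc] at h
    obtain ⟨rfl, h2⟩ := ih₁ h
    obtain ⟨rfl, h3⟩ := ih₂ h2
    exact ⟨rfl, h3⟩
  | star R ih =>
    intro R' s t h
    cases R' <;> simp only [encodeRegex, List.cons_append, List.cons.injEq, reduceCtorEq,
      false_and, true_and] at h
    obtain ⟨rfl, h2⟩ := ih h
    exact ⟨rfl, h2⟩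

theorem encodeRegex_ne_nil (R : RegularExpression S) : encodeRegex R ≠ [] := by
  cases R <;> simp [encodeRegex]

theorem At.name_unique {x : List Token} {i : ℕ} {a b : Name} (ha : At x i (encodeName a))
    (hb : At x i (encodeName b)) : a = b := by
  obtain ⟨s, hs⟩ := ha
  obtain ⟨t, ht⟩ := hb
  exact (encodeName_append_inj (hs.trans ht.symm)).1

theorem At.regex_unique {x : List Token} {i : ℕ} {R R' : RegularExpression S}
    (hR : At x i (encodeRegex R)) (hR' : At x i (encodeRegex R')) : R = R' := by
  obtain ⟨s, hs⟩ := hR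
  obtain ⟨t, ht⟩ := hR'
  exact (encodeRegex_append_inj (hs.trans ht.symm)).1

theorem notMem_encodeName {m : Token} (hm : m ≠ .endName) (hm' : ∀ b, m ≠ .bit b) (a : Name) :
    m ∉ encodeName a := by
  simp [encodeName, hm, fun b => (hm' b).symm]

/-- These tokens delimit the parts of a query, so their occurrences reveal where the parts start. -/
theorem notMem_encodeRegex {m : Token} (hm : m ∈ ({.atom, .distinguished, .endQuery} : Set Token))
    (R : RegularExpression S) : m ∉ encodeRegex R := by
  have hn : ∀ a, m ∉ encodeName a :=
    notMem_encodeName (by rintro rfl; simp at hm) (by rintro b rfl; simp at hm)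
  induction R with
  | zero => rintro h; simp only [encodeRegex, List.mem_singleton] at h; simp [h] at hm
  | epsilon => rintro h; simp only [encodeRegex, List.mem_singleton] at h; simp [h] at hm
  | char a =>
    rintro h
    simp only [encodeRegex, List.mem_cons, hn, or_false] at h
    simp [h] at hm
  | plus R₁ R₂ ih₁ ih₂ =>
    rintro h
    simp only [encodeRegex, List.mem_cons, List.mem_append, ih₁, ih₂, or_false] at h
    simp [h] at hm
  | comp R₁ R₂ ih₁ ih₂ =>
    rintro h
    simp only [encodeRegex, List.mem_cons, List.mem_append, ih₁, ih₂, or_false] at h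
    simp [h] at hm
  | star R ih =>
    rintro h
    simp only [encodeRegex, List.mem_cons, ih, or_false] at h
    simp [h] at hm

theorem encodeAtom_block (A : Atom S) : ∃ t, encodeAtom A = .atom :: t ∧ .atom ∉ t :=
  ⟨_, rfl, by
    simp [notMem_encodeName, notMem_encodeRegex]⟩

theorem distinguished_block (a : Name) : ∃ t, Token.distinguished :: encodeName a =
    .distinguished :: t ∧ .distinguished ∉ t :=
  ⟨_, rfl, by simp [notMem_encodeName]⟩

theorem distinguished_notMem_encodeAtoms (l : List (Atom S)) :
    .distinguished ∉ l.flatMap encodeAtom := by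
  simp [encodeAtom, notMem_encodeName, notMem_encodeRegex]

theorem atom_notMem_distinguished (l : List Name) :
    .atom ∉ l.flatMap (fun a => Token.distinguished :: encodeName a) := by
  simp [notMem_encodeName]

theorem encodeQuery_append_inj {Q Q' : CRPQ S} {s t : List Token}
    (h : encodeQuery Q ++ s = encodeQuery Q' ++ t) : Q = Q' ∧ s = t := by
  have hatoms : ∀ (l l' : List (Atom S)),
      l.flatMap encodeAtom ++ (.endQuery :: s) = l'.flatMap encodeAtom ++ (.endQuery :: t) →
      l = l' ∧ s = t := by
    intro l
    induction l with
    | nil =>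
      intro l' h
      cases l' with
      | nil => simpa using h
      | cons A l' => simp [encodeAtom] at h
    | cons A l ih =>
      intro l' h
      cases l' with
      | nil => simp [encodeAtom] at h
      | cons A' l' =>
        simp only [encodeAtom, List.flatMap_cons, List.cons_append, List.append_assoc,
          List.cons.injEq, true_and] at h
        obtain ⟨h1, h⟩ := encodeName_append_inj h
        obtain ⟨h2, h⟩ := encodeRegex_append_inj h
        obtain ⟨h3, h⟩ := encodeName_append_inj h
        obtain ⟨h4, h⟩ := ih l' h
        refine ⟨?_, h⟩
        cases A; cases A'; simp_all
  have hdist : ∀ (d d' : List Name) (l l' : List (Atom S)),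
      d.flatMap (fun x => Token.distinguished :: encodeName x) ++
        (l.flatMap encodeAtom ++ (.endQuery :: s)) =
      d'.flatMap (fun x => Token.distinguished :: encodeName x) ++
        (l'.flatMap encodeAtom ++ (.endQuery :: t)) → d = d' ∧ l = l' ∧ s = t := by
    intro d
    induction d with
    | nil =>
      intro d' l l' h
      cases d' with
      | nil => exact ⟨rfl, hatoms l l' (by simpa using h)⟩
      | cons a d' => cases l <;> simp [encodeAtom] at h
    | cons a d ih =>
      intro d' l l' h
      cases d' with
      | nil => cases l' <;> simp [encodeAtom] at h
      | cons a' d' =>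
        simp only [List.flatMap_cons, List.cons_append, List.append_assoc,
          List.cons.injEq, true_and] at h
        obtain ⟨h1, h⟩ := encodeName_append_inj h
        obtain ⟨h2, h⟩ := ih d' l l' h
        exact ⟨by rw [h1, h2], h⟩
  obtain ⟨h1, h2, h3⟩ := hdist Q.distinguished Q'.distinguished Q.atoms Q'.atoms
    (by simpa [encodeQuery] using h)
  refine ⟨?_, h3⟩
  cases Q; cases Q'; simp_all

end Encoding

/-- The tokens of the model are those of the word `x`. -/
structure Model.IsWord (M : Model) (x : List Token) : Prop where
  tok : ∀ a i, M.tok a i ↔ x[i]? = some a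
  size : x.length + 1 < M.size

/-! ### Names, expressions and queries recovered from the tables -/

namespace Model

variable {M : Model} {x : List Token} {S : Set Name}

theorem IsWord.lt_size (h : M.IsWord x) {i : ℕ} (hi : i ≤ x.length + 1) : i < M.size :=
  lt_of_le_of_lt hi h.size

theorem IsWord.nameAt_iff (h : M.IsWord x) {i j : ℕ} :
    M.NameAt i j ↔ ∃ a, At x i (encodeName a) ∧ j = i + (encodeName a).length := by
  constructor
  · rintro ⟨e, -, rfl, hie, he, hb⟩
    obtain ⟨n, rfl⟩ := Nat.exists_eq_add_of_le hie
    clear hie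
    have hlen : i + n < x.length := by
      rw [h.tok] at he
      exact (List.getElem?_eq_some_iff.1 he).1
    induction n generalizing i with
    | zero => exact ⟨[], by simpa [encodeName, at_cons, at_nil] using (h.tok _ _).1 he, by simp [encodeName]⟩
    | succ n ih =>
      obtain ⟨a, ha, hl⟩ := ih (i := i + 1) (by rwa [show i + 1 + n = i + (n + 1) by omega])
        (fun k hk h1 h2 => hb k hk (by omega) (by omega)) (by omega)
      have hi := hb i (h.lt_size (by omega)) le_rfl (by omega)
      rw [length_encodeName] at hl
      rcases hi with hi | hi
      · exact ⟨false :: a, at_cons.2 ⟨(h.tok _ _).1 hi, ha⟩, by simp [length_encodeName]; omega⟩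
      · exact ⟨true :: a, at_cons.2 ⟨(h.tok _ _).1 hi, ha⟩, by simp [length_encodeName]; omega⟩
  · rintro ⟨a, ha, rfl⟩
    have hle := ha.add_length_le (encodeName_ne_nil a)
    rw [length_encodeName] at hle
    refine ⟨i + a.length, h.lt_size (by omega), by rw [length_encodeName]; omega, by omega, ?_, ?_⟩
    · rw [h.tok, ha.getElem? (by simp [length_encodeName])]
      simp [encodeName]
    · intro k _ hik hk
      have h1 := ha.getElem? (n := k - i) (by rw [length_encodeName]; omega)
      rw [show i + (k - i) = k by omega, encodeName, List.getElem?_append_left (by simp; omega),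
        List.getElem?_map, List.getElem?_eq_getElem (l := a) (by omega)] at h1
      unfold IsBit
      rw [h.tok, h.tok, h1]
      cases a[k - i] <;> simp

theorem IsWord.nameIs_iff (h : M.IsWord x) {i : ℕ} (a : Name) :
    M.NameIs a i ↔ At x i (encodeName a) := by
  induction a generalizing i with
  | nil => simp [NameIs, encodeName, at_cons, at_nil, h.tok]
  | cons b a ih =>
    have : encodeName (b :: a) = .bit b :: encodeName a := rfl
    rw [this, at_cons, NameIs, h.tok]
    refine and_congr_right fun hi => ?_
    have := (List.getElem?_eq_some_iff.1 hi).1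
    constructor
    · rintro ⟨_, -, rfl, hm⟩
      exact ih.1 hm
    · exact fun hm => ⟨i + 1, h.lt_size (by omega), rfl, ih.2 hm⟩

/-- Induction on the distance of `i` to the end of the word; beyond the end there are no tokens, and
both sides are false. -/
theorem SameNameSpec.sameName_iff (hs : M.SameNameSpec) (h : M.IsWord x) : ∀ (n : ℕ) {i j : ℕ},
    x.length ≤ i + n → i < M.size → j < M.size →
    (M.SameName i j ↔ ∃ a, At x i (encodeName a) ∧ At x j (encodeName a)) := by
  intro n
  induction n with
  | zero =>
    intro i j hn hi hj
    have hx : ∀ a, ¬ M.tok a i := fun a ha => by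
      rw [h.tok, List.getElem?_eq_none (by omega)] at ha
      simp at ha
    rw [hs i hi j hj]
    constructor
    · rintro (⟨h1, -⟩ | ⟨_, _, _, _, _, _, _, ⟨h1, -⟩ | ⟨h1, -⟩⟩) <;> exact absurd h1 (hx _)
    · rintro ⟨a, ha, -⟩
      have := ha.add_length_le (encodeName_ne_nil a)
      rw [length_encodeName] at this
      omega
  | succ n ih =>
    intro i j hn hi hj
    rw [hs i hi j hj]
    constructor
    · rintro (⟨h1, h2⟩ | ⟨_, hi', _, hj', rfl, rfl, hij, hb⟩)
      · exact ⟨[], by simpa [encodeName, at_cons, at_nil] using (h.tok _ _).1 h1,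
          by simpa [encodeName, at_cons, at_nil] using (h.tok _ _).1 h2⟩
      · obtain ⟨a, h1, h2⟩ := (ih (by omega) hi' hj').1 hij
        rcases hb with ⟨h3, h4⟩ | ⟨h3, h4⟩
        · exact ⟨false :: a, at_cons.2 ⟨(h.tok _ _).1 h3, h1⟩, at_cons.2 ⟨(h.tok _ _).1 h4, h2⟩⟩
        · exact ⟨true :: a, at_cons.2 ⟨(h.tok _ _).1 h3, h1⟩, at_cons.2 ⟨(h.tok _ _).1 h4, h2⟩⟩
    · rintro ⟨a, h1, h2⟩
      have l1 := h1.add_length_le (encodeName_ne_nil a)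
      have l2 := h2.add_length_le (encodeName_ne_nil a)
      cases a with
      | nil =>
        left
        simpa [encodeName, at_cons, at_nil, h.tok] using And.intro h1 h2
      | cons b a =>
        right
        rw [length_encodeName] at l1 l2
        have e : encodeName (b :: a) = .bit b :: encodeName a := rfl
        rw [e, at_cons] at h1 h2
        refine ⟨i + 1, h.lt_size (by omega), j + 1, h.lt_size (by omega), rfl, rfl,
          (ih (by omega) (h.lt_size (by omega)) (h.lt_size (by omega))).2 ⟨a, h1.2, h2.2⟩, ?_⟩
        simp only [h.tok]
        cases b
        · exact .inl ⟨h1.1, h2.1⟩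
        · exact .inr ⟨h1.1, h2.1⟩

end Model

end CRPQContainment

namespace CRPQContainment

namespace Model

variable {M : Model} {x : List Token} {S : Set Name}

/-- `label` holds at the positions where the name of a label from `S` is written. -/
def IsLabel (S : Set Name) (label : Model → ℕ → Prop) (M : Model) (x : List Token) : Prop :=
  ∀ i < M.size, label M i ↔ ∃ a ∈ S, At x i (encodeName a)

/-- One unfolding of the recursion for expressions, with `P` in place of the table and correct to
the right of `i`. It serves both directions: a table that obeys the recursion is correct, and the
correct table obeys the recursion. -/
theorem exists_regex_iff {label : Model → ℕ → Prop} (h : M.IsWord x) (hl : IsLabel S label M x)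
    {P : ℕ → ℕ → Prop} {i j : ℕ} (hj : j < M.size)
    (hP : ∀ {i' j' : ℕ}, i < i' → i' < M.size → j' < M.size →
      (P i' j' ↔ ∃ R : RegularExpression S, At x i' (encodeRegex R) ∧
        j' = i' + (encodeRegex R).length)) :
    (∃ i' < M.size, i' = i + 1 ∧
      (((M.tok .empty i ∨ M.tok .epsilon i) ∧ j = i') ∨
        (M.tok .symbol i ∧ M.NameAt i' j ∧ label M i') ∨
        ((M.tok .plus i ∨ M.tok .comp i) ∧ ∃ m < M.size, P i' m ∧ P m j) ∨
        (M.tok .star i ∧ P i' j))) ↔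
    ∃ R : RegularExpression S, At x i (encodeRegex R) ∧ j = i + (encodeRegex R).length := by
  constructor
  · rintro ⟨_, hi', rfl, ⟨h1 | h1, rfl⟩ | ⟨h1, h2, h3⟩ | ⟨h1, m, hm, h2, h3⟩ | ⟨h1, h2⟩⟩
    · exact ⟨.zero, by simpa [encodeRegex, at_cons, at_nil] using (h.tok _ _).1 h1,
        by simp [encodeRegex]⟩
    · exact ⟨.epsilon, by simpa [encodeRegex, at_cons, at_nil] using (h.tok _ _).1 h1,
        by simp [encodeRegex]⟩
    · obtain ⟨a, ha, rfl⟩ := h.nameAt_iff.1 h2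
      obtain ⟨b, hb, hb'⟩ := (hl _ hi').1 h3
      obtain rfl := ha.name_unique hb'
      exact ⟨.char ⟨a, hb⟩, at_cons.2 ⟨(h.tok _ _).1 h1, ha⟩, by simp [encodeRegex]; omega⟩
    · obtain ⟨R₁, hR₁, rfl⟩ := (hP (by omega) hi' hm).1 h2
      obtain ⟨R₂, hR₂, rfl⟩ := (hP (by omega) hm hj).1 h3
      rcases h1 with h1 | h1
      · exact ⟨.plus R₁ R₂, at_cons.2 ⟨(h.tok _ _).1 h1, at_append.2 ⟨hR₁, hR₂⟩⟩,
          by simp [encodeRegex]; omega⟩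
      · exact ⟨.comp R₁ R₂, at_cons.2 ⟨(h.tok _ _).1 h1, at_append.2 ⟨hR₁, hR₂⟩⟩,
          by simp [encodeRegex]; omega⟩
    · obtain ⟨R, hR, rfl⟩ := (hP (by omega) hi' hj).1 h2
      exact ⟨.star R, at_cons.2 ⟨(h.tok _ _).1 h1, hR⟩, by simp [encodeRegex]; omega⟩
  · rintro ⟨R, hR, rfl⟩
    have hlen := hR.add_length_le (encodeRegex_ne_nil R)
    have hpos := List.length_pos_of_ne_nil (encodeRegex_ne_nil R)
    refine ⟨i + 1, h.lt_size (by omega), rfl, ?_⟩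
    simp only [h.tok]
    cases R with
    | zero => exact .inl ⟨.inl (at_cons.1 hR).1, by simp [encodeRegex]⟩
    | epsilon => exact .inl ⟨.inr (at_cons.1 hR).1, by simp [encodeRegex]⟩
    | char a =>
      have h1 := at_cons.1 hR
      exact .inr (.inl ⟨h1.1, h.nameAt_iff.2 ⟨a, h1.2, by simp [encodeRegex]; omega⟩,
        (hl _ (h.lt_size (by omega))).2 ⟨a, a.2, h1.2⟩⟩)
    | plus R₁ R₂ =>
      obtain ⟨h1, h2⟩ := at_cons.1 hR
      obtain ⟨h2, h3⟩ := at_append.1 h2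
      simp only [encodeRegex, List.length_cons, List.length_append] at hlen hpos hj ⊢
      exact .inr (.inr (.inl ⟨.inl h1, i + 1 + (encodeRegex R₁).length, h.lt_size (by omega),
        (hP (by omega) (h.lt_size (by omega)) (h.lt_size (by omega))).2 ⟨R₁, h2, rfl⟩,
        (hP (by omega) (h.lt_size (by omega)) hj).2 ⟨R₂, h3, by omega⟩⟩))
    | comp R₁ R₂ =>
      obtain ⟨h1, h2⟩ := at_cons.1 hR
      obtain ⟨h2, h3⟩ := at_append.1 h2
      simp only [encodeRegex, List.length_cons, List.length_append] at hlen hpos hj ⊢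
      exact .inr (.inr (.inl ⟨.inr h1, i + 1 + (encodeRegex R₁).length, h.lt_size (by omega),
        (hP (by omega) (h.lt_size (by omega)) (h.lt_size (by omega))).2 ⟨R₁, h2, rfl⟩,
        (hP (by omega) (h.lt_size (by omega)) hj).2 ⟨R₂, h3, by omega⟩⟩))
    | star R =>
      obtain ⟨h1, h2⟩ := at_cons.1 hR
      simp only [encodeRegex, List.length_cons] at hlen hpos hj ⊢
      exact .inr (.inr (.inr ⟨h1, (hP (by omega) (h.lt_size (by omega)) hj).2 ⟨R, h2, by omega⟩⟩))

theorem RegexSpec.regexAt_iff {label : Model → ℕ → Prop} (hr : M.RegexSpec label) (h : M.IsWord x)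
    (hl : IsLabel S label M x) : ∀ (n : ℕ) {i j : ℕ}, M.size ≤ i + n → i < M.size → j < M.size →
    (M.RegexAt i j ↔ ∃ R : RegularExpression S, At x i (encodeRegex R) ∧
      j = i + (encodeRegex R).length)
  | 0, _, _, hn, hi, _ => by omega
  | n + 1, i, j, hn, hi, hj => (hr i hi j hj).trans <| exists_regex_iff h hl hj
      fun h1 => hr.regexAt_iff h hl n (by omega)

theorem regexSpec_of_iff {label : Model → ℕ → Prop} (h : M.IsWord x) (hl : IsLabel S label M x)
    (hr : ∀ i < M.size, ∀ j < M.size, (M.RegexAt i j ↔ ∃ R : RegularExpression S,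
      At x i (encodeRegex R) ∧ j = i + (encodeRegex R).length)) : M.RegexSpec label :=
  fun i hi j hj => (hr i hi j hj).trans (exists_regex_iff h hl hj fun _ hi' hj' =>
    hr _ hi' _ hj').symm

/-- The relations of the model that describe the syntax of the word are as they should be. -/
structure SyntaxCorrect (M : Model) (x : List Token) (S : Set Name) : Prop where
  isWord : M.IsWord x
  sameName_iff : ∀ {i j : ℕ}, i < M.size → j < M.size →
    (M.SameName i j ↔ ∃ a, At x i (encodeName a) ∧ At x j (encodeName a))
  regexAt_iff : ∀ {i j : ℕ}, i < M.size → j < M.size →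
    (M.RegexAt i j ↔ ∃ R : RegularExpression S, At x i (encodeRegex R) ∧
      j = i + (encodeRegex R).length)

theorem syntaxCorrect {label : Model → ℕ → Prop} (h : M.IsWord x) (hs : M.SameNameSpec)
    (hr : M.RegexSpec label) (hl : IsLabel S label M x) : M.SyntaxCorrect x S :=
  ⟨h, hs.sameName_iff h x.length (by omega), hr.regexAt_iff h hl M.size (by omega)⟩

/-- The parts of the atom `A` are written at the positions `i`, `i'`, `j`, `k`, up to `l`. -/
structure AtomPositions (x : List Token) (A : Atom S) (i i' j k l : ℕ) : Prop where
  start : x[i]? = some .atom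
  eq_source : i' = i + 1
  source : At x i' (encodeName A.source)
  eq_regex : j = i' + (encodeName A.source).length
  regex : At x j (encodeRegex A.regex)
  eq_target : k = j + (encodeRegex A.regex).length
  target : At x k (encodeName A.target)
  eq_end : l = k + (encodeName A.target).length

theorem AtomPositions.at {A : Atom S} {i i' j k l : ℕ} (h : AtomPositions x A i i' j k l) :
    At x i (encodeAtom A) ∧ l = i + (encodeAtom A).length := by
  obtain ⟨h1, rfl, h2, rfl, h3, rfl, h4, rfl⟩ := h
  refine ⟨at_cons.2 ⟨h1, at_append.2 ⟨at_append.2 ⟨h2, h3⟩, ?_⟩⟩, ?_⟩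
  · rwa [List.length_append, ← add_assoc]
  · simp [encodeAtom]; omega

theorem atomPositions_of_at {A : Atom S} {i : ℕ} (h : At x i (encodeAtom A)) :
    AtomPositions x A i (i + 1) (i + 1 + (encodeName A.source).length)
      (i + 1 + (encodeName A.source).length + (encodeRegex A.regex).length)
      (i + (encodeAtom A).length) := by
  obtain ⟨h1, h2⟩ := at_cons.1 h
  obtain ⟨h3, h4⟩ := at_append.1 h2
  obtain ⟨h5, h6⟩ := at_append.1 h3
  refine ⟨h1, rfl, h5, rfl, h6, rfl, ?_, ?_⟩
  · rwa [List.length_append, ← add_assoc] at h4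
  · simp [encodeAtom]; omega

theorem AtomPositions.lt_size {A : Atom S} {i i' j k l : ℕ} (hp : AtomPositions x A i i' j k l)
    (h : M.IsWord x) : i < M.size ∧ i' < M.size ∧ j < M.size ∧ k < M.size ∧ l < M.size := by
  have h1 := hp.target.add_length_le (encodeName_ne_nil _)
  have h2 := h.size
  obtain ⟨-, rfl, -, rfl, -, rfl, -, rfl⟩ := hp
  omega

namespace SyntaxCorrect

theorem sameName_iff_of_at (h : M.SyntaxCorrect x S) {i j : ℕ} {a b : Name}
    (ha : At x i (encodeName a)) (hb : At x j (encodeName b)) : M.SameName i j ↔ a = b := by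
  have h1 := ha.add_length_le (encodeName_ne_nil _)
  have h2 := hb.add_length_le (encodeName_ne_nil _)
  rw [h.sameName_iff (h.isWord.lt_size (by omega)) (h.isWord.lt_size (by omega))]
  constructor
  · rintro ⟨c, hc, hc'⟩
    rw [ha.name_unique hc, hb.name_unique hc']
  · rintro rfl
    exact ⟨a, ha, hb⟩

theorem atomAt_iff (h : M.SyntaxCorrect x S) {i i' j k l : ℕ} (hj : j < M.size)
    (hk : k < M.size) : M.AtomAt i i' j k l ↔ ∃ A : Atom S, AtomPositions x A i i' j k l := by
  constructor
  · rintro ⟨h1, h2, h3, h4, h5⟩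
    obtain ⟨a, ha, h6⟩ := h.isWord.nameAt_iff.1 h3
    obtain ⟨R, hR, h7⟩ := (h.regexAt_iff hj hk).1 h4
    obtain ⟨b, hb, h8⟩ := h.isWord.nameAt_iff.1 h5
    exact ⟨⟨a, R, b⟩, (h.isWord.tok _ _).1 h1, h2, ha, h6, hR, h7, hb, h8⟩
  · rintro ⟨A, h1, h2, h3, h4, h5, h6, h7, h8⟩
    exact ⟨(h.isWord.tok _ _).2 h1, h2, h.isWord.nameAt_iff.2 ⟨_, h3, h4⟩,
      (h.regexAt_iff hj hk).2 ⟨_, h5, h6⟩, h.isWord.nameAt_iff.2 ⟨_, h7, h8⟩⟩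

/-- Atoms written up to `e` can be read off the word. -/
theorem exists_atoms (h : M.SyntaxCorrect x S) (ha : M.AtomsSpec) : ∀ (n : ℕ) {i e : ℕ},
    x.length ≤ i + n → i < M.size → e < M.size → M.AtomsAt i e →
    ∃ l : List (Atom S), At x i (l.flatMap encodeAtom ++ [.endQuery]) ∧
      e = i + (l.flatMap encodeAtom).length := by
  intro n
  induction n with
  | zero =>
    intro i e hn hi he hie
    have hx : ∀ a, ¬ M.tok a i := fun a ha => by
      rw [h.isWord.tok, List.getElem?_eq_none (by omega)] at ha
      simp at ha
    rcases ha i hi e he hie with ⟨h1, -⟩ | ⟨_, _, _, _, _, _, _, _, ⟨h1, -⟩, -⟩ <;>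
      exact absurd h1 (hx _)
  | succ n ih =>
    intro i e hn hi he hie
    rcases ha i hi e he hie with ⟨h1, rfl⟩ | ⟨i', hi', j, hj, k, hk, l, hl, h1, h2⟩
    · exact ⟨[], by simpa [at_cons, at_nil] using (h.isWord.tok _ _).1 h1, by simp⟩
    · obtain ⟨A, hA⟩ := (h.atomAt_iff hj hk).1 h1
      obtain ⟨hA1, hA2⟩ := hA.at
      have hpos : 0 < (encodeAtom A).length := by simp [encodeAtom]
      obtain ⟨L, hL, hLe⟩ := ih (by omega) hl he h2
      refine ⟨A :: L, ?_, by rw [List.flatMap_cons, List.length_append]; omega⟩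
      rw [List.flatMap_cons, List.append_assoc, at_append, ← hA2]
      exact ⟨hA1, hL⟩

theorem exists_query (h : M.SyntaxCorrect x S) (ha : M.AtomsSpec) (hq : M.QuerySpec) :
    ∀ (n : ℕ) {i e : ℕ},
    x.length ≤ i + n → i < M.size → e < M.size → M.QueryFrom i e →
    ∃ (d : List Name) (l : List (Atom S)),
      At x i (d.flatMap (fun x => Token.distinguished :: encodeName x) ++
        l.flatMap encodeAtom ++ [.endQuery]) ∧
      e = i + (d.flatMap (fun x => Token.distinguished :: encodeName x)).length +
        (l.flatMap encodeAtom).length := by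
  intro n
  induction n with
  | zero =>
    intro i e hn hi he hie
    rcases hq i hi e he hie with h1 | ⟨_, _, _, _, h1, _⟩
    · obtain ⟨l, hl, hl'⟩ := h.exists_atoms ha x.length (by omega) hi he h1
      exact ⟨[], l, by simpa using hl, by simpa using hl'⟩
    · rw [h.isWord.tok, List.getElem?_eq_none (by omega)] at h1
      simp at h1
  | succ n ih =>
    intro i e hn hi he hie
    rcases hq i hi e he hie with h1 | ⟨i', hi', j, hj, h1, rfl, h2, h3⟩
    · obtain ⟨l, hl, hl'⟩ := h.exists_atoms ha x.length (by omega) hi he h1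
      exact ⟨[], l, by simpa using hl, by simpa using hl'⟩
    · obtain ⟨a, ha, rfl⟩ := h.isWord.nameAt_iff.1 h2
      obtain ⟨d, l, hdl, hdl'⟩ := ih (by omega) hj he h3
      refine ⟨a :: d, l, ?_, by simp only [List.flatMap_cons, List.length_append, List.length_cons]; omega⟩
      have : List.flatMap (fun x => Token.distinguished :: encodeName x) (a :: d) ++
          List.flatMap encodeAtom l ++ [Token.endQuery] = .distinguished :: (encodeName a ++
          (d.flatMap (fun x => Token.distinguished :: encodeName x) ++
          l.flatMap encodeAtom ++ [.endQuery])) := by simp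
      rw [this, at_cons, at_append]
      exact ⟨(h.isWord.tok _ _).1 h1, ha, hdl⟩

end SyntaxCorrect

/-- The query `Q` is written from position `s` to position `e`. -/
structure QueryAt (x : List Token) (s e : ℕ) (Q : CRPQ S) : Prop where
  query : At x s (encodeQuery Q)
  eq_end : e + 1 = s + (encodeQuery Q).length

/-! ### Locating the parts of a written query -/

namespace QueryAt

variable {s e : ℕ} {Q : CRPQ S}

theorem distinguished (hQ : QueryAt x s e Q) :
    At x s (Q.distinguished.flatMap fun x => Token.distinguished :: encodeName x) :=
  (at_append.1 (at_append.1 hQ.query).1).1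

theorem atoms (hQ : QueryAt x s e Q) :
    At x (s + (Q.distinguished.flatMap fun x => Token.distinguished :: encodeName x).length)
      (Q.atoms.flatMap encodeAtom) :=
  (at_append.1 (at_append.1 hQ.query).1).2

theorem end_eq (hQ : QueryAt x s e Q) :
    e = s + (Q.distinguished.flatMap fun x => Token.distinguished :: encodeName x).length +
      (Q.atoms.flatMap encodeAtom).length := by
  have := hQ.eq_end
  simp only [encodeQuery, List.length_append, List.length_singleton] at this
  omega

theorem le_length (hQ : QueryAt x s e Q) : e + 1 ≤ x.length := by
  rw [hQ.eq_end]
  exact hQ.query.add_length_le (by simp [encodeQuery])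

theorem exists_atom (hQ : QueryAt x s e Q) {i : ℕ} (h1 : s ≤ i) (h2 : i < e)
    (h3 : x[i]? = some .atom) : ∃ A ∈ Q.atoms, At x i (encodeAtom A) := by
  by_cases hi : i < s + (Q.distinguished.flatMap fun x => Token.distinguished :: encodeName x).length
  · exact absurd (hQ.distinguished.mem h1 hi h3) (atom_notMem_distinguished _)
  · exact exists_block i _ (fun A _ => encodeAtom_block A) hQ.atoms (by omega)
      (by have := hQ.end_eq; omega) h3

theorem exists_position_atom (hQ : QueryAt x s e Q) {A : Atom S} (hA : A ∈ Q.atoms) :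
    ∃ i, s ≤ i ∧ i < e ∧ At x i (encodeAtom A) := by
  obtain ⟨i, h1, h2, h3⟩ := hQ.atoms.block hA (by simp [encodeAtom])
  exact ⟨i, by omega, by have := hQ.end_eq; omega, h3⟩

theorem exists_distinguished (hQ : QueryAt x s e Q) {i : ℕ} (h1 : s ≤ i) (h2 : i < e)
    (h3 : x[i]? = some .distinguished) : ∃ a ∈ Q.distinguished, At x (i + 1) (encodeName a) := by
  by_cases hi : i < s + (Q.distinguished.flatMap fun x => Token.distinguished :: encodeName x).length
  · obtain ⟨a, ha, h⟩ := exists_block i _ (fun a _ => distinguished_block a) hQ.distinguished h1 hi h3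
    exact ⟨a, ha, (at_cons.1 h).2⟩
  · exact absurd (hQ.atoms.mem (by omega) (by have := hQ.end_eq; omega) h3)
      (distinguished_notMem_encodeAtoms _)

theorem exists_position_distinguished (hQ : QueryAt x s e Q) {a : Name}
    (ha : a ∈ Q.distinguished) : ∃ i, s ≤ i ∧ i < e ∧ x[i]? = some .distinguished ∧
      At x (i + 1) (encodeName a) := by
  obtain ⟨i, h1, h2, h3⟩ := hQ.distinguished.block ha (by simp)
  exact ⟨i, h1, by have := hQ.end_eq; omega, at_cons.1 h3⟩

/-- An `atom` token in the range of the query starts the code of one of its atoms, and unique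
readability identifies that atom with the one read off at the given positions. -/
theorem atomIn_iff (h : M.SyntaxCorrect x S) (hQ : QueryAt x s e Q) {i i' j k l : ℕ}
    (hj : j < M.size) (hk : k < M.size) :
    M.AtomIn s e i i' j k l ↔ ∃ A ∈ Q.atoms, s ≤ i ∧ i < e ∧ AtomPositions x A i i' j k l := by
  constructor
  · rintro ⟨h1, h2, h3⟩
    obtain ⟨A, hA⟩ := (h.atomAt_iff hj hk).1 h3
    obtain ⟨B, hB, hB'⟩ := hQ.exists_atom h1 h2 hA.start
    have hp := atomPositions_of_at hB'
    have e1 := hA.eq_source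
    have hs : A.source = B.source := (e1 ▸ hA.source).name_unique hp.source
    have e2 : j = i + 1 + (encodeName B.source).length := by rw [hA.eq_regex, e1, hs]
    have hr : A.regex = B.regex := (e2 ▸ hA.regex).regex_unique hp.regex
    have e3 : k = i + 1 + (encodeName B.source).length + (encodeRegex B.regex).length := by
      rw [hA.eq_target, e2, hr]
    have ht : A.target = B.target := (e3 ▸ hA.target).name_unique hp.target
    have : A = B := by cases A; cases B; simp_all
    exact ⟨A, this ▸ hB, h1, h2, hA⟩
  · rintro ⟨A, -, h1, h2, hA⟩
    exact ⟨h1, h2, (h.atomAt_iff hj hk).2 ⟨A, hA⟩⟩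

theorem exists_atomPositions (hQ : QueryAt x s e Q) (hM : M.IsWord x) {A : Atom S}
    (hA : A ∈ Q.atoms) : ∃ i < M.size, ∃ i' < M.size, ∃ j < M.size, ∃ k < M.size, ∃ l < M.size,
      s ≤ i ∧ i < e ∧ AtomPositions x A i i' j k l := by
  obtain ⟨i, h1, h2, h3⟩ := hQ.exists_position_atom hA
  have hp := atomPositions_of_at h3
  obtain ⟨a, b, c, d, f⟩ := hp.lt_size hM
  exact ⟨_, a, _, b, _, c, _, d, _, f, h1, h2, hp⟩

theorem exists_varPos (h : M.SyntaxCorrect x S) (hQ : QueryAt x s e Q) {a : Name}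
    (ha : a ∈ Q.vars) : ∃ p < M.size, M.VarPos s e p ∧ At x p (encodeName a) := by
  obtain ⟨A, hA, h1⟩ := ha
  obtain ⟨i, hi, i', hi', j, hj, k, hk, l, hl, h2, h3, h4⟩ := hQ.exists_atomPositions h.isWord hA
  have h5 := (hQ.atomIn_iff h (i' := i') (l := l) hj hk).2 ⟨A, hA, h2, h3, h4⟩
  rcases h1 with rfl | rfl
  · exact ⟨i', hi', ⟨i, hi, i', hi', j, hj, k, hk, l, hl, h5, .inl rfl⟩, h4.source⟩
  · exact ⟨k, hk, ⟨i, hi, i', hi', j, hj, k, hk, l, hl, h5, .inr rfl⟩, h4.target⟩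

theorem exists_of_varPos (h : M.SyntaxCorrect x S) (hQ : QueryAt x s e Q) {p : ℕ}
    (hp : M.VarPos s e p) : ∃ a ∈ Q.vars, At x p (encodeName a) := by
  obtain ⟨i, hi, i', hi', j, hj, k, hk, l, hl, hA, h1⟩ := id hp
  obtain ⟨A, hAQ, -, -, hA'⟩ := (hQ.atomIn_iff h hj hk).1 hA
  rcases h1 with rfl | rfl
  · exact ⟨_, ⟨A, hAQ, .inl rfl⟩, hA'.source⟩
  · exact ⟨_, ⟨A, hAQ, .inr rfl⟩, hA'.target⟩

theorem exists_of_distinguishedPos (h : M.SyntaxCorrect x S) (hQ : QueryAt x s e Q) {p : ℕ}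
    (hp : M.DistinguishedPos s e p) : ∃ a ∈ Q.distinguished, At x p (encodeName a) := by
  obtain ⟨i, -, h1, h2, h3, rfl⟩ := hp
  exact hQ.exists_distinguished h1 h2 ((h.isWord.tok _ _).1 h3)

theorem exists_distinguishedPos (h : M.SyntaxCorrect x S) (hQ : QueryAt x s e Q) {a : Name}
    (ha : a ∈ Q.distinguished) :
    ∃ p < M.size, M.DistinguishedPos s e p ∧ At x p (encodeName a) := by
  obtain ⟨i, h1, h2, h3, h4⟩ := hQ.exists_position_distinguished ha
  have := h4.add_length_le (encodeName_ne_nil _)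
  exact ⟨i + 1, h.isWord.lt_size (by omega), ⟨i, h.isWord.lt_size (by omega), h1, h2,
    (h.isWord.tok _ _).2 h3, rfl⟩, h4⟩

theorem distinguishedOccur (h : M.SyntaxCorrect x S) (hQ : QueryAt x s e Q) :
    M.DistinguishedOccur s e := by
  intro p hp hd
  obtain ⟨a, ha, hap⟩ := hQ.exists_of_distinguishedPos h hd
  obtain ⟨q, hq, hv, haq⟩ := hQ.exists_varPos h (Q.distinguished_occurs a ha)
  exact ⟨q, hq, hv, (h.sameName_iff_of_at hap haq).2 rfl⟩

end QueryAt

/-- The tables produce the lists of variables and atoms; `DistinguishedOccur` supplies the proof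
that belongs to a query. Here the atoms have to be identified by hand, since there is no query yet.
-/
theorem SyntaxCorrect.exists_queryAt (h : M.SyntaxCorrect x S) (ha : M.AtomsSpec)
    (hq : M.QuerySpec) {s e : ℕ} (hs : s < M.size) (he : e < M.size) (hQ : M.QueryFrom s e)
    (hd : M.DistinguishedOccur s e) : ∃ Q : CRPQ S, QueryAt x s e Q := by
  obtain ⟨d, l, h1, h2⟩ := h.exists_query ha hq x.length (by omega) hs he hQ
  have hatoms := (at_append.1 (at_append.1 h1).1).2
  have hdist := (at_append.1 (at_append.1 h1).1).1
  refine ⟨⟨d, l, fun a ha => ?_⟩, h1, by simp [encodeQuery]; simp at h2; omega⟩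
  obtain ⟨i, hi1, hi2, hi3⟩ := hdist.block ha (by simp)
  obtain ⟨hi4, hi5⟩ := at_cons.1 hi3
  have hlen := hi5.add_length_le (encodeName_ne_nil _)
  obtain ⟨q, hq, ⟨j, hj, j', hj', k, hk, m, hm, n, hn, ⟨hj1, hj2, hj3⟩, hjq⟩, hs⟩ :=
    hd (i + 1) (h.isWord.lt_size (by omega)) ⟨i, h.isWord.lt_size (by omega), hi1, by omega,
      (h.isWord.tok _ _).2 hi4, rfl⟩
  obtain ⟨A, hA⟩ := (h.atomAt_iff hk hm).1 hj3
  have hA' := hA.start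
  by_cases hjd : j < s + (d.flatMap fun x => Token.distinguished :: encodeName x).length
  · exact absurd (hdist.mem hj1 hjd hA') (atom_notMem_distinguished _)
  obtain ⟨B, hB, hB'⟩ := exists_block j l (fun A _ => encodeAtom_block A) hatoms (by omega)
    (by omega) hA'
  have hp := atomPositions_of_at hB'
  have e1 := hA.eq_source
  have hs1 : A.source = B.source := (e1 ▸ hA.source).name_unique hp.source
  have e2 : k = j + 1 + (encodeName B.source).length := by rw [hA.eq_regex, e1, hs1]
  have hr : A.regex = B.regex := (e2 ▸ hA.regex).regex_unique hp.regex
  have e3 : m = j + 1 + (encodeName B.source).length + (encodeRegex B.regex).length := by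
    rw [hA.eq_target, e2, hr]
  have ht : A.target = B.target := (e3 ▸ hA.target).name_unique hp.target
  refine ⟨B, hB, ?_⟩
  rcases hjq with rfl | rfl
  · left
    rw [← hs1]
    exact (h.sameName_iff_of_at hi5 hA.source).1 hs
  · right
    rw [← ht]
    exact (h.sameName_iff_of_at hi5 hA.target).1 hs

end Model

end CRPQContainment

namespace CRPQContainment

/-! ### Paths -/

namespace KB

variable {L V : Type} {K : KB L V}

theorem eq_of_edges : ∀ {K K' : KB L V}, K.edges = K'.edges → K = K'
  | ⟨_, _⟩, ⟨_, _⟩, rfl => rfl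

theorem path_nil_iff {u v : V} : K.Path u [] v ↔ u = v :=
  ⟨fun h => by cases h; rfl, fun h => h ▸ .nil u⟩

theorem path_cons_iff {u v : V} {a : L} {w : List L} :
    K.Path u (a :: w) v ↔ ∃ v', (u, a, v') ∈ K.edges ∧ K.Path v' w v :=
  ⟨fun h => by cases h with | cons h h' => exact ⟨_, h, h'⟩, fun ⟨_, h, h'⟩ => .cons h h'⟩

theorem path_append_iff {u v : V} {w w' : List L} :
    K.Path u (w ++ w') v ↔ ∃ m, K.Path u w m ∧ K.Path m w' v := by
  induction w generalizing u with
  | nil => simp [path_nil_iff]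
  | cons a w ih =>
    simp only [List.cons_append, path_cons_iff, ih]
    constructor
    · rintro ⟨v', h, m, h1, h2⟩
      exact ⟨m, ⟨v', h, h1⟩, h2⟩
    · rintro ⟨m, ⟨v', h, h1⟩, h2⟩
      exact ⟨v', h, m, h1, h2⟩

theorem path_singleton_iff {u v : V} {a : L} : K.Path u [a] v ↔ (u, a, v) ∈ K.edges := by
  simp [path_cons_iff, path_nil_iff]

end KB

/-- The first factor can be taken nonempty, so the rest is shorter; inductions over the length of
the word rely on this. -/
theorem matches_star_cases {L : Type} {R : RegularExpression L} {w : List L}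
    (h : w ∈ (RegularExpression.star R).matches') :
    w = [] ∨ ∃ w₁ w₂, w₁ ≠ [] ∧ w = w₁ ++ w₂ ∧ w₁ ∈ R.matches' ∧
      w₂ ∈ (RegularExpression.star R).matches' := by
  rw [RegularExpression.matches'_star] at h
  obtain ⟨l, rfl, hl⟩ := Language.mem_kstar_iff_exists_nonempty.1 h
  cases l with
  | nil => exact .inl rfl
  | cons w₁ l =>
    refine .inr ⟨w₁, l.flatten, (hl w₁ (by simp)).2, rfl, (hl w₁ (by simp)).1, ?_⟩
    rw [RegularExpression.matches'_star]
    exact Language.mem_kstar_iff_exists_nonempty.2 ⟨l, rfl, fun y hy => hl y (by simp [hy])⟩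

theorem append_mem_matches_star {L : Type} {R : RegularExpression L} {w₁ w₂ : List L}
    (h₁ : w₁ ∈ R.matches') (h₂ : w₂ ∈ (RegularExpression.star R).matches') :
    w₁ ++ w₂ ∈ (RegularExpression.star R).matches' := by
  rw [RegularExpression.matches'_star] at h₂ ⊢
  obtain ⟨l, rfl, hl⟩ := Language.mem_kstar.1 h₂
  exact Language.mem_kstar.2 ⟨w₁ :: l, rfl, by simpa using ⟨h₁, hl⟩⟩

/-! ### Certificates -/

theorem horner_four (N c i j u v : ℕ) :
    horner N c [i, j, u, v] = (((c * N + i) * N + j) * N + u) * N + v := rfl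

/-- Every family of relations on the domain is described by a certificate. -/
theorem exists_certificate (N : ℕ) (Z : ℕ → ℕ → ℕ → ℕ → ℕ → Prop) :
    ∃ y : List Bool, y.length = 8 * N ^ 4 ∧ ∀ c < 8, ∀ i < N, ∀ j < N, ∀ u < N, ∀ v < N,
      (y[horner N c [i, j, u, v]]? = some true ↔ Z c i j u v) := by
  classical
  -- The arguments are the base `N` digits of the address `n`, as arranged by `horner`.
  refine ⟨(List.range (8 * N ^ 4)).map fun n =>
    decide (Z (n / N / N / N / N) (n / N / N / N % N) (n / N / N % N) (n / N % N) (n % N)),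
    by simp, fun c hc i hi j hj u hu v hv => ?_⟩
  have hN : 0 < N := by omega
  have hlt : ∀ {m h v : ℕ}, h < m → v < N → h * N + v < m * N := fun {m h v} h1 h2 => by
    calc h * N + v < h * N + N := by omega
      _ = (h + 1) * N := by ring
      _ ≤ m * N := Nat.mul_le_mul_right _ h1
  have hdiv : ∀ {h v : ℕ}, v < N → (h * N + v) / N = h := fun {h v} h1 => by
    rw [mul_comm, Nat.mul_add_div hN, Nat.div_eq_of_lt h1, add_zero]
  have hmod : ∀ {h v : ℕ}, v < N → (h * N + v) % N = v := fun {h v} h1 => by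
    rw [add_comm, Nat.add_mul_mod_self_right, Nat.mod_eq_of_lt h1]
  have hb : horner N c [i, j, u, v] < 8 * N ^ 4 := by
    have := hlt (hlt (hlt (hlt hc hi) hj) hu) hv
    rw [horner_four]
    calc _ < _ := this
      _ = _ := by ring
  rw [List.getElem?_map, List.getElem?_range hb, horner_four]
  simp [hdiv, hmod, hi, hj, hu, hv]

theorem wordStructure_isWord {d : ℕ} (hd : d ≠ 0) (x : List Token) (y z : List Bool) :
    (wordStructure d x y z).model.IsWord x where
  tok a i := by
    simp [BitStructure.model, wordStructure]
  size := by
    simp only [BitStructure.model, wordStructure]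
    calc x.length + 1 < (x.length + 2) ^ 1 := by rw [pow_one]; omega
      _ ≤ _ := Nat.pow_le_pow_right (by omega) (by omega)

namespace Model

variable {M : Model} {x : List Token} {S : Set Name}

/-! ### The knowledge base of a certificate -/

/-- The knowledge base that is described by the first certificate. -/
def kb (M : Model) (x : List Token) (S : Set Name) : KB S (Fin M.size) where
  edges := {t | ∃ p < M.size, x[p]? = some .symbol ∧ At x (p + 1) (encodeName t.2.1) ∧
    M.Edge p t.1 t.2.2}
  finite_edges := by
    have h : (⋃ p : Fin M.size, (Set.univ : Set (Fin M.size)) ×ˢ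
        ({a : S | At x (p + 1) (encodeName a)} ×ˢ (Set.univ : Set (Fin M.size)))).Finite :=
      Set.finite_iUnion fun p => Set.finite_univ.prod <| Set.Finite.prod
        (Set.Subsingleton.finite fun a ha b hb => Subtype.ext (At.name_unique ha hb)) Set.finite_univ
    refine h.subset ?_
    rintro ⟨u, a, v⟩ ⟨p, hp, -, h1, -⟩
    exact Set.mem_iUnion.2 ⟨⟨p, hp⟩, trivial, h1, trivial⟩

/-- Soundness of the table of matches: induction on the expression, and for a star a second
induction on the bound `r`. -/
theorem MatchesSpec.exists_path {b : Bool} (h : M.SyntaxCorrect x S) (hs : M.MatchesSpec b)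
    (R : RegularExpression S) : ∀ {q r : ℕ} {u v : Fin M.size}, At x q (encodeRegex R) →
    r < M.size → M.Matches b q u v r → ∃ w ∈ R.matches', (M.kb x S).Path u w v := by
  have hlt : ∀ {q} {R : RegularExpression S}, At x q (encodeRegex R) → q < M.size :=
    fun hR => h.isWord.lt_size (by have := hR.add_length_le (encodeRegex_ne_nil _); omega)
  have hm : ∀ {q m : ℕ} {R R' : RegularExpression S}, m < M.size → At x q (encodeRegex R) →
      M.RegexAt q m → At x (q + (encodeRegex R).length) (encodeRegex R') →
      At x m (encodeRegex R') := by
    intro q m R R' hm hR hqm hR'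
    obtain ⟨R'', h1, rfl⟩ := (h.regexAt_iff (hlt hR) hm).1 hqm
    obtain rfl := hR.regex_unique h1
    exact hR'
  induction R with
  | zero =>
    intro q r u v hR hr hq
    have ht := (at_cons.1 hR).1
    obtain ⟨q', -, rfl, h1⟩ := hs q (hlt hR) u u.2 v v.2 r hr hq
    simp [h.isWord.tok, ht] at h1
  | epsilon =>
    intro q r u v hR hr hq
    have ht := (at_cons.1 hR).1
    obtain ⟨q', -, rfl, h1⟩ := hs q (hlt hR) u u.2 v v.2 r hr hq
    simp [h.isWord.tok, ht] at h1
    exact ⟨[], by simp [RegularExpression.matches'], KB.path_nil_iff.2 (Fin.ext h1)⟩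
  | char a =>
    intro q r u v hR hr hq
    obtain ⟨ht, ha⟩ := at_cons.1 hR
    obtain ⟨q', -, rfl, h1⟩ := hs q (hlt hR) u u.2 v v.2 r hr hq
    simp only [h.isWord.tok, ht, Option.some.injEq, reduceCtorEq, false_and, false_or, or_false,
      true_and] at h1
    obtain ⟨p, hp, p', hp', h1, rfl, h2, h3⟩ := h1
    obtain ⟨a', ha', hpa⟩ := (h.sameName_iff (h.isWord.lt_size (by
      have := ha.add_length_le (encodeName_ne_nil _); omega)) hp').1 h2
    obtain rfl := ha.name_unique ha'
    exact ⟨[a], rfl, KB.path_singleton_iff.2 ⟨p, hp, h1, hpa, h3⟩⟩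
  | plus R₁ R₂ ih₁ ih₂ =>
    intro q r u v hR hr hq
    obtain ⟨ht, h2⟩ := at_cons.1 hR
    obtain ⟨h2, h3⟩ := at_append.1 h2
    obtain ⟨q', -, rfl, h1⟩ := hs q (hlt hR) u u.2 v v.2 r hr hq
    simp only [h.isWord.tok, ht, Option.some.injEq, reduceCtorEq, false_and, false_or, or_false,
      true_and] at h1
    obtain ⟨m, hm', r', hr', h4, h5 | h5⟩ := h1
    · obtain ⟨w, hw, hp⟩ := ih₁ h2 hr' h5
      exact ⟨w, .inl hw, hp⟩
    · obtain ⟨w, hw, hp⟩ := ih₂ (hm hm' h2 h4 h3) hr' h5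
      exact ⟨w, .inr hw, hp⟩
  | comp R₁ R₂ ih₁ ih₂ =>
    intro q r u v hR hr hq
    obtain ⟨ht, h2⟩ := at_cons.1 hR
    obtain ⟨h2, h3⟩ := at_append.1 h2
    obtain ⟨q', -, rfl, h1⟩ := hs q (hlt hR) u u.2 v v.2 r hr hq
    simp only [h.isWord.tok, ht, Option.some.injEq, reduceCtorEq, false_and, false_or, or_false,
      true_and] at h1
    obtain ⟨m, hm', c, hc, r', hr', r'', hr'', h4, h5, h6⟩ := h1
    obtain ⟨w₁, hw₁, hp₁⟩ := ih₁ (v := ⟨c, hc⟩) h2 hr' h5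
    obtain ⟨w₂, hw₂, hp₂⟩ := ih₂ (u := ⟨c, hc⟩) (hm hm' h2 h4 h3) hr'' h6
    exact ⟨w₁ ++ w₂, Language.append_mem_mul hw₁ hw₂, KB.path_append_iff.2 ⟨_, hp₁, hp₂⟩⟩
  | star R ih =>
    intro q r
    induction r using Nat.strong_induction_on with
    | _ r ihr =>
      intro u v hR hr hq
      obtain ⟨ht, h2⟩ := at_cons.1 hR
      obtain ⟨q', -, rfl, h1⟩ := hs q (hlt hR) u u.2 v v.2 r hr hq
      simp only [h.isWord.tok, ht, Option.some.injEq, reduceCtorEq, false_and, false_or,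
        true_and] at h1
      obtain h1 | ⟨c, hc, r', hr', r'', hr'', h1, h3, h4⟩ := h1
      · exact ⟨[], Language.nil_mem_kstar _, KB.path_nil_iff.2 (Fin.ext h1)⟩
      · obtain ⟨w₁, hw₁, hp₁⟩ := ih (v := ⟨c, hc⟩) h2 hr'' h3
        obtain ⟨w₂, hw₂, hp₂⟩ := ihr r' h1 (u := ⟨c, hc⟩) hR hr' h4
        exact ⟨w₁ ++ w₂, append_mem_matches_star hw₁ hw₂, KB.path_append_iff.2 ⟨_, hp₁, hp₂⟩⟩

/-- The regular expression at position `q` matches the label word of a path from `u` to `v` of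
length at most `r`. -/
def HasPath (K : KB S (Fin M.size)) (x : List Token) (q u v r : ℕ) : Prop :=
  ∃ (hu : u < M.size) (hv : v < M.size) (R : RegularExpression S), At x q (encodeRegex R) ∧
    ∃ w ∈ R.matches', w.length ≤ r ∧ K.Path ⟨u, hu⟩ w ⟨v, hv⟩

/-- Completeness: the table in which `r` bounds the length of the path obeys the conditions. At a
star a nonempty first factor is split off, so the bound decreases. -/
theorem matchesSpec_of_iff {b : Bool} (h : M.SyntaxCorrect x S)
    (hm : ∀ q < M.size, ∀ u < M.size, ∀ v < M.size, ∀ r < M.size,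
      (M.Matches b q u v r ↔ HasPath (M.kb x S) x q u v r)) : M.MatchesSpec b := by
  intro q hq u hu v hv r hr hM
  obtain ⟨_, _, R, hR, w, hw, hwr, hp⟩ := (hm q hq u hu v hv r hr).1 hM
  have hlen := hR.add_length_le (encodeRegex_ne_nil _)
  have hpos := List.length_pos_of_ne_nil (encodeRegex_ne_nil R)
  have hq' : q + 1 < M.size := h.isWord.lt_size (by omega)
  refine ⟨q + 1, hq', rfl, ?_⟩
  simp only [h.isWord.tok]
  cases R with
  | zero => simp [RegularExpression.matches'] at hw
  | epsilon =>
    have : w = [] := by simpa [RegularExpression.matches'] using hw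
    subst this
    exact .inl ⟨(at_cons.1 hR).1, by simpa [KB.path_nil_iff] using hp⟩
  | char a =>
    have : w = [a] := hw
    subst this
    obtain ⟨p, hp, h1, h2, h3⟩ := KB.path_singleton_iff.1 hp
    have := h2.add_length_le (encodeName_ne_nil _)
    refine .inr (.inl ⟨(at_cons.1 hR).1, p, hp, p + 1, h.isWord.lt_size (by omega), h1, rfl,
      (h.sameName_iff_of_at (at_cons.1 hR).2 h2).2 rfl, h3⟩)
  | plus R₁ R₂ =>
    obtain ⟨h1, h2⟩ := at_cons.1 hR
    obtain ⟨h2, h3⟩ := at_append.1 h2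
    simp only [encodeRegex, List.length_cons, List.length_append] at hlen
    have hm' : q + 1 + (encodeRegex R₁).length < M.size := h.isWord.lt_size (by omega)
    refine .inr (.inr (.inl ⟨h1, _, hm', r, hr, (h.regexAt_iff hq' hm').2 ⟨R₁, h2, rfl⟩, ?_⟩))
    rw [hm _ hq' u hu v hv r hr, hm _ hm' u hu v hv r hr]
    rcases hw with hw | hw
    · exact .inl ⟨hu, hv, R₁, h2, w, hw, hwr, hp⟩
    · exact .inr ⟨hu, hv, R₂, h3, w, hw, hwr, hp⟩
  | comp R₁ R₂ =>
    obtain ⟨h1, h2⟩ := at_cons.1 hR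
    obtain ⟨h2, h3⟩ := at_append.1 h2
    simp only [encodeRegex, List.length_cons, List.length_append] at hlen
    have hm' : q + 1 + (encodeRegex R₁).length < M.size := h.isWord.lt_size (by omega)
    obtain ⟨w₁, hw₁, w₂, hw₂, rfl⟩ := hw
    obtain ⟨c, hc₁, hc₂⟩ := KB.path_append_iff.1 hp
    simp only [List.length_append] at hwr
    refine .inr (.inr (.inr (.inl ⟨h1, _, hm', c, c.2, r, hr, r, hr,
      (h.regexAt_iff hq' hm').2 ⟨R₁, h2, rfl⟩, ?_, ?_⟩)))
    · exact (hm _ hq' u hu c c.2 r hr).2 ⟨hu, c.2, R₁, h2, w₁, hw₁, by omega, hc₁⟩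
    · exact (hm _ hm' c c.2 v hv r hr).2 ⟨c.2, hv, R₂, h3, w₂, hw₂, by omega, hc₂⟩
  | star R =>
    obtain ⟨h1, h2⟩ := at_cons.1 hR
    refine .inr (.inr (.inr (.inr ⟨h1, ?_⟩)))
    rcases matches_star_cases hw with rfl | ⟨w₁, w₂, hne, rfl, hw₁, hw₂⟩
    · exact .inl (by simpa [KB.path_nil_iff] using hp)
    · obtain ⟨c, hc₁, hc₂⟩ := KB.path_append_iff.1 hp
      have := List.length_pos_of_ne_nil hne
      simp only [List.length_append] at hwr
      refine .inr ⟨c, c.2, w₂.length, by omega, r, hr, by omega, ?_, ?_⟩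
      · exact (hm _ hq' u hu c c.2 r hr).2 ⟨hu, c.2, R, h2, w₁, hw₁, by omega, hc₁⟩
      · exact (hm _ hq c c.2 v hv _ (by omega)).2 ⟨c.2, hv, _, hR, w₂, hw₂, le_rfl, hc₂⟩

/-! ### Homomorphisms and answers -/

theorem Satisfies.exists_embedding {b : Bool} {s e : ℕ} {Q : CRPQ S} (h : M.SyntaxCorrect x S)
    (hQ : QueryAt x s e Q) (hs : M.Satisfies b s e) :
    ∃ μ : Name → Fin M.size, Q.IsEmbedding (M.kb x S) μ ∧
      (∀ {p u : ℕ} {a : Name}, At x p (encodeName a) → u < M.size → M.MapsTo b p u →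
        (μ a : ℕ) = u) ∧
      ∀ a ∈ Q.vars, ∀ {p : ℕ}, At x p (encodeName a) → M.MapsTo b p (μ a) := by
  classical
  obtain ⟨hm, hmap, hat⟩ := hs
  have hlt : ∀ {p a}, At x p (encodeName a) → p < M.size :=
    fun hR => h.isWord.lt_size (by have := hR.add_length_le (encodeName_ne_nil _); omega)
  -- Any recorded value of any occurrence is taken; `MapSpec` makes the choice irrelevant. The value
  -- `0` is only used for names without a recorded value.
  let μ : Name → Fin M.size := fun a =>
    if ha : ∃ u : Fin M.size, ∃ p, At x p (encodeName a) ∧ M.MapsTo b p u then ha.choose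
    else ⟨0, h.isWord.lt_size (by omega)⟩
  have hμ : ∀ {p u : ℕ} {a : Name}, At x p (encodeName a) → u < M.size → M.MapsTo b p u →
        (μ a : ℕ) = u := by
    intro p u a hp hu hpu
    have ha : ∃ u : Fin M.size, ∃ p, At x p (encodeName a) ∧ M.MapsTo b p u := ⟨⟨u, hu⟩, p, hp, hpu⟩
    obtain ⟨p', hp', hpu'⟩ := ha.choose_spec
    have : μ a = ha.choose := dif_pos ha
    rw [this]
    exact (hmap p' (hlt hp') p (hlt hp) _ ha.choose.2 u hu
      ((h.sameName_iff_of_at hp' hp).2 rfl) hpu').1 hpu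
  refine ⟨μ, fun A hA => ?_, hμ, fun a ha p hp => ?_⟩
  rotate_left
  · obtain ⟨q, hq, ⟨i, hi, i', hi', j, hj, k, hk, l, hl, hA, hqi⟩, haq⟩ := hQ.exists_varPos h ha
    obtain ⟨u, hu, v, hv, r, hr, hiu, hkv, -⟩ := hat i hi i' hi' j hj k hk l hl hA
    have hname := (h.sameName_iff_of_at haq hp).2 rfl
    rcases hqi with rfl | rfl
    · rw [hμ haq hu hiu]
      exact (hmap q hq p (hlt hp) u hu u hu hname hiu).2
    · rw [hμ haq hv hkv]
      exact (hmap q hq p (hlt hp) v hv v hv hname hkv).2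
  obtain ⟨i, hi, i', hi', j, hj, k, hk, l, hl, h1, h2, h3⟩ := hQ.exists_atomPositions h.isWord hA
  obtain ⟨u, hu, v, hv, r, hr, hiu, hkv, hmm⟩ := hat i hi i' hi' j hj k hk l hl
    ((hQ.atomIn_iff h hj hk).2 ⟨A, hA, h1, h2, h3⟩)
  obtain ⟨w, hw, hp⟩ := hm.exists_path h A.regex (u := ⟨u, hu⟩) (v := ⟨v, hv⟩) h3.regex hr hmm
  refine ⟨w, hw, ?_⟩
  rwa [show μ A.source = ⟨u, hu⟩ from Fin.ext (hμ h3.source hu hiu),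
    show μ A.target = ⟨v, hv⟩ from Fin.ext (hμ h3.target hv hkv)]

theorem satisfies_of_embedding {b : Bool} {s e : ℕ} {Q : CRPQ S} (h : M.SyntaxCorrect x S)
    (hQ : QueryAt x s e Q) {μ : Name → Fin M.size}
    (hm : ∀ q < M.size, ∀ u < M.size, ∀ v < M.size, ∀ r < M.size,
      (M.Matches b q u v r ↔ HasPath (M.kb x S) x q u v r))
    (hmap : ∀ p < M.size, ∀ u < M.size,
      (M.MapsTo b p u ↔ ∃ a, At x p (encodeName a) ∧ (μ a : ℕ) = u))
    (hemb : ∀ A ∈ Q.atoms, ∃ w ∈ A.regex.matches', w.length < M.size ∧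
      (M.kb x S).Path (μ A.source) w (μ A.target)) : M.Satisfies b s e := by
  refine ⟨matchesSpec_of_iff h hm, ?_, ?_⟩
  · intro p hp q hq u hu v hv hpq hpu
    obtain ⟨a, ha, rfl⟩ := (hmap p hp u hu).1 hpu
    constructor
    · intro hqv
      obtain ⟨a', ha', rfl⟩ := (hmap q hq v hv).1 hqv
      rw [(h.sameName_iff_of_at ha ha').1 hpq]
    · obtain ⟨a', ha', haq⟩ := (h.sameName_iff hp hq).1 hpq
      obtain rfl := ha.name_unique ha'
      exact (hmap q hq _ hu).2 ⟨a, haq, rfl⟩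
  · intro i hi i' hi' j hj k hk l hl hA
    obtain ⟨A, hA, -, -, h3⟩ := (hQ.atomIn_iff h hj hk).1 hA
    obtain ⟨w, hw, hwl, hp⟩ := hemb A hA
    exact ⟨μ A.source, Fin.is_lt _, μ A.target, Fin.is_lt _, w.length, hwl,
      (hmap _ hi' _ (Fin.is_lt _)).2 ⟨_, h3.source, rfl⟩,
      (hmap _ hk _ (Fin.is_lt _)).2 ⟨_, h3.target, rfl⟩,
      (hm _ hj _ (Fin.is_lt _) _ (Fin.is_lt _) _ hwl).2
        ⟨Fin.is_lt _, Fin.is_lt _, A.regex, h3.regex, w, hw, le_rfl, hp⟩⟩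

/-- The maximal list of distinguished variables that is written at position `i`. -/
def TupleAt (x : List Token) (i : ℕ) (d : List Name) : Prop :=
  At x i (d.flatMap fun a => Token.distinguished :: encodeName a) ∧
    x[i + (d.flatMap fun a => Token.distinguished :: encodeName a).length]? ≠ some .distinguished

theorem tupleAt_nil {i : ℕ} : TupleAt x i [] ↔ x[i]? ≠ some .distinguished := by
  simp [TupleAt, at_nil]

theorem tupleAt_cons {i : ℕ} {a : Name} {d : List Name} : TupleAt x i (a :: d) ↔
    x[i]? = some .distinguished ∧ At x (i + 1) (encodeName a) ∧
      TupleAt x (i + 1 + (encodeName a).length) d := by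
  unfold TupleAt
  rw [List.flatMap_cons, List.cons_append, at_cons, at_append, List.length_cons, List.length_append,
    and_assoc, and_assoc, show ∀ a b, i + (a + b + 1) = i + 1 + a + b by intros; omega]

/-- The list of distinguished variables is followed by an atom or by the end of the query. -/
theorem QueryAt.tupleAt {s e : ℕ} {Q : CRPQ S} (hQ : QueryAt x s e Q) :
    TupleAt x s Q.distinguished := by
  refine ⟨hQ.distinguished, ?_⟩
  have h := hQ.query
  rw [encodeQuery, List.append_assoc, at_append] at h
  cases hA : Q.atoms with
  | nil =>
    rw [hA] at h
    rw [(at_cons.1 h.2).1]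
    simp
  | cons A l =>
    rw [hA] at h
    rw [(at_cons.1 h.2).1]
    simp

theorem SameTupleSpec.map_eq (h : M.SyntaxCorrect x S) (hs : M.SameTupleSpec)
    {μ ν : Name → Fin M.size}
    (hμ : ∀ {p u : ℕ} {a : Name}, At x p (encodeName a) → u < M.size → M.MapsTo false p u →
      (μ a : ℕ) = u)
    (hν : ∀ {p u : ℕ} {a : Name}, At x p (encodeName a) → u < M.size → M.MapsTo true p u →
      (ν a : ℕ) = u) :
    ∀ (d : List Name) {i j : ℕ} {d' : List Name}, i < M.size → j < M.size → TupleAt x i d →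
      TupleAt x j d' → M.SameTuple i j → d.map μ = d'.map ν
  | [], i, j, [], _, _, _, _, _ => rfl
  | [], i, j, a' :: d', hi, hj, hd, hd', hij => by
    rw [tupleAt_nil] at hd
    rw [tupleAt_cons] at hd'
    have := hs i hi j hj hij
    simp [h.isWord.tok, hd, hd'.1] at this
  | a :: d, i, j, [], hi, hj, hd, hd', hij => by
    rw [tupleAt_nil] at hd'
    rw [tupleAt_cons] at hd
    have := hs i hi j hj hij
    simp [h.isWord.tok, hd', hd.1] at this
  | a :: d, i, j, a' :: d', hi, hj, hd, hd', hij => by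
    rw [tupleAt_cons] at hd hd'
    have := hs i hi j hj hij
    simp only [h.isWord.tok, hd.1, hd'.1, not_true_eq_false, false_and, false_or, true_and] at this
    obtain ⟨_, -, _, -, k, hk, l, hl, u, hu, rfl, rfl, h1, h2, h3, h4, h5⟩ := this
    obtain ⟨b, hb, rfl⟩ := h.isWord.nameAt_iff.1 h3
    obtain ⟨b', hb', rfl⟩ := h.isWord.nameAt_iff.1 h4
    obtain rfl := hd.2.1.name_unique hb
    obtain rfl := hd'.2.1.name_unique hb'
    rw [List.map_cons, List.map_cons, hs.map_eq h hμ hν d hk hl hd.2.2 hd'.2.2 h5,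
      Fin.ext ((hμ hb hu h1).trans (hν hb' hu h2).symm)]

/-- The set `D` restricts the first tuple to names on which `μ` is known to agree with the first
certificate. -/
theorem sameTupleSpec_of_iff (h : M.SyntaxCorrect x S) {μ ν : Name → Fin M.size} {D : Set Name}
    (hμ : ∀ p < M.size, ∀ a ∈ D, At x p (encodeName a) → M.MapsTo false p (μ a))
    (hν : ∀ p < M.size, ∀ a, At x p (encodeName a) → M.MapsTo true p (ν a))
    (ht : ∀ i < M.size, ∀ j < M.size, (M.SameTuple i j ↔
      ∃ d d', (∀ a ∈ d, a ∈ D) ∧ TupleAt x i d ∧ TupleAt x j d' ∧ d.map μ = d'.map ν)) :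
    M.SameTupleSpec := by
  intro i hi j hj hij
  simp only [h.isWord.tok]
  obtain ⟨d, d', hD, hd, hd', hdd⟩ := (ht i hi j hj).1 hij
  cases d with
  | nil =>
    cases d' with
    | nil => exact .inl ⟨tupleAt_nil.1 hd, tupleAt_nil.1 hd'⟩
    | cons a' d' => simp at hdd
  | cons a d =>
    cases d' with
    | nil => simp at hdd
    | cons a' d' =>
      rw [tupleAt_cons] at hd hd'
      simp only [List.map_cons, List.cons.injEq] at hdd
      have l1 := hd.2.1.add_length_le (encodeName_ne_nil _)
      have l2 := hd'.2.1.add_length_le (encodeName_ne_nil _)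
      have hk : i + 1 + (encodeName a).length < M.size := h.isWord.lt_size (by omega)
      have hl : j + 1 + (encodeName a').length < M.size := h.isWord.lt_size (by omega)
      have hi' : i + 1 < M.size := h.isWord.lt_size (by omega)
      have hj' : j + 1 < M.size := h.isWord.lt_size (by omega)
      exact .inr ⟨hd.1, hd'.1, _, hi', _, hj', _, hk, _, hl, μ a, Fin.is_lt _, rfl, rfl,
        hμ _ hi' a (hD a (by simp)) hd.2.1, hdd.1 ▸ hν _ hj' a' hd'.2.1, h.isWord.nameAt_iff.2 ⟨a, hd.2.1, rfl⟩,
        h.isWord.nameAt_iff.2 ⟨a', hd'.2.1, rfl⟩, (ht _ hk _ hl).2 ⟨d, d',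
          fun b hb => hD b (by simp [hb]), hd.2.2, hd'.2.2, hdd.2⟩⟩

/-! ### Components -/

theorem nameInSet_iff (h : M.SyntaxCorrect x S) {p : ℕ} {a : Name} (hp : At x p (encodeName a)) :
    M.NameInSet p ↔ ∃ q < M.size, At x q (encodeName a) ∧ M.InSet q := by
  have hlt := h.isWord.lt_size (i := p)
    (by have := hp.add_length_le (encodeName_ne_nil _); omega)
  refine exists_congr fun q => and_congr_right fun hq => and_congr_left fun _ => ?_
  rw [h.sameName_iff hlt hq]
  exact ⟨fun ⟨b, hb, hb'⟩ => hp.name_unique hb ▸ hb', fun hq => ⟨a, hp, hq⟩⟩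

/-- A closed set is closed under adjacency, hence it contains the distinguished variable reachable
from any of its variables. -/
theorem QueryAt.componentSpec {s e : ℕ} {Q : CRPQ S} (h : M.SyntaxCorrect x S)
    (hQ : QueryAt x s e Q) (hc : Q.ComponentsDistinguished) : M.ComponentSpec s e := by
  rintro hclosed ⟨p, hp, hv, hin⟩
  obtain ⟨a, ha, hap⟩ := hQ.exists_of_varPos h hv
  obtain ⟨b, hb, hab⟩ := hc a ha
  let C : Set Name := {a | ∃ q < M.size, At x q (encodeName a) ∧ M.InSet q}
  have hC : ∀ A ∈ Q.atoms, A.source ∈ C ↔ A.target ∈ C := by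
    intro A hA
    obtain ⟨i, hi, i', hi', j, hj, k, hk, l, hl, h1, h2, h3⟩ := hQ.exists_atomPositions h.isWord hA
    have := hclosed i hi i' hi' j hj k hk l hl ((hQ.atomIn_iff h hj hk).2 ⟨A, hA, h1, h2, h3⟩)
    rwa [nameInSet_iff h h3.source, nameInSet_iff h h3.target] at this
  have hadj : ∀ {a b}, Q.graph.Adj a b → a ∈ C → b ∈ C := by
    intro a b hab ha
    rw [CRPQ.graph, SimpleGraph.fromRel_adj] at hab
    obtain ⟨-, ⟨A, hA, rfl, rfl⟩ | ⟨A, hA, rfl, rfl⟩⟩ := hab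
    · exact (hC A hA).1 ha
    · exact (hC A hA).2 ha
  have hbC : b ∈ C := by
    obtain ⟨W⟩ := hab
    have haC : a ∈ C := (nameInSet_iff h hap).1 hin
    clear hap ha hb
    induction W with
    | nil => exact haC
    | cons hadj' _ ih => exact ih (hadj hadj' haC)
  obtain ⟨q, hq, hd, hbq⟩ := hQ.exists_distinguishedPos h hb
  exact ⟨q, hq, hd, (nameInSet_iff h hbq).2 hbC⟩

/-- The condition is tested with the component of `a`, which is a closed set. -/
theorem QueryAt.exists_distinguished_reachable {s e : ℕ} {Q : CRPQ S} (h : M.SyntaxCorrect x S)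
    (hQ : QueryAt x s e Q) (hc : M.ComponentSpec s e) {a : Name} (ha : a ∈ Q.vars)
    (hin : ∀ p < M.size, (M.InSet p ↔ ∃ b, At x p (encodeName b) ∧ Q.graph.Reachable a b)) :
    ∃ b ∈ Q.distinguished, Q.graph.Reachable a b := by
  have hlt : ∀ {p a}, At x p (encodeName a) → p < M.size :=
    fun hR => h.isWord.lt_size (by have := hR.add_length_le (encodeName_ne_nil _); omega)
  have hn : ∀ {p b}, At x p (encodeName b) → (M.NameInSet p ↔ Q.graph.Reachable a b) := by
    intro p b hb
    rw [nameInSet_iff h hb]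
    constructor
    · rintro ⟨q, hq, hbq, hqin⟩
      obtain ⟨b', hb', hr⟩ := (hin q hq).1 hqin
      rwa [hbq.name_unique hb']
    · exact fun hr => ⟨p, hlt hb, hb, (hin p (hlt hb)).2 ⟨b, hb, hr⟩⟩
  have hclosed : M.SetClosed s e := by
    intro i hi i' hi' j hj k hk l hl hA
    obtain ⟨A, hA, -, -, h3⟩ := (hQ.atomIn_iff h hj hk).1 hA
    rw [hn h3.source, hn h3.target]
    have : Q.graph.Reachable A.source A.target := by
      by_cases hst : A.source = A.target
      · rw [hst]
      · refine SimpleGraph.Adj.reachable ?_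
        rw [CRPQ.graph, SimpleGraph.fromRel_adj]
        exact ⟨hst, .inl ⟨A, hA, rfl, rfl⟩⟩
    exact ⟨fun h => h.trans this, fun h => h.trans this.symm⟩
  obtain ⟨p, hp, hv, hap⟩ := hQ.exists_varPos h ha
  obtain ⟨q, hq, hd, hin'⟩ := hc hclosed ⟨p, hp, hv, (hn hap).2 (.refl a)⟩
  obtain ⟨b, hb, hbq⟩ := hQ.exists_of_distinguishedPos h hd
  exact ⟨b, hb, (hn hbq).1 hin'⟩

end Model

end CRPQContainment

namespace CRPQContainment

/-! ### Pumping for regular expressions -/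

/-- A regular expression has few ways of splitting its words into two parts. -/
theorem exists_splits {S : Set Name} (R : RegularExpression S) :
    ∃ l : List (Language S × Language S), l.length ≤ (encodeRegex R).length ∧
      (∀ t ∈ l, t.1 * t.2 ≤ R.matches') ∧
      ∀ u v, u ++ v ∈ R.matches' → ∃ t ∈ l, u ∈ t.1 ∧ v ∈ t.2 := by
  induction R with
  | zero => exact ⟨[], by simp, by simp, fun u v h => h.elim⟩
  | epsilon =>
    refine ⟨[(1, 1)], by simp [encodeRegex], ?_, fun u v h => ?_⟩
    · intro t ht
      obtain rfl := List.mem_singleton.1 ht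
      rw [mul_one]
      exact le_rfl
    · obtain ⟨rfl, rfl⟩ : u = [] ∧ v = [] := by
        have h : u ++ v = [] := h
        simpa using h
      exact ⟨_, List.mem_singleton_self _, rfl, rfl⟩
  | char a =>
    refine ⟨[(1, {[a]}), ({[a]}, 1)], by simp [encodeRegex, length_encodeName], ?_,
      fun u v h => ?_⟩
    · intro t ht
      simp only [List.mem_cons, List.not_mem_nil, or_false] at ht
      rcases ht with rfl | rfl
      · rw [one_mul]; exact le_rfl
      · rw [mul_one]; exact le_rfl
    · have h : u ++ v = [a] := h
      rcases List.append_eq_singleton_iff.1 h with ⟨rfl, rfl⟩ | ⟨rfl, rfl⟩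
      · exact ⟨(1, {[a]}), by simp, rfl, rfl⟩
      · exact ⟨({[a]}, 1), by simp, rfl, rfl⟩
  | plus R₁ R₂ ih₁ ih₂ =>
    obtain ⟨l₁, h₁, h₂, h₃⟩ := ih₁
    obtain ⟨l₂, h₄, h₅, h₆⟩ := ih₂
    refine ⟨l₁ ++ l₂, by simp [encodeRegex]; omega, ?_, fun u v h => ?_⟩
    · intro t ht
      rcases List.mem_append.1 ht with ht | ht
      · exact (h₂ t ht).trans fun w hw => .inl hw
      · exact (h₅ t ht).trans fun w hw => .inr hw
    · rcases h with h | h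
      · obtain ⟨t, ht, h'⟩ := h₃ u v h
        exact ⟨t, by simp [ht], h'⟩
      · obtain ⟨t, ht, h'⟩ := h₆ u v h
        exact ⟨t, by simp [ht], h'⟩
  | comp R₁ R₂ ih₁ ih₂ =>
    obtain ⟨l₁, h₁, h₂, h₃⟩ := ih₁
    obtain ⟨l₂, h₄, h₅, h₆⟩ := ih₂
    refine ⟨l₁.map (fun t => (t.1, t.2 * R₂.matches')) ++
      l₂.map (fun t => (R₁.matches' * t.1, t.2)), by simp [encodeRegex]; omega, ?_,
      fun u v h => ?_⟩
    · intro t ht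
      rcases List.mem_append.1 ht with ht | ht
      · obtain ⟨t, ht', rfl⟩ := List.mem_map.1 ht
        rw [← mul_assoc]
        exact mul_le_mul_left (h₂ t ht') _
      · obtain ⟨t, ht', rfl⟩ := List.mem_map.1 ht
        rw [mul_assoc]
        exact mul_le_mul_right (h₅ t ht') _
    · obtain ⟨w₁, hw₁, w₂, hw₂, h⟩ := h
      rcases List.append_eq_append_iff.1 h with ⟨c, rfl, rfl⟩ | ⟨c, rfl, rfl⟩
      · obtain ⟨t, ht, h7, h8⟩ := h₆ _ _ hw₂
        exact ⟨_, List.mem_append_right _ (List.mem_map.2 ⟨t, ht, rfl⟩),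
          Language.append_mem_mul hw₁ h7, h8⟩
      · obtain ⟨t, ht, h7, h8⟩ := h₃ _ _ hw₁
        exact ⟨_, List.mem_append_left _ (List.mem_map.2 ⟨t, ht, rfl⟩), h7,
          Language.append_mem_mul h8 hw₂⟩
  | star R ih =>
    obtain ⟨l, h₁, h₂, h₃⟩ := ih
    -- The pair `(1, 1)` serves the empty word, and the star token accounts for it in the bound.
    refine ⟨(1, 1) :: l.map (fun t => ((RegularExpression.star R).matches' * t.1,
      t.2 * (RegularExpression.star R).matches')), by simp [encodeRegex]; omega, ?_, ?_⟩
    · intro t ht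
      rcases List.mem_cons.1 ht with rfl | ht
      · rw [one_mul]
        rintro w rfl
        exact Language.nil_mem_kstar _
      · obtain ⟨t, ht', rfl⟩ := List.mem_map.1 ht
        rintro w ⟨w₁, ⟨u₁, hu₁, u₂, hu₂, rfl⟩, w₂, ⟨v₁, hv₁, v₂, hv₂, rfl⟩, rfl⟩
        have h4 := append_mem_matches_star (h₂ t ht' (Language.append_mem_mul hu₂ hv₁)) hv₂
        rw [RegularExpression.matches'_star] at hu₁ h4 ⊢
        have h5 := Language.append_mem_mul hu₁ h4
        rw [kstar_mul_kstar] at h5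
        have e : (u₁ ++ u₂) ++ (v₁ ++ v₂) = u₁ ++ (u₂ ++ v₁ ++ v₂) := by simp
        change (u₁ ++ u₂) ++ (v₁ ++ v₂) ∈ KStar.kstar R.matches'
        rwa [e]
    · intro u
      induction hn : u.length using Nat.strong_induction_on generalizing u with
      | _ n ihn =>
        intro v h
        rcases matches_star_cases h with h | ⟨w₁, w₂, hne, h, hw₁, hw₂⟩
        · obtain ⟨rfl, rfl⟩ : u = [] ∧ v = [] := by simpa using h
          exact ⟨(1, 1), by simp, rfl, rfl⟩
        · have hpos := List.length_pos_of_ne_nil hne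
          rcases List.append_eq_append_iff.1 h with ⟨c, rfl, rfl⟩ | ⟨c, rfl, rfl⟩
          · obtain ⟨t, ht, h7, h8⟩ := h₃ _ _ hw₁
            refine ⟨_, List.mem_cons_of_mem _ (List.mem_map.2 ⟨t, ht, rfl⟩), ?_,
              Language.append_mem_mul h8 hw₂⟩
            exact ⟨[], Language.nil_mem_kstar _, u, h7, rfl⟩
          · obtain ⟨t, ht, h7, h8⟩ := ihn c.length (by simp at hn; omega) c rfl v hw₂
            rcases List.mem_cons.1 ht with rfl | ht
            -- Here the cut is at the very end of `w₁`, so it is a split of `w₁` itself.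
            · obtain ⟨t', ht', h9, h10⟩ := h₃ w₁ [] (by simpa using hw₁)
              have h7 : c = [] := h7
              have h8 : v = [] := h8
              subst h7 h8
              refine ⟨_, List.mem_cons_of_mem _ (List.mem_map.2 ⟨t', ht', rfl⟩), ?_, ?_⟩
              · exact ⟨[], Language.nil_mem_kstar _, w₁, h9, by simp⟩
              · exact ⟨[], h10, [], Language.nil_mem_kstar _, rfl⟩
            · obtain ⟨t, ht', rfl⟩ := List.mem_map.1 ht
              obtain ⟨c₁, hc₁, c₂, hc₂, rfl⟩ := h7
              refine ⟨_, List.mem_cons_of_mem _ (List.mem_map.2 ⟨t, ht', rfl⟩),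
                ⟨w₁ ++ c₁, append_mem_matches_star hw₁ hc₁, c₂, hc₂, by simp⟩, h8⟩

/-- Pigeonhole: two of the `s + 1` cuts at `i, …, i + s` belong to the same pair of languages from
`exists_splits`, so the left part of one cut may be joined with the right part of the other. -/
theorem exists_pump {S : Set Name} {R : RegularExpression S} {w : List S} (hw : w ∈ R.matches')
    {i s : ℕ} (hs : (encodeRegex R).length ≤ s) :
    ∃ p q, i ≤ p ∧ p < q ∧ q ≤ i + s ∧ w.take p ++ w.drop q ∈ R.matches' := by
  obtain ⟨l, h₁, h₂, h₃⟩ := exists_splits R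
  have h : ∀ n : Fin (s + 1), ∃ m : Fin l.length, w.take (i + n) ∈ (l.get m).1 ∧
      w.drop (i + n) ∈ (l.get m).2 := by
    intro n
    obtain ⟨t, ht, h⟩ := h₃ (w.take (i + n)) (w.drop (i + n)) (by simpa using hw)
    obtain ⟨m, rfl⟩ := List.get_of_mem ht
    exact ⟨m, h⟩
  choose f hf using h
  obtain ⟨a, b, hab, hfab⟩ := Fintype.exists_ne_map_eq_of_card_lt f (by simp; omega)
  wlog hlt : a < b generalizing a b
  · exact this b a hab.symm hfab.symm (lt_of_le_of_ne (not_lt.1 hlt) hab.symm)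
  refine ⟨i + a, i + b, by omega, by simpa using hlt, by omega, ?_⟩
  exact h₂ _ (List.get_mem l (f a)) (Language.append_mem_mul (hf a).1 (hfab ▸ (hf b).2))

/-- This is why a certificate can name the labels of a counterexample by positions in the word. -/
theorem symbol_infix_encodeRegex {S : Set Name} {R : RegularExpression S} : ∀ {w : List S},
    w ∈ R.matches' → ∀ {a : S}, a ∈ w → Token.symbol :: encodeName a <:+: encodeRegex R := by
  induction R with
  | zero => exact fun h => h.elim
  | epsilon =>
    intro w hw a ha
    have hw : w = [] := hw
    simp [hw] at ha
  | char b =>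
    intro w hw a ha
    have hw : w = [b] := hw
    obtain rfl : a = b := by simpa [hw] using ha
    exact List.infix_refl _
  | plus R₁ R₂ ih₁ ih₂ =>
    intro w hw a ha
    rcases hw with hw | hw
    · exact (ih₁ hw ha).trans ⟨[.plus], encodeRegex R₂, by simp [encodeRegex]⟩
    · exact (ih₂ hw ha).trans ⟨.plus :: encodeRegex R₁, [], by simp [encodeRegex]⟩
  | comp R₁ R₂ ih₁ ih₂ =>
    rintro _ ⟨w₁, hw₁, w₂, hw₂, rfl⟩ a ha
    rcases List.mem_append.1 ha with ha | ha
    · exact (ih₁ hw₁ ha).trans ⟨[.comp], encodeRegex R₂, by simp [encodeRegex]⟩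
    · exact (ih₂ hw₂ ha).trans ⟨.comp :: encodeRegex R₁, [], by simp [encodeRegex]⟩
  | star R ih =>
    intro w hw a ha
    rw [RegularExpression.matches'_star] at hw
    obtain ⟨l, rfl, hl⟩ := Language.mem_kstar.1 hw
    obtain ⟨w, hw, ha⟩ := List.mem_flatten.1 ha
    exact (ih (hl w hw) ha).trans ⟨[.star], [], by simp [encodeRegex]⟩

/-! ### Disjunctions and closures of symbols -/

/-- Disjunctions of symbols and Kleene closures of symbols. -/
def classDisjunctionStar (L : Type) : Set (RegularExpression L) :=
  {R | IsDisjunction R ∨ ∃ a : L, R = .star (.char a)}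

theorem mem_matches_isDisjunction {L : Type} {R : RegularExpression L} (h : IsDisjunction R)
    {w : List L} (hw : w ∈ R.matches') : ∃ a, w = [a] := by
  induction h with
  | symbol a => exact ⟨a, hw⟩
  | plus _ _ ih ih' => exact hw.elim ih ih'

theorem mem_matches_star_char {L : Type} {a : L} {w : List L} :
    w ∈ (RegularExpression.star (.char a)).matches' ↔ ∀ c ∈ w, c = a := by
  rw [RegularExpression.matches'_star, RegularExpression.matches'_char]
  constructor
  · intro hw c hc
    obtain ⟨l, rfl, hl⟩ := Language.mem_kstar.1 hw
    obtain ⟨v, hv, hc⟩ := List.mem_flatten.1 hc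
    have : v = [a] := hl v hv
    simpa [this] using hc
  · intro hw
    refine Language.mem_kstar.2 ⟨w.map fun c => [c], ?_, ?_⟩
    · induction w with
      | nil => rfl
      | cons c w ih =>
        rw [List.map_cons, List.flatten_cons, ← ih fun c hc => hw c (by simp [hc])]
        rfl
    · intro v hv
      obtain ⟨c, hc, rfl⟩ := List.mem_map.1 hv
      rw [hw c hc]
      rfl

/-- The property of both fragments on which the argument with levels rests. -/
theorem exists_forall_eq_of_mem {L : Type} {R : RegularExpression L}
    (hR : R ∈ classDisjunctionStar L) {w : List L} (hw : w ∈ R.matches') :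
    ∃ a, ∀ c ∈ w, c = a := by
  rcases hR with hR | ⟨a, rfl⟩
  · obtain ⟨a, rfl⟩ := mem_matches_isDisjunction hR hw
    exact ⟨a, by simp⟩
  · exact ⟨a, mem_matches_star_char.1 hw⟩

/-- The table of matches only has room for bounds below `N`. Cycles can be cut out of a path for
`a*`, as any power of `a` is allowed; a disjunction reads a single letter. -/
theorem exists_short_path {L : Type} {N : ℕ} (hN : 2 ≤ N) {K : KB L (Fin N)}
    {R : RegularExpression L} (hR : R ∈ classDisjunctionStar L) {w : List L} (hw : w ∈ R.matches')
    {u v : Fin N} (hp : K.Path u w v) : ∃ w ∈ R.matches', w.length < N ∧ K.Path u w v := by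
  rcases hR with hR | ⟨a, rfl⟩
  · obtain ⟨a, rfl⟩ := mem_matches_isDisjunction hR hw
    exact ⟨[a], hw, by simp; omega, hp⟩
  · induction hn : w.length using Nat.strong_induction_on generalizing w with
    | _ n ih =>
      by_cases hlt : w.length < N
      · exact ⟨w, hw, hlt, hp⟩
      have h : ∀ i : Fin (w.length + 1), ∃ m, K.Path u (w.take i) m ∧ K.Path m (w.drop i) v :=
        fun i => KB.path_append_iff.1 (by simpa using hp)
      choose f hf using h
      obtain ⟨i, j, hij, hfij⟩ := Fintype.exists_ne_map_eq_of_card_lt f (by simp; omega)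
      wlog hlt' : i < j generalizing i j
      · exact this j i hij.symm hfij.symm (lt_of_le_of_ne (not_lt.1 hlt') hij.symm)
      have hlt' : (i : ℕ) < j := hlt'
      refine ih (w.take i ++ w.drop j).length ?_ (w := w.take i ++ w.drop j)
        (KB.path_append_iff.2 ⟨_, (hf i).1, hfij ▸ (hf j).2⟩) ?_ rfl
      · rw [List.length_append, List.length_take, List.length_drop]
        omega
      · rw [mem_matches_star_char] at hw ⊢
        intro c hc
        rcases List.mem_append.1 hc with hc | hc
        · exact hw c (List.mem_of_mem_take hc)
        · exact hw c (List.mem_of_mem_drop hc)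

end CRPQContainment

namespace CRPQContainment

open Function (update)

/-! ### Graphs that consist of labelled paths -/

theorem KB.Path.map {L V V' : Type} {K : KB L V} {K' : KB L V'} {f : V → V'}
    (hf : ∀ u a v, (u, a, v) ∈ K.edges → (f u, a, f v) ∈ K'.edges) {u v : V} {w : List L}
    (h : K.Path u w v) : K'.Path (f u) w (f v) := by
  induction h with
  | nil v => exact .nil _
  | cons h _ ih => exact .cons (hf _ _ _ h) ih

section PathGraph

variable {L V ι : Type} {α β : ι → V} {ws : ι → List L}

/-- The `j`th node on the path from `α i` to `β i` that is labelled with the word `ws i`. -/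
def pathNode (α β : ι → V) (ws : ι → List L) (i : ι) (j : ℕ) : V ⊕ ι × ℕ :=
  if j = 0 then .inl (α i) else if j < (ws i).length then .inr (i, j) else .inl (β i)

/-- The graph that consists of paths from `α i` to `β i` labelled with the words `ws i`. -/
def pathGraph [Finite ι] (α β : ι → V) (ws : ι → List L) : KB L (V ⊕ ι × ℕ) where
  edges := {t | ∃ i j, (ws i)[j]? = some t.2.1 ∧ t.1 = pathNode α β ws i j ∧
    t.2.2 = pathNode α β ws i (j + 1)}
  finite_edges := by
    refine (Set.finite_iUnion fun i => Set.finite_range fun j : Fin (ws i).length =>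
      (pathNode α β ws i j, (ws i)[j], pathNode α β ws i (j + 1))).subset ?_
    rintro ⟨u, a, v⟩ ⟨i, j, h1, rfl, rfl⟩
    obtain ⟨hj, rfl⟩ := List.getElem?_eq_some_iff.1 h1
    exact Set.mem_iUnion.2 ⟨i, ⟨j, hj⟩, rfl⟩

theorem pathNode_length {i : ι} (h : ws i = [] → α i = β i) :
    pathNode α β ws i (ws i).length = .inl (β i) := by
  unfold pathNode
  split_ifs with h1 h2
  · rw [h (List.length_eq_zero_iff.1 h1)]
  · omega
  · rfl

theorem pathNode_injOn (i : ι) {j j' : ℕ} (hj : j < (ws i).length) (hj' : j' < (ws i).length)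
    (h : pathNode α β ws i j = pathNode α β ws i j') : j = j' := by
  unfold pathNode at h
  split_ifs at h <;> simp_all

theorem pathGraph_path [Finite ι] (i : ι) : ∀ (l : List L) (j : ℕ),
    (∀ m < l.length, (ws i)[j + m]? = l[m]?) →
    (pathGraph α β ws).Path (pathNode α β ws i j) l (pathNode α β ws i (j + l.length))
  | [], j, _ => .nil _
  | a :: l, j, h => by
    refine .cons (v := pathNode α β ws i (j + 1)) ⟨i, j, by simpa using h 0 (by simp), rfl, rfl⟩ ?_
    have := pathGraph_path i l (j + 1) fun m hm => by
      simpa [show j + (m + 1) = j + 1 + m by omega] using h (m + 1) (by simpa using hm)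
    rwa [List.length_cons, show j + (l.length + 1) = j + 1 + l.length by omega]

theorem pathGraph_path_word [Finite ι] {i : ι} (h : ws i = [] → α i = β i) :
    (pathGraph α β ws).Path (.inl (α i)) (ws i) (.inl (β i)) := by
  have := pathGraph_path (α := α) (β := β) (ws := ws) i (ws i) 0 (by simp)
  rwa [zero_add, pathNode_length h] at this

theorem KB.Path.exists_nodes {K : KB L V} {u v : V} {w : List L} (h : K.Path u w v) :
    ∃ g : ℕ → V, g 0 = u ∧ g w.length = v ∧
      ∀ j a, w[j]? = some a → (g j, a, g (j + 1)) ∈ K.edges := by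
  induction h with
  | nil v => exact ⟨fun _ => v, rfl, rfl, by simp⟩
  | @cons u v v' a w h _ ih =>
    obtain ⟨g, h1, h2, h3⟩ := ih
    refine ⟨fun n => n.casesOn u g, rfl, h2, fun j b hb => ?_⟩
    cases j with
    | zero =>
      obtain rfl : a = b := by simpa using hb
      simpa [h1] using h
    | succ j => exact h3 j b (by simpa using hb)

/-- The graph is mapped to every knowledge base that has the paths. -/
theorem pathGraph_exists_map [Finite ι] {K : KB L V} (h : ∀ i, K.Path (α i) (ws i) (β i)) :
    ∃ f : V ⊕ ι × ℕ → V, (∀ v, f (.inl v) = v) ∧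
      ∀ u a v, (u, a, v) ∈ (pathGraph α β ws).edges → (f u, a, f v) ∈ K.edges := by
  choose g hg1 hg2 hg3 using fun i => (h i).exists_nodes
  let f : V ⊕ ι × ℕ → V := Sum.elim id fun t => g t.1 t.2
  have hf : ∀ i j, j ≤ (ws i).length → f (pathNode α β ws i j) = g i j := by
    intro i j hj
    unfold pathNode
    split_ifs with h1 h2
    · rw [h1, hg1]; rfl
    · rfl
    · rw [show j = (ws i).length by omega, hg2]; rfl
  refine ⟨f, fun v => rfl, ?_⟩
  rintro u a v ⟨i, j, h1, rfl, rfl⟩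
  have hj := (List.getElem?_eq_some_iff.1 h1).1
  rw [hf i j hj.le, hf i (j + 1) hj]
  exact hg3 i j a h1

/-! ### Lengthening a path -/

variable [DecidableEq ι]

/-- Moves the nodes of the path `k` after position `p` by `r` positions. -/
def shiftNode (k : ι) (p r : ℕ) : V ⊕ ι × ℕ → V ⊕ ι × ℕ
  | .inl v => .inl v
  | .inr (i, j) => if i = k ∧ p < j then .inr (i, j + r) else .inr (i, j)

theorem shiftNode_pathNode_of_ne {k i : ι} (hi : i ≠ k) {w : List L} (p r j : ℕ) :
    shiftNode k p r (pathNode α β (update ws k w) i j) = pathNode α β ws i j := by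
  unfold pathNode
  rw [Function.update_of_ne hi]
  split_ifs <;> simp [shiftNode, hi]

theorem shiftNode_pathNode {k : ι} {w : List L} {p r : ℕ} (hw : (ws k).length = w.length + r)
    (hp : p < w.length) (j : ℕ) :
    shiftNode k p r (pathNode α β (update ws k w) k j) =
      pathNode α β ws k (if p < j then j + r else j) := by
  unfold pathNode
  rw [Function.update_self]
  by_cases hj : p < j
  · rw [if_pos hj, if_neg (show ¬ j = 0 by omega), if_neg (show ¬ j + r = 0 by omega)]
    by_cases hjw : j < w.length
    · rw [if_pos hjw, if_pos (show j + r < (ws k).length by omega)]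
      simp [shiftNode, hj]
    · rw [if_neg hjw, if_neg (show ¬ j + r < (ws k).length by omega)]
      rfl
  · rw [if_neg hj]
    by_cases h0 : j = 0
    · simp [h0, shiftNode]
    · rw [if_neg h0, if_neg h0, if_pos (by omega), if_pos (by omega)]
      simp [shiftNode, hj]

/-- All edges except one on the path `k` are preserved when nodes are moved. -/
theorem shiftNode_edge [Finite ι] {k : ι} {w : List L} {p r : ℕ} (hw : (ws k).length = w.length + r)
    (hp : p < w.length) (h1 : ∀ j < p, w[j]? = (ws k)[j]?)
    (h2 : ∀ j, p < j → w[j]? = (ws k)[j + r]?) {u v : V ⊕ ι × ℕ} {a : L}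
    (h : (u, a, v) ∈ (pathGraph α β (update ws k w)).edges) :
    (shiftNode k p r u, a, shiftNode k p r v) ∈ (pathGraph α β ws).edges ∨
      (w[p]? = some a ∧ u = pathNode α β (update ws k w) k p ∧
        v = pathNode α β (update ws k w) k (p + 1)) := by
  obtain ⟨i, j, h3, rfl, rfl⟩ := h
  by_cases hi : i = k
  · subst hi
    rw [Function.update_self] at h3
    rcases lt_trichotomy j p with hj | rfl | hj
    · left
      refine ⟨i, j, by rw [← h1 j hj]; exact h3, ?_, ?_⟩
      · exact (shiftNode_pathNode hw hp j).trans (by rw [if_neg (by omega)])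
      · exact (shiftNode_pathNode hw hp (j + 1)).trans (by rw [if_neg (by omega)])
    · exact .inr ⟨h3, rfl, rfl⟩
    · left
      refine ⟨i, j + r, by rw [← h2 j hj]; exact h3, ?_, ?_⟩
      · exact (shiftNode_pathNode hw hp j).trans (by rw [if_pos hj])
      · exact (shiftNode_pathNode hw hp (j + 1)).trans
          (by rw [if_pos (by omega), show j + 1 + r = j + r + 1 by omega])
  · left
    rw [Function.update_of_ne hi] at h3
    exact ⟨i, j, h3, shiftNode_pathNode_of_ne hi _ _ _, shiftNode_pathNode_of_ne hi _ _ _⟩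

/-- Paths with a constant label are preserved when a run of one letter is lengthened. -/
theorem exists_path_shiftNode [Finite ι] {k : ι} {w : List L} {p r : ℕ} (hw : (ws k).length = w.length + r)
    (hp : p < w.length) (h1 : ∀ j < p, w[j]? = (ws k)[j]?)
    (h2 : ∀ j, p < j → w[j]? = (ws k)[j + r]?)
    (h3 : ∀ j, p ≤ j → j ≤ p + r → (ws k)[j]? = w[p]?) {u v : V ⊕ ι × ℕ} {a : L} {l : List L}
    (hl : ∀ c ∈ l, c = a) (h : (pathGraph α β (update ws k w)).Path u l v) :
    ∃ l', (∀ c ∈ l', c = a) ∧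
      (pathGraph α β ws).Path (shiftNode k p r u) l' (shiftNode k p r v) := by
  induction h with
  | nil v => exact ⟨[], by simp, .nil _⟩
  | @cons u v v' b l h _ ih =>
    obtain ⟨l', hl', hp'⟩ := ih fun c hc => hl c (by simp [hc])
    obtain rfl : b = a := hl b (by simp)
    rcases shiftNode_edge hw hp h1 h2 h with h | ⟨h4, rfl, rfl⟩
    · exact ⟨b :: l', by simpa using hl', .cons h hp'⟩
    -- The edge at `p` is replaced by the `r + 1` edges of the lengthened run, all with the same
    -- letter.
    · refine ⟨List.replicate (r + 1) b ++ l', ?_, KB.path_append_iff.2 ⟨_, ?_, hp'⟩⟩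
      · intro c hc
        rcases List.mem_append.1 hc with hc | hc
        · exact List.eq_of_mem_replicate hc
        · exact hl' c hc
      · rw [shiftNode_pathNode hw hp, shiftNode_pathNode hw hp, if_neg (by omega),
          if_pos (by omega)]
        have := pathGraph_path (α := α) (β := β) (ws := ws) k (List.replicate (r + 1) b) p ?_
        · rwa [List.length_replicate, show p + (r + 1) = p + 1 + r by omega] at this
        · intro m hm
          rw [List.length_replicate] at hm
          rw [h3 _ (by omega) (by omega), h4, List.getElem?_replicate_of_lt hm]

/-! ### The distance to the end of a path, measured in changes of letters -/

variable [DecidableEq L]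

/-- The number of changes of letters in a word that is read after an optional first letter. -/
def changes : Option L → List L → ℕ
  | _, [] => 0
  | none, c :: w => changes (some c) w
  | some b, c :: w => (if b = c then 0 else 1) + changes (some c) w

theorem changes_none_le (b : Option L) (w : List L) : changes none w ≤ changes b w := by
  cases w <;> cases b <;> simp [changes]

theorem changes_le (b : Option L) (w : List L) : changes b w ≤ changes none w + 1 := by
  cases w with
  | nil => cases b <;> simp [changes]
  | cons c w =>
    cases b
    · simp
    · simp only [changes]; split_ifs <;> omega

/-- The current run of `n` letters `a` is carried along in front of `w`. All runs are shorter than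
`k`, and there is one more run than there are changes. -/
theorem length_le_changes {k : ℕ} : ∀ (w : List L) (a : L) (n : ℕ),
    (∀ b, ¬ List.replicate k b <:+: List.replicate n a ++ w) →
    n + w.length ≤ k * (changes (some a) w + 1)
  | [], a, n, h => by
    have : n < k := by
      by_contra hn
      refine h a ⟨[], List.replicate (n - k) a, ?_⟩
      rw [List.nil_append, List.append_nil, ← List.replicate_add]
      congr 1
      omega
    simp [changes]
    omega
  | c :: w, a, n, h => by
    by_cases hac : a = c
    · subst hac
      have := length_le_changes (k := k) w a (n + 1) fun b hb => h b (by
        rwa [List.replicate_succ' (n := n) (a := a), List.append_assoc] at hb)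
      simp only [changes, if_true, List.length_cons, zero_add] at this ⊢
      omega
    · have h1 : n < k := by
        by_contra hn
        refine h a ⟨[], List.replicate (n - k) a ++ c :: w, ?_⟩
        rw [List.nil_append, ← List.append_assoc, ← List.replicate_add]
        congr 2
        omega
      have h2 := length_le_changes w c 1 fun b hb => h b
        (hb.trans ⟨List.replicate n a, [], by simp⟩)
      simp only [changes, if_neg hac, List.length_cons]
      rw [show k * (1 + changes (some c) w + 1) = k + k * (changes (some c) w + 1) by ring]
      omega

/-- A long word without long runs of a letter has many changes of letters. -/
theorem length_le_changes_none {k : ℕ} (w : List L) (h : ∀ b, ¬ List.replicate k b <:+: w) :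
    w.length ≤ k * (changes none w + 1) := by
  cases w with
  | nil => simp
  | cons c w => simpa [changes, add_comm] using length_le_changes w c 1 (by simpa using h)

/-- The number of changes of letters on the way from a node on the path `k` to an end of the
path, after an optional first letter. -/
def level (k : ι) (w : List L) (b : Option L) : V ⊕ ι × ℕ → ℕ
  | .inl _ => 0
  | .inr (i, j) =>
    if i = k then min (changes b (w.drop j)) (changes b (w.take j).reverse) else 0

theorem level_none_le (k : ι) (w : List L) (b : Option L) (u : V ⊕ ι × ℕ) :
    level k w none u ≤ level k w b u := by
  rcases u with _ | ⟨i, j⟩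
  · exact le_rfl
  · simp only [level]
    split_ifs
    · exact min_le_min (changes_none_le _ _) (changes_none_le _ _)
    · exact le_rfl

theorem level_le (k : ι) (w : List L) (b : Option L) (u : V ⊕ ι × ℕ) :
    level k w b u ≤ level k w none u + 1 := by
  rcases u with _ | ⟨i, j⟩
  · simp [level]
  · simp only [level]
    split_ifs
    · rw [← min_add_add_right]
      exact min_le_min (changes_le _ _) (changes_le _ _)
    · omega

theorem level_pathNode (k : ι) (b : Option L) (j : ℕ) :
    level k (ws k) b (pathNode α β ws k j) =
      min (changes b ((ws k).drop j)) (changes b ((ws k).take j).reverse) := by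
  unfold pathNode
  split_ifs with h1 h2
  · subst h1
    cases b <;> simp [level, changes]
  · simp [level]
  · rw [List.drop_eq_nil_of_le (by omega)]
    cases b <;> simp [level, changes]

theorem level_pathNode_of_ne {k i : ι} (hi : i ≠ k) (w : List L) (b : Option L) (j : ℕ) :
    level k w b (pathNode α β ws i j) = 0 := by
  unfold pathNode
  split_ifs <;> simp [level, hi]

/-- Crossing an edge labelled `a` adds or removes a letter `a` directly after the first letter `a`,
which causes no change of letters in either direction. -/
theorem level_edge [Finite ι] (k : ι) {u v : V ⊕ ι × ℕ} {a : L} (h : (u, a, v) ∈ (pathGraph α β ws).edges) :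
    level k (ws k) (some a) u = level k (ws k) (some a) v := by
  obtain ⟨i, j, h1, rfl, rfl⟩ := h
  by_cases hi : i = k
  · subst hi
    obtain ⟨hj, rfl⟩ := List.getElem?_eq_some_iff.1 h1
    rw [level_pathNode, level_pathNode, List.drop_eq_getElem_cons hj,
      List.take_succ_eq_append_getElem hj, List.reverse_append]
    simp [changes]
  · rw [level_pathNode_of_ne hi, level_pathNode_of_ne hi]

theorem level_path [Finite ι] (k : ι) {u v : V ⊕ ι × ℕ} {a : L} {l : List L} (hl : ∀ c ∈ l, c = a)
    (h : (pathGraph α β ws).Path u l v) :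
    level k (ws k) (some a) u = level k (ws k) (some a) v := by
  induction h with
  | nil v => rfl
  | @cons u v v' b l h _ ih =>
    obtain rfl : b = a := hl b (by simp)
    rw [level_edge k h, ih fun c hc => hl c (by simp [hc])]

/-- With first letter `a` the level is constant along the path, and dropping the first letter costs
at most one change. -/
theorem level_path_le [Finite ι] (k : ι) {u v : V ⊕ ι × ℕ} {a : L} {l : List L} (hl : ∀ c ∈ l, c = a)
    (h : (pathGraph α β ws).Path u l v) :
    level k (ws k) none u ≤ level k (ws k) none v + 1 ∧
      level k (ws k) none v ≤ level k (ws k) none u + 1 := by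
  have h1 := level_path k hl h
  have h2 := level_none_le k (ws k) (some a) u
  have h3 := level_none_le k (ws k) (some a) v
  have h4 := level_le k (ws k) (some a) u
  have h5 := level_le k (ws k) (some a) v
  omega

/-- Paths with a constant label that stay away from a node are preserved when the path is
lengthened at that node. -/
theorem path_shiftNode_of_level [Finite ι] {k : ι} {w : List L} {p r n : ℕ}
    (hw : (ws k).length = w.length + r)
    (hp : p < w.length) (h1 : ∀ j < p, w[j]? = (ws k)[j]?)
    (h2 : ∀ j, p < j → w[j]? = (ws k)[j + r]?)
    (h3 : n < level k w none (pathNode α β (update ws k w) k p)) {u v : V ⊕ ι × ℕ} {a : L}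
    {l : List L} (hl : ∀ c ∈ l, c = a) (hu : level k w (some a) u ≤ n)
    (h : (pathGraph α β (update ws k w)).Path u l v) :
    (pathGraph α β ws).Path (shiftNode k p r u) l (shiftNode k p r v) := by
  induction h with
  | nil v => exact .nil _
  | @cons u v v' b l h _ ih =>
    obtain rfl : b = a := hl b (by simp)
    have h4 := level_edge k h
    rw [Function.update_self] at h4
    refine .cons ?_ (ih (fun c hc => hl c (by simp [hc])) (by omega))
    rcases shiftNode_edge hw hp h1 h2 h with h | ⟨-, rfl, -⟩
    · exact h
    · have := level_none_le k w (some b) (pathNode α β (update ws k w) k p)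
      omega

end PathGraph

end CRPQContainment

namespace CRPQContainment

open Function (update)

/-! ### Small counterexamples -/

section Levels

variable {S : Set Name} {Q : CRPQ S}

theorem CRPQ.mem_vars_of_adj {x y : Name} (h : Q.graph.Adj x y) : y ∈ Q.vars := by
  rw [CRPQ.graph, SimpleGraph.fromRel_adj] at h
  obtain ⟨-, ⟨A, hA, rfl, rfl⟩ | ⟨A, hA, rfl, rfl⟩⟩ := h
  · exact ⟨A, hA, .inr rfl⟩
  · exact ⟨A, hA, .inl rfl⟩

theorem CRPQ.support_subset_vars {x y : Name} (W : Q.graph.Walk x y) (hx : x ∈ Q.vars) :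
    ∀ v ∈ W.support, v ∈ Q.vars := by
  induction W with
  | nil => simpa using hx
  | cons h W ih =>
    intro v hv
    rw [SimpleGraph.Walk.support_cons, List.mem_cons] at hv
    rcases hv with rfl | hv
    · exact hx
    · exact ih (CRPQ.mem_vars_of_adj h) v hv

/-- Variables in the same component are connected by a short walk. -/
theorem CRPQ.exists_walk {x y : Name} (hx : x ∈ Q.vars) (h : Q.graph.Reachable x y) :
    ∃ W : Q.graph.Walk x y, W.length ≤ 2 * Q.atoms.length := by
  obtain ⟨W, hW⟩ := h.exists_isPath
  refine ⟨W, ?_⟩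
  -- The nodes of a simple path are distinct endpoints of atoms, and an atom has two of them.
  have hsub : W.support ⊆ Q.atoms.flatMap fun A => [A.source, A.target] := by
    intro v hv
    obtain ⟨A, hA, h⟩ := CRPQ.support_subset_vars W hx v hv
    exact List.mem_flatMap.2 ⟨A, hA, by simpa using h⟩
  have h1 := (List.subperm_of_subset hW.support_nodup hsub).length_le
  rw [SimpleGraph.Walk.length_support, List.length_flatMap] at h1
  have h2 : ∀ l : List (Atom S), (l.map fun A => [A.source, A.target].length).sum = 2 * l.length := by
    intro l
    induction l with
    | nil => rfl
    | cons A l ih => rw [List.map_cons, List.sum_cons, ih, List.length_cons]; simp; omega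
  rw [h2] at h1
  omega

variable {V ι : Type} [Finite ι] [DecidableEq ι] [DecidableEq S] {α β : ι → V} {ws : ι → List S}

theorem level_walk_le (k : ι) (hQ : Q.InFragment (classDisjunctionStar S)) {ν : Name → V ⊕ ι × ℕ}
    (hν : Q.IsEmbedding (pathGraph α β ws) ν) {x y : Name} (W : Q.graph.Walk x y) :
    level k (ws k) none (ν x) ≤ level k (ws k) none (ν y) + W.length := by
  induction W with
  | nil => simp
  | cons h W ih =>
    rw [CRPQ.graph, SimpleGraph.fromRel_adj] at h
    rw [SimpleGraph.Walk.length_cons]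
    obtain ⟨-, ⟨A, hA, rfl, rfl⟩ | ⟨A, hA, rfl, rfl⟩⟩ := h
    all_goals
      obtain ⟨w, hw, hp⟩ := hν A hA
      obtain ⟨a, ha⟩ := exists_forall_eq_of_mem (hQ A hA) hw
      have := level_path_le k ha hp
      omega

/-- Variables are mapped to nodes from which an end of a path is reached after few changes of
letters. -/
theorem level_var_le (k : ι) (hQ : Q.InFragment (classDisjunctionStar S))
    (hQ' : Q.ComponentsDistinguished) {D : List V} {ν : Name → V ⊕ ι × ℕ}
    (hν : Q.IsEmbedding (pathGraph α β ws) ν) (hD : D.map Sum.inl = Q.distinguished.map ν)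
    {x : Name} (hx : x ∈ Q.vars) : level k (ws k) none (ν x) ≤ 2 * Q.atoms.length := by
  obtain ⟨y, hy, hxy⟩ := hQ' x hx
  obtain ⟨W, hW⟩ := CRPQ.exists_walk hx hxy
  have h1 := level_walk_le k hQ hν W
  have h2 : ν y ∈ D.map Sum.inl := hD ▸ List.mem_map_of_mem hy
  obtain ⟨v, -, hv⟩ := List.mem_map.1 h2
  have h3 : level k (ws k) none (.inl v : V ⊕ ι × ℕ) = 0 := rfl
  rw [← hv, h3] at h1
  omega

end Levels

/-- The graph with paths from `α i` to `β i` labelled with words `ws i` that match the expressions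
`R i` shows that the tuple `D` need not be an answer of the query `Q`. -/
structure IsCounterexample {S : Set Name} {V ι : Type} [Finite ι] (α β : ι → V)
    (R : ι → RegularExpression S) (D : List V) (Q : CRPQ S) (ws : ι → List S) : Prop where
  mem : ∀ i, ws i ∈ (R i).matches'
  eq_of_nil : ∀ i, ws i = [] → α i = β i
  no_embedding : ∀ ν, Q.IsEmbedding (pathGraph α β ws) ν → D.map Sum.inl ≠ Q.distinguished.map ν

/-! ### Shortening a counterexample -/

namespace IsCounterexample

variable {S : Set Name} {V ι : Type} [Finite ι] {α β : ι → V} {R : ι → RegularExpression S}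
  {D : List V} {Q : CRPQ S} {ws : ι → List S}

/-- Embeddings are carried from the shortened graph back to the original one. Shifting fixes the
nodes `inl v`, hence the answer tuple. -/
theorem update [DecidableEq ι] (h : IsCounterexample α β R D Q ws) {k : ι} {w : List S}
    (hw : w ∈ (R k).matches') (hne : w ≠ []) (hshift : ∀ ν,
      Q.IsEmbedding (pathGraph α β (update ws k w)) ν → D.map Sum.inl = Q.distinguished.map ν →
      ∃ p r, Q.IsEmbedding (pathGraph α β ws) (shiftNode k p r ∘ ν)) :
    IsCounterexample α β R D Q (update ws k w) where
  mem i := by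
    by_cases hi : i = k
    · subst hi; rwa [Function.update_self]
    · rw [Function.update_of_ne hi]; exact h.mem i
  eq_of_nil i := by
    by_cases hi : i = k
    · subst hi; rw [Function.update_self]; exact fun h => absurd h hne
    · rw [Function.update_of_ne hi]; exact h.eq_of_nil i
  no_embedding ν hν hD := by
    obtain ⟨p, r, hpr⟩ := hshift ν hν hD
    refine h.no_embedding _ hpr ?_
    rw [← List.map_map, ← hD, List.map_map]
    rfl

theorem getElem?_take_append_drop {L : Type} {w : List L} {p q : ℕ} (hpq : p < q)
    (hq : q ≤ w.length) (j : ℕ) :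
    (w.take p ++ w.drop q)[j]? = if j < p then w[j]? else w[j + (q - p)]? := by
  split_ifs with hj
  · rw [List.getElem?_append_left (by rw [List.length_take]; omega), List.getElem?_take_of_lt hj]
  · rw [List.getElem?_append_right (by rw [List.length_take]; omega), List.getElem?_drop,
      List.length_take]
    congr 1
    omega

/-- A word with a long run of one letter can be shortened. -/
theorem exists_shorter_of_run [DecidableEq ι] (h : IsCounterexample α β R D Q ws)
    (hQ : Q.InFragment (classDisjunctionStar S)) {k : ι} {s m : ℕ}
    (hs : (encodeRegex (R k)).length ≤ s) (hm : Q.atoms.length ≤ m) {a : S}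
    (hrun : List.replicate (m + s + 1) a <:+: ws k) :
    ∃ w, w.length < (ws k).length ∧ IsCounterexample α β R D Q (Function.update ws k w) := by
  classical
  obtain ⟨x, z, hxz⟩ := hrun
  have hlen : x.length + (m + s + 1) ≤ (ws k).length := by
    rw [← hxz]; simp only [List.length_append, List.length_replicate]; omega
  have hrun : ∀ j, x.length ≤ j → j < x.length + (m + s + 1) → (ws k)[j]? = some a := by
    intro j h1 h2
    rw [← hxz, List.append_assoc, List.getElem?_append_right h1,
      List.getElem?_append_left (by rw [List.length_replicate]; omega),
      List.getElem?_replicate_of_lt (by omega)]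
  generalize x.length = i at hlen hrun
  obtain ⟨p, q, hip, hpq, hqs, hw⟩ := exists_pump (h.mem k) hs (i := i)
  have hget := getElem?_take_append_drop hpq (show q ≤ (ws k).length by omega)
  have hlen' : (ws k).length = ((ws k).take p ++ (ws k).drop q).length + (q - p) := by
    rw [List.length_append, List.length_take, List.length_drop]
    omega
  generalize (ws k).take p ++ (ws k).drop q = w at hw hget hlen'
  refine ⟨w, by omega, h.update hw (List.ne_nil_of_length_pos (by omega)) fun ν hν _ => ?_⟩
  -- At least `m + 1` nodes of the run remain, and at most `m` atoms have a source.
  obtain ⟨j, hj, hjν⟩ : ∃ j ∈ Finset.Ico i (i + m + 1), ∀ A ∈ Q.atoms,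
      ν A.source ≠ pathNode α β (Function.update ws k w) k j := by
    by_contra! hcon
    have h1 : (Finset.Ico i (i + m + 1)).image (pathNode α β (Function.update ws k w) k) ⊆
        (Q.atoms.map fun A => ν A.source).toFinset := by
      intro u hu
      obtain ⟨j, hj, rfl⟩ := Finset.mem_image.1 hu
      obtain ⟨A, hA, hAj⟩ := hcon j hj
      exact List.mem_toFinset.2 (List.mem_map.2 ⟨A, hA, hAj⟩)
    have h2 := Finset.card_le_card h1
    rw [Finset.card_image_of_injOn] at h2
    · have h3 := List.toFinset_card_le (Q.atoms.map fun A => ν A.source)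
      rw [List.length_map] at h3
      rw [Nat.card_Ico] at h2
      omega
    · intro j hj j' hj' hjj
      simp only [Finset.coe_Ico, Set.mem_Ico] at hj hj'
      exact pathNode_injOn k (by rw [Function.update_self]; omega)
        (by rw [Function.update_self]; omega) hjj
  rw [Finset.mem_Ico] at hj
  have h0 : j < w.length := by omega
  -- Within the run all letters agree, so the deletion may be regarded as made at `j` instead of
  -- `p`.
  have h1 : ∀ j' < j, w[j']? = (ws k)[j']? := by
    intro j' hj'
    rw [hget]
    split_ifs with hp
    · rfl
    · rw [hrun _ (by omega) (by omega), hrun _ (by omega) (by omega)]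
  have h2 : ∀ j', j < j' → w[j']? = (ws k)[j' + (q - p)]? := by
    intro j' hj'
    rw [hget]
    split_ifs with hp
    · rw [hrun _ (by omega) (by omega), hrun _ (by omega) (by omega)]
    · rfl
  have h3 : ∀ j', j ≤ j' → j' ≤ j + (q - p) → (ws k)[j']? = w[j]? := by
    intro j' hj' hj''
    rw [hget, hrun _ (by omega) (by omega)]
    split_ifs with hp <;> rw [hrun _ (by omega) (by omega)]
  refine ⟨j, q - p, fun A hA => ?_⟩
  obtain ⟨l, hl, hp⟩ := hν A hA
  rcases hQ A hA with hR | ⟨b, hR⟩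
  · obtain ⟨b, rfl⟩ := mem_matches_isDisjunction hR hl
    refine ⟨[b], hl, KB.path_singleton_iff.2 ?_⟩
    rcases shiftNode_edge hlen' h0 h1 h2 (KB.path_singleton_iff.1 hp) with hp | ⟨-, hp, -⟩
    · exact hp
    · exact absurd hp (hjν A hA)
  · rw [hR, mem_matches_star_char] at hl
    obtain ⟨l', hl', hp'⟩ := exists_path_shiftNode hlen' h0 h1 h2 h3 hl hp
    exact ⟨l', by rwa [hR, mem_matches_star_char], hp'⟩

/-- A long word without long runs of one letter can be shortened. -/
theorem exists_shorter_of_no_run [DecidableEq ι] (h : IsCounterexample α β R D Q ws)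
    (hQ : Q.InFragment (classDisjunctionStar S)) (hQ' : Q.ComponentsDistinguished) {k : ι}
    {s m t : ℕ} (hs : (encodeRegex (R k)).length ≤ s) (hm : Q.atoms.length ≤ m)
    (hrun : ∀ a, ¬ List.replicate t a <:+: ws k) (ht : 0 < t)
    (hlen : 2 * ((2 * m + 3) * t) + s ≤ (ws k).length) :
    ∃ w, w.length < (ws k).length ∧ IsCounterexample α β R D Q (Function.update ws k w) := by
  classical
  -- At least `(2 * m + 3) * t` letters remain on each side of the cut. As there are no runs of
  -- length `t`, this forces more than `2 * m + 1` changes towards either end.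
  obtain ⟨p, q, hip, hpq, hqs, hw⟩ := exists_pump (h.mem k) hs (i := (2 * m + 3) * t)
  have hget := getElem?_take_append_drop hpq (show q ≤ (ws k).length by omega)
  have hlen' : (ws k).length = ((ws k).take p ++ (ws k).drop q).length + (q - p) := by
    rw [List.length_append, List.length_take, List.length_drop]
    omega
  have htpos : 0 < (2 * m + 3) * t := by positivity
  have hchanges : ∀ l : List S, (∀ a, ¬ List.replicate t a <:+: l) → (2 * m + 3) * t ≤ l.length →
      2 * m + 1 < changes none l := by
    intro l hl hlt
    have h1 := length_le_changes_none l hl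
    by_contra hcon
    have h2 : t * (changes none l + 1) ≤ t * (2 * m + 2) := Nat.mul_le_mul_left _ (by omega)
    have h3 : (2 * m + 3) * t = t * (2 * m + 2) + t := by ring
    omega
  have hleft : 2 * m + 1 < changes none ((ws k).take p).reverse := by
    refine hchanges _ (fun a ha => hrun a ?_)
      (by rw [List.length_reverse, List.length_take]; omega)
    rw [← List.reverse_replicate, List.reverse_infix] at ha
    exact ha.trans (List.take_prefix _ _).isInfix
  have hright : 2 * m + 1 < changes none ((ws k).drop q) := by
    refine hchanges _ (fun a ha => hrun a (ha.trans (List.drop_suffix _ _).isInfix))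
      (by rw [List.length_drop]; omega)
  have hp : p < ((ws k).take p ++ (ws k).drop q).length := by omega
  have hlevel : 2 * m + 1 < level k ((ws k).take p ++ (ws k).drop q) none
      (pathNode α β (Function.update ws k ((ws k).take p ++ (ws k).drop q)) k p) := by
    have h1 := level_pathNode (α := α) (β := β)
      (ws := Function.update ws k ((ws k).take p ++ (ws k).drop q)) k none p
    rw [Function.update_self] at h1
    have h2 : ((ws k).take p).length = p := by rw [List.length_take]; omega
    rw [h1, List.take_left' h2, List.drop_left' h2]
    exact lt_min hright hleft
  generalize (ws k).take p ++ (ws k).drop q = w at hw hget hlen' hp hlevel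
  refine ⟨w, by omega, h.update hw (List.ne_nil_of_length_pos (by omega)) fun ν hν hD =>
    ⟨p, q - p, fun A hA => ?_⟩⟩
  obtain ⟨l, hl, hpath⟩ := hν A hA
  obtain ⟨a, ha⟩ := exists_forall_eq_of_mem (hQ A hA) hl
  refine ⟨l, hl, path_shiftNode_of_level hlen' hp (fun j hj => by rw [hget, if_pos hj])
    (fun j hj => by rw [hget, if_neg (by omega)]) hlevel ha ?_ hpath⟩
  -- The source has level at most `2 * m`, and the first letter adds at most one.
  have h1 := level_var_le k hQ hQ' hν hD ⟨A, hA, .inl rfl⟩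
  rw [Function.update_self] at h1
  have h2 := level_le k w (some a) (ν A.source)
  omega

/-- All words of a smallest counterexample are short. -/
theorem exists_short [Fintype ι] (h : IsCounterexample α β R D Q ws)
    (hQ : Q.InFragment (classDisjunctionStar S)) (hQ' : Q.ComponentsDistinguished) {s m : ℕ}
    (hs : ∀ k, (encodeRegex (R k)).length ≤ s) (hm : Q.atoms.length ≤ m) :
    ∃ ws, IsCounterexample α β R D Q ws ∧
      ∀ k, (ws k).length < 2 * ((2 * m + 3) * (m + s + 1)) + s := by
  classical
  induction hn : ∑ k, (ws k).length using Nat.strong_induction_on generalizing ws with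
  | _ n ih =>
    by_cases hlen : ∀ k, (ws k).length < 2 * ((2 * m + 3) * (m + s + 1)) + s
    · exact ⟨ws, h, hlen⟩
    push Not at hlen
    obtain ⟨k, hk⟩ := hlen
    obtain ⟨w, hw, hc⟩ : ∃ w, w.length < (ws k).length ∧
        IsCounterexample α β R D Q (Function.update ws k w) := by
      by_cases hrun : ∃ a, List.replicate (m + s + 1) a <:+: ws k
      · obtain ⟨a, ha⟩ := hrun
        exact h.exists_shorter_of_run hQ (hs k) hm ha
      · exact h.exists_shorter_of_no_run hQ hQ' (hs k) hm (not_exists.1 hrun) (by omega) hk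
    refine ih _ ?_ hc rfl
    rw [← hn]
    refine Finset.sum_lt_sum (fun i _ => ?_) ⟨k, Finset.mem_univ _, ?_⟩
    · by_cases hi : i = k
      · subst hi; rw [Function.update_self]; exact hw.le
      · rw [Function.update_of_ne hi]
    · rwa [Function.update_self]

end IsCounterexample

/-- An embedding of `Q₂` into the graph of paths could be composed with the map of that graph to the
given knowledge base. -/
theorem exists_isCounterexample {S : Set Name} {Q₁ Q₂ : CRPQ S} (h : ¬ Q₁.Contained Q₂) :
    ∃ (V : Type) (μ : Name → V) (ws : Fin Q₁.atoms.length → List S),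
      IsCounterexample (fun i => μ (Q₁.atoms.get i).source) (fun i => μ (Q₁.atoms.get i).target)
        (fun i => (Q₁.atoms.get i).regex) (Q₁.distinguished.map μ) Q₂ ws := by
  unfold CRPQ.Contained at h
  push Not at h
  obtain ⟨V, _, _, K, h⟩ := h
  obtain ⟨_, ⟨μ, hμ, rfl⟩, hans⟩ := Set.not_subset.1 h
  choose ws hws hp using fun i : Fin Q₁.atoms.length => hμ (Q₁.atoms.get i) (List.get_mem _ _)
  refine ⟨V, μ, ws, hws, fun i hi => ?_, fun ν hν hD => hans ?_⟩
  · have := hp i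
    rwa [hi, KB.path_nil_iff] at this
  · obtain ⟨f, hf, hf'⟩ := pathGraph_exists_map hp
    refine ⟨f ∘ ν, fun A hA => ?_, ?_⟩
    · obtain ⟨w, hw, hp⟩ := hν A hA
      exact ⟨w, hw, hp.map hf'⟩
    · rw [← List.map_map, ← hD, List.map_map]
      conv_lhs => rw [← List.map_id (Q₁.distinguished.map μ)]
      exact List.map_congr_left fun v _ => (hf v).symm

theorem length_atoms_le {S : Set Name} (Q : CRPQ S) :
    Q.atoms.length ≤ (Q.atoms.flatMap encodeAtom).length := by
  induction Q.atoms with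
  | nil => simp
  | cons A l ih =>
    have : 0 < (encodeAtom A).length := by simp [encodeAtom]
    rw [List.flatMap_cons, List.length_append, List.length_cons]
    omega

theorem length_encodeRegex_le {S : Set Name} {Q : CRPQ S} {A : Atom S} (hA : A ∈ Q.atoms) :
    (encodeRegex A.regex).length ≤ (encodeQuery Q).length := by
  have h1 : (encodeRegex A.regex).length ≤ (encodeAtom A).length := by
    simp only [encodeAtom, List.length_cons, List.length_append]; omega
  obtain ⟨l, l', h2⟩ := List.append_of_mem hA
  simp only [encodeQuery, List.length_append, h2, List.flatMap_append, List.flatMap_cons]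
  omega

/-- The relevant nodes of a graph with short paths are renamed injectively by numbers. The bound on
the words of `Q₁` and the condition on labels are what the certificates require. -/
theorem exists_small_counterexample : ∃ d, 1 ≤ d ∧ ∀ {S : Set Name} (Q₁ Q₂ : CRPQ S),
    Q₂.InFragment (classDisjunctionStar S) → Q₂.ComponentsDistinguished → ¬ Q₁.Contained Q₂ →
    ∃ (K : KB S (Fin (((encodeQuery Q₁ ++ encodeQuery Q₂).length + 2) ^ d)))
      (μ : Name → Fin (((encodeQuery Q₁ ++ encodeQuery Q₂).length + 2) ^ d)),
      (∀ A ∈ Q₁.atoms, ∃ w ∈ A.regex.matches',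
        w.length < ((encodeQuery Q₁ ++ encodeQuery Q₂).length + 2) ^ d ∧
          K.Path (μ A.source) w (μ A.target)) ∧
      (∀ ν, Q₂.IsEmbedding K ν → Q₁.distinguished.map μ ≠ Q₂.distinguished.map ν) ∧
      ∀ u a v, (u, a, v) ∈ K.edges → ∃ A ∈ Q₁.atoms,
        Token.symbol :: encodeName a <:+: encodeRegex A.regex := by
  -- There are at most `n` paths whose length is quadratic in `n`; the exponent leaves room for the
  -- constants.
  refine ⟨6, by omega, fun {S} Q₁ Q₂ hQ₂ hQ₂' hQ => ?_⟩
  classical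
  obtain ⟨V, μ, ws, hws⟩ := exists_isCounterexample hQ
  have hn : (encodeQuery Q₁ ++ encodeQuery Q₂).length =
    (encodeQuery Q₁).length + (encodeQuery Q₂).length := List.length_append
  have hm₁ : Q₁.atoms.length ≤ (encodeQuery Q₁).length := by
    have := length_atoms_le Q₁
    simp only [encodeQuery, List.length_append]
    omega
  have hm₂ : Q₂.atoms.length ≤ (encodeQuery Q₂).length := by
    have := length_atoms_le Q₂
    simp only [encodeQuery, List.length_append]
    omega
  have hs : ∀ k : Fin Q₁.atoms.length, (encodeRegex (Q₁.atoms.get k).regex).length ≤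
      (encodeQuery Q₁).length := fun k => length_encodeRegex_le (List.get_mem _ _)
  generalize (encodeQuery Q₁ ++ encodeQuery Q₂).length = n at *
  obtain ⟨ws, hws, hlen⟩ := hws.exists_short hQ₂ hQ₂' (s := n) (m := n)
    (fun k => (hs k).trans (by omega)) (by omega)
  let B := 2 * ((2 * n + 3) * (n + n + 1)) + n
  have hB : B + 2 ≤ (n + 2) ^ 5 := by
    have h1 : B + 2 ≤ 8 * (n + 2) ^ 2 := by
      simp only [B]
      nlinarith
    have h2 : 2 ^ 3 ≤ (n + 2) ^ 3 := Nat.pow_le_pow_left (by omega) 3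
    calc B + 2 ≤ 8 * (n + 2) ^ 2 := h1
      _ ≤ (n + 2) ^ 3 * (n + 2) ^ 2 := Nat.mul_le_mul_right _ h2
      _ = (n + 2) ^ 5 := by ring
  have hN : (n + 2) ^ 6 = (n + 2) * (n + 2) ^ 5 := by ring
  have hBN : B ≤ (n + 2) ^ 6 := by
    rw [hN]
    exact (by omega : B ≤ (n + 2) ^ 5).trans (Nat.le_mul_of_pos_left _ (by omega))
  generalize hα : (fun i => μ (Q₁.atoms.get i).source) = α at hws
  generalize hβ : (fun i => μ (Q₁.atoms.get i).target) = β at hws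
  let T : Finset (V ⊕ Fin Q₁.atoms.length × ℕ) :=
    (Finset.univ.image fun i => .inl (α i)) ∪ (Finset.univ.image fun i => .inl (β i)) ∪
      (Finset.univ ×ˢ Finset.range B).image .inr
  have hT : T.card ≤ (n + 2) ^ 6 := by
    have h1 : (Finset.univ.image fun i => (.inl (α i) : V ⊕ Fin Q₁.atoms.length × ℕ)).card ≤ n :=
      Finset.card_image_le.trans (by simp; omega)
    have h2 : (Finset.univ.image fun i => (.inl (β i) : V ⊕ Fin Q₁.atoms.length × ℕ)).card ≤ n :=
      Finset.card_image_le.trans (by simp; omega)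
    have h3 : ((Finset.univ ×ˢ Finset.range B).image
        (.inr : _ → V ⊕ Fin Q₁.atoms.length × ℕ)).card ≤ n * B := by
      refine Finset.card_image_le.trans ?_
      rw [Finset.card_product, Finset.card_range, Finset.card_univ, Fintype.card_fin]
      exact Nat.mul_le_mul_right _ (by omega)
    calc T.card ≤ n + n + n * B :=
          (Finset.card_union_le _ _).trans
            (add_le_add ((Finset.card_union_le _ _).trans (add_le_add h1 h2)) h3)
      _ = n * (B + 2) := by ring
      _ ≤ (n + 2) * (n + 2) ^ 5 := Nat.mul_le_mul (by omega) hB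
      _ = (n + 2) ^ 6 := hN.symm
  have hnode : ∀ i j, pathNode α β ws i j ∈ T := by
    intro i j
    unfold pathNode
    have := hlen i
    split_ifs <;> simp [T]
    all_goals omega
  obtain ⟨e⟩ : Nonempty (T ↪ Fin ((n + 2) ^ 6)) :=
    Function.Embedding.nonempty_of_card_le (by simpa using hT)
  have hN0 : 0 < (n + 2) ^ 6 := by positivity
  -- All edges run inside `T`, so the value outside `T` does not matter.
  let f : V ⊕ Fin Q₁.atoms.length × ℕ → Fin ((n + 2) ^ 6) := fun t =>
    if ht : t ∈ T then e ⟨t, ht⟩ else ⟨0, hN0⟩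
  have hf : Set.InjOn f T := by
    intro t ht t' ht' h
    have ht : t ∈ T := ht
    have ht' : t' ∈ T := ht'
    simp only [f, ht, ht', dif_pos] at h
    simpa using e.injective h
  let K : KB S (Fin ((n + 2) ^ 6)) := ⟨(fun t => (f t.1, t.2.1, f t.2.2)) ''
    (pathGraph α β ws).edges, (pathGraph α β ws).finite_edges.image _⟩
  have hK : ∀ u a v, (u, a, v) ∈ (pathGraph α β ws).edges → (f u, a, f v) ∈ K.edges :=
    fun u a v h => ⟨_, h, rfl⟩
  have hvars : ∀ x ∈ Q₁.vars, (.inl (μ x) : V ⊕ Fin Q₁.atoms.length × ℕ) ∈ T := by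
    rintro x ⟨A, hA, h⟩
    obtain ⟨i, rfl⟩ := List.get_of_mem hA
    rcases h with rfl | rfl
    · exact Finset.mem_union_left _ (Finset.mem_union_left _ (Finset.mem_image.2
        ⟨i, Finset.mem_univ _, by rw [← hα]⟩))
    · exact Finset.mem_union_left _ (Finset.mem_union_right _ (Finset.mem_image.2
        ⟨i, Finset.mem_univ _, by rw [← hβ]⟩))
  refine ⟨K, fun x => f (.inl (μ x)), fun A hA => ?_, fun ν hν hD => ?_, ?_⟩
  · obtain ⟨i, rfl⟩ := List.get_of_mem hA
    refine ⟨ws i, hws.mem i, (hlen i).trans_le hBN, ?_⟩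
    have := (pathGraph_path_word (hws.eq_of_nil i)).map hK
    rwa [← hα, ← hβ] at this
  · have : Nonempty (V ⊕ Fin Q₁.atoms.length × ℕ) := ⟨.inl (μ [])⟩
    have hg : ∀ t ∈ T, Function.invFunOn f T (f t) = t := fun t ht =>
      hf.leftInvOn_invFunOn ht
    have hK' : ∀ u a v, (u, a, v) ∈ K.edges → (Function.invFunOn f T u, a,
        Function.invFunOn f T v) ∈ (pathGraph α β ws).edges := by
      rintro _ _ _ ⟨⟨u, a, v⟩, h, h'⟩
      obtain ⟨rfl, rfl, rfl⟩ := by simpa only [Prod.mk.injEq] using h'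
      obtain ⟨i, j, h1, rfl, rfl⟩ := id h
      rw [hg _ (hnode _ _), hg _ (hnode _ _)]
      exact h
    refine hws.no_embedding (Function.invFunOn f T ∘ ν) (fun A hA => ?_) ?_
    · obtain ⟨w, hw, hp⟩ := hν A hA
      exact ⟨w, hw, hp.map hK'⟩
    · rw [← List.map_map, ← hD, List.map_map, List.map_map]
      exact List.map_congr_left fun x hx => (hg _ (hvars x (Q₁.distinguished_occurs x hx))).symm
  · rintro _ _ _ ⟨⟨u, a, v⟩, ⟨i, j, h1, -, -⟩, h'⟩
    obtain ⟨-, rfl, -⟩ := by simpa only [Prod.mk.injEq] using h'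
    exact ⟨_, List.get_mem _ i, symbol_infix_encodeRegex (hws.mem i) (List.mem_of_getElem? h1)⟩

end CRPQContainment

namespace CRPQContainment

namespace Model

variable {M : Model} {x : List Token} {S : Set Name}

/-! ### Fragments -/

/-- Each excluded constructor leaves its own token, so membership in the fragment can be tested
token by token. -/
theorem isDisjunction_iff {R : RegularExpression S} : IsDisjunction R ↔
    ∀ a ∈ encodeRegex R, ¬ (a = .empty ∨ a = .epsilon ∨ a = .comp ∨ a = .star) := by
  induction R with
  | zero => exact ⟨(nomatch ·), fun h => absurd (.inl rfl) (h .empty (by simp [encodeRegex]))⟩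
  | epsilon =>
    exact ⟨(nomatch ·), fun h => absurd (.inr (.inl rfl)) (h .epsilon (by simp [encodeRegex]))⟩
  | char a =>
    refine ⟨fun _ t ht => ?_, fun _ => .symbol a⟩
    rintro (rfl | rfl | rfl | rfl) <;> simp [encodeRegex, notMem_encodeName] at ht
  | plus R R' ih ih' =>
    constructor
    · rintro (_ | ⟨h, h'⟩) t ht
      simp only [encodeRegex, List.mem_cons, List.mem_append] at ht
      rcases ht with rfl | ht | ht
      · simp
      · exact ih.1 h t ht
      · exact ih'.1 h' t ht
    · exact fun h => .plus (ih.2 fun t ht => h t (by simp [encodeRegex, ht]))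
        (ih'.2 fun t ht => h t (by simp [encodeRegex, ht]))
  | comp R R' =>
    exact ⟨(nomatch ·), fun h => absurd (.inr (.inr (.inl rfl))) (h .comp (by simp [encodeRegex]))⟩
  | star R =>
    exact ⟨(nomatch ·), fun h => absurd (.inr (.inr (.inr rfl))) (h .star (by simp [encodeRegex]))⟩

theorem QueryAt.disjunctionFragment_iff {s f : ℕ} {Q : CRPQ S} (h : M.SyntaxCorrect x S)
    (hQ : QueryAt x s f Q) : M.DisjunctionFragment s f ↔ Q.InFragment (classA S) := by
  have hlen := hQ.le_length
  constructor
  · intro hd A hA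
    refine isDisjunction_iff.2 fun a ha => ?_
    obtain ⟨i, hi, hif, hAi⟩ := hQ.exists_position_atom hA
    have hp := atomPositions_of_at hAi
    obtain ⟨i', hi', h1, h2⟩ : ∃ i', s ≤ i' ∧ i' < f ∧ x[i']? = some a := by
      have : a ∈ Q.distinguished.flatMap (fun x => Token.distinguished :: encodeName x) ++
          Q.atoms.flatMap encodeAtom := by
        refine List.mem_append_right _ (List.mem_flatMap.2 ⟨A, hA, ?_⟩)
        simp [encodeAtom, ha]
      obtain ⟨n, hn, hna⟩ := List.getElem_of_mem this
      refine ⟨s + n, by omega, ?_, ?_⟩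
      · rw [hQ.end_eq]
        rw [List.length_append] at hn
        omega
      · rw [(at_append.1 hQ.query).1.getElem? hn, List.getElem?_eq_getElem hn, hna]
    have := hd i' (h.isWord.lt_size (by omega)) hi' h1
    rw [h.isWord.tok, h.isWord.tok, h.isWord.tok, h.isWord.tok, h2] at this
    simpa using this
  · intro hd i _ hi hif
    rw [h.isWord.tok, h.isWord.tok, h.isWord.tok, h.isWord.tok]
    intro ha
    obtain ⟨a, hxa, ha⟩ : ∃ a, x[i]? = some a ∧
        (a = .empty ∨ a = .epsilon ∨ a = .comp ∨ a = .star) := by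
      rcases ha with ha | ha | ha | ha <;> exact ⟨_, ha, by simp⟩
    have hmem : a ∈ Q.distinguished.flatMap (fun x => Token.distinguished :: encodeName x) ++
          Q.atoms.flatMap encodeAtom := by
      refine (at_append.1 hQ.query).1.mem hi ?_ hxa
      rw [List.length_append, ← add_assoc, ← hQ.end_eq]
      exact hif
    have hn : ∀ b, a ∉ encodeName b := fun b => notMem_encodeName
      (by rintro rfl; simp at ha) (by rintro b rfl; simp at ha) b
    rw [List.mem_append, List.mem_flatMap, List.mem_flatMap] at hmem
    rcases hmem with ⟨b, -, hb⟩ | ⟨A, hA, hb⟩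
    · rw [List.mem_cons] at hb
      rcases hb with rfl | hb
      · simp at ha
      · exact hn _ hb
    · simp only [encodeAtom, List.mem_cons, List.mem_append, hn, or_false, false_or] at hb
      rcases hb with rfl | hb
      · simp at ha
      · exact isDisjunction_iff.1 (hd A hA) a hb ha

theorem QueryAt.symbolStarFragment_iff {s f : ℕ} {Q : CRPQ S} (h : M.SyntaxCorrect x S)
    (hQ : QueryAt x s f Q) : M.SymbolStarFragment s f ↔ Q.InFragment (classSymbolStar S) := by
  constructor
  · intro hd A hA
    obtain ⟨i, hi, i', hi', j, hj, k, hk, l, hl, h1, h2, h3⟩ := hQ.exists_atomPositions h.isWord hA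
    have hr := h3.regex
    have := hd i hi i' hi' j hj k hk l hl ((hQ.atomIn_iff h hj hk).2 ⟨A, hA, h1, h2, h3⟩)
    rw [h.isWord.tok, h.isWord.tok] at this
    rcases this with h4 | ⟨h4, _, _, rfl, h5⟩
    · generalize A.regex = R at hr
      cases R with
      | char a => exact ⟨a, .inl rfl⟩
      | _ => have := (at_cons.1 hr).1; simp [h4] at this
    · rw [h.isWord.tok] at h5
      generalize A.regex = R at hr
      cases R with
      | star R =>
        have hr := (at_cons.1 hr).2
        cases R with
        | char a => exact ⟨a, .inr rfl⟩
        | _ => have := (at_cons.1 hr).1; simp [h5] at this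
      | _ => have := (at_cons.1 hr).1; simp [h4] at this
  · intro hd i hi i' hi' j hj k hk l hl hA
    obtain ⟨A, hA, -, -, h3⟩ := (hQ.atomIn_iff h hj hk).1 hA
    rw [h.isWord.tok, h.isWord.tok]
    have hr := h3.regex
    obtain ⟨a, ha | ha⟩ := hd A hA
    · rw [ha] at hr
      exact .inl (at_cons.1 hr).1
    · rw [ha] at hr
      have h4 := (at_cons.1 (at_cons.1 hr).2).1
      have := (List.getElem?_eq_some_iff.1 h4).1
      exact .inr ⟨(at_cons.1 hr).1, j + 1, h.isWord.lt_size (by omega), rfl,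
        (h.isWord.tok _ _).2 h4⟩

/-- The labels are definable if they form a finite set or are all names. -/
theorem exists_isLabel (hS : S.Finite ∨ S = Set.univ) : ∃ label : Model → ℕ → Prop,
    (∀ {k : ℕ} (i : Fin k), Definable k fun M e => label M (e i)) ∧
    ∀ {M : Model} {x : List Token}, M.IsWord x → IsLabel S label M x := by
  rcases hS with hS | rfl
  · refine ⟨fun M i => ∃ a ∈ hS.toFinset.toList, M.NameIs a i,
      fun i => Definable.exists_nameIs _ i, fun h i _ => ?_⟩
    simp only [h.nameIs_iff, Finset.mem_toList, Set.Finite.mem_toFinset]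
  · refine ⟨fun M i => ∃ j < M.size, M.NameAt i j,
      fun i => Definable.ex (P := fun M e j => M.NameAt (e i) j) (Definable.nameAt _ _),
      fun h i _ => ?_⟩
    simp only [h.nameAt_iff, Set.mem_univ, true_and]
    constructor
    · rintro ⟨_, -, a, ha, -⟩
      exact ⟨a, ha⟩
    · rintro ⟨a, ha⟩
      exact ⟨_, h.lt_size (by have := ha.add_length_le (encodeName_ne_nil _); omega), a, ha, rfl⟩

/-! ### Verification of a containment -/

theorem AtEnd.length_le {l : ℕ} (h : M.IsWord x) (hl : M.AtEnd l) : x.length ≤ l := by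
  by_contra hlt
  refine hl ⟨x[l]'(by omega), by simp, ?_⟩
  rw [h.tok, List.getElem?_eq_getElem]

/-- What is verified about an encoding of the queries `Q₁` and `Q₂`. -/
structure VerifiesQueries (M : Model) (x : List Token) (fragment : Model → ℕ → ℕ → Prop)
    (Q₁ Q₂ : CRPQ S) (e f : ℕ) : Prop where
  syntaxCorrect : M.SyntaxCorrect x S
  query₁ : QueryAt x 0 e Q₁
  query₂ : QueryAt x (e + 1) f Q₂
  fragment : fragment M (e + 1) f
  component₁ : M.ComponentSpec 0 e
  component₂ : M.ComponentSpec (e + 1) f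
  satisfies : M.Satisfies false 0 e → M.Satisfies true (e + 1) f ∧ M.SameTupleSpec ∧
    M.SameTuple 0 (e + 1)

/-- The two codes form a prefix of the word, and `AtEnd` shows that nothing follows. -/
theorem Verifies.exists_queries {label : Model → ℕ → Prop} {fragment : Model → ℕ → ℕ → Prop}
    (h : M.Verifies label fragment) (hM : M.IsWord x) (hl : IsLabel S label M x) :
    ∃ (Q₁ Q₂ : CRPQ S) (e f : ℕ), x = encodeQuery Q₁ ++ encodeQuery Q₂ ∧
      M.VerifiesQueries x fragment Q₁ Q₂ e f := by
  obtain ⟨_, ho, e, he, _, hs, f, hf, _, -, ⟨rfl, rfl, rfl, hend⟩, ⟨h1, h2, h3, h4⟩, ⟨h5, h6⟩,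
    ⟨h7, h8⟩, h9, ⟨h10, h11⟩, h12⟩ := h
  have hc := M.syntaxCorrect hM h1 h2 hl
  obtain ⟨Q₁, hQ₁⟩ := hc.exists_queryAt h3 h4 ho he h5 h7
  obtain ⟨Q₂, hQ₂⟩ := hc.exists_queryAt h3 h4 hs hf h6 h8
  refine ⟨Q₁, Q₂, e, f, ?_, hc, hQ₁, hQ₂, h9, h10, h11, h12⟩
  have e1 := hQ₁.eq_end
  have e2 := hQ₂.eq_end
  have hat : At x 0 (encodeQuery Q₁ ++ encodeQuery Q₂) :=
    at_append.2 ⟨hQ₁.query, by rw [← e1]; exact hQ₂.query⟩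
  refine (List.IsPrefix.eq_of_length_le (by simpa [At] using hat) ?_).symm
  rw [List.length_append]
  exact (hend.length_le hM).trans (by omega)

theorem queryAt_append {Q₁ Q₂ : CRPQ S} (hx : x = encodeQuery Q₁ ++ encodeQuery Q₂) :
    ∃ e f, QueryAt x 0 e Q₁ ∧ QueryAt x (e + 1) f Q₂ ∧ f + 1 = x.length := by
  have p1 : 0 < (encodeQuery Q₁).length := by simp [encodeQuery]
  have p2 : 0 < (encodeQuery Q₂).length := by simp [encodeQuery]
  obtain ⟨h1, h2⟩ := at_append.1 (at_zero hx)
  refine ⟨(encodeQuery Q₁).length - 1, x.length - 1, ⟨h1, by omega⟩, ⟨?_, ?_⟩, ?_⟩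
  · rwa [Nat.sub_add_cancel p1, ← zero_add (encodeQuery Q₁).length]
  · rw [hx, List.length_append]; omega
  · rw [hx, List.length_append]; omega

theorem sameNameSpec_of_iff (h : M.IsWord x) (hs : ∀ i < M.size, ∀ j < M.size,
    (M.SameName i j ↔ ∃ a, At x i (encodeName a) ∧ At x j (encodeName a))) : M.SameNameSpec := by
  intro i hi j hj
  rw [hs i hi j hj]
  simp only [h.tok]
  constructor
  · rintro ⟨a, h1, h2⟩
    cases a with
    | nil => exact .inl ⟨(at_cons.1 h1).1, (at_cons.1 h2).1⟩
    | cons b a =>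
      obtain ⟨h1, h3⟩ := at_cons.1 h1
      obtain ⟨h2, h4⟩ := at_cons.1 h2
      have hi' := h.lt_size (i := i + 1)
        (by have := h3.add_length_le (encodeName_ne_nil _); omega)
      have hj' := h.lt_size (i := j + 1)
        (by have := h4.add_length_le (encodeName_ne_nil _); omega)
      refine .inr ⟨i + 1, hi', j + 1, hj', rfl, rfl, (hs _ hi' _ hj').2 ⟨a, h3, h4⟩, ?_⟩
      cases b
      · exact .inl ⟨h1, h2⟩
      · exact .inr ⟨h1, h2⟩
  · rintro (⟨h1, h2⟩ | ⟨_, hi', _, hj', rfl, rfl, h3, h4⟩)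
    · exact ⟨[], at_cons.2 ⟨h1, at_nil⟩, at_cons.2 ⟨h2, at_nil⟩⟩
    · obtain ⟨a, h5, h6⟩ := (hs _ hi' _ hj').1 h3
      rcases h4 with ⟨h1, h2⟩ | ⟨h1, h2⟩
      · exact ⟨false :: a, at_cons.2 ⟨h1, h5⟩, at_cons.2 ⟨h2, h6⟩⟩
      · exact ⟨true :: a, at_cons.2 ⟨h1, h5⟩, at_cons.2 ⟨h2, h6⟩⟩

theorem atomsSpec_of_iff (h : M.SyntaxCorrect x S) (ha : ∀ i < M.size, ∀ e < M.size,
    (M.AtomsAt i e ↔ ∃ l : List (Atom S), At x i (l.flatMap encodeAtom ++ [.endQuery]) ∧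
      e = i + (l.flatMap encodeAtom).length)) : M.AtomsSpec := by
  intro i hi e he hie
  obtain ⟨l, hl, rfl⟩ := (ha i hi e he).1 hie
  cases l with
  | nil => exact .inl ⟨(h.isWord.tok _ _).2 (at_cons.1 hl).1, by simp⟩
  | cons A l =>
    rw [List.flatMap_cons, List.append_assoc, at_append] at hl
    have hp := atomPositions_of_at hl.1
    obtain ⟨-, h1, h2, h3, h4⟩ := hp.lt_size h.isWord
    refine .inr ⟨_, h1, _, h2, _, h3, _, h4, (h.atomAt_iff h2 h3).2 ⟨A, hp⟩,
      (ha _ h4 _ he).2 ⟨l, hl.2, ?_⟩⟩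
    rw [List.flatMap_cons, List.length_append, add_assoc]

theorem querySpec_of_iff (h : M.SyntaxCorrect x S) (ha : ∀ i < M.size, ∀ e < M.size,
    (M.AtomsAt i e ↔ ∃ l : List (Atom S), At x i (l.flatMap encodeAtom ++ [.endQuery]) ∧
      e = i + (l.flatMap encodeAtom).length))
    (hq : ∀ i < M.size, ∀ e < M.size, (M.QueryFrom i e ↔ ∃ (d : List Name) (l : List (Atom S)),
      At x i (d.flatMap (fun x => Token.distinguished :: encodeName x) ++
        l.flatMap encodeAtom ++ [.endQuery]) ∧
      e = i + (d.flatMap (fun x => Token.distinguished :: encodeName x)).length +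
        (l.flatMap encodeAtom).length)) : M.QuerySpec := by
  intro i hi e he hie
  obtain ⟨d, l, hl, rfl⟩ := (hq i hi e he).1 hie
  cases d with
  | nil => exact .inl ((ha i hi _ he).2 ⟨l, hl, by simp⟩)
  | cons a d =>
    rw [List.flatMap_cons, List.append_assoc, List.append_assoc, List.cons_append, at_cons,
      at_append, ← List.append_assoc] at hl
    have hlen := hl.2.2.add_length_le (by simp)
    rw [List.length_append, List.length_singleton] at hlen
    have h1 : i + 1 < M.size := h.isWord.lt_size (by omega)
    have h2 : i + 1 + (encodeName a).length < M.size := h.isWord.lt_size (by omega)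
    refine .inr ⟨_, h1, _, h2, (h.isWord.tok _ _).2 hl.1, rfl,
      h.isWord.nameAt_iff.2 ⟨a, hl.2.1, rfl⟩, (hq _ h2 _ he).2 ⟨d, l, hl.2.2, ?_⟩⟩
    rw [List.flatMap_cons, List.length_append, List.length_cons]
    omega

variable {label : Model → ℕ → Prop} {fragment : Model → ℕ → ℕ → Prop}
  {C : Set (RegularExpression S)}

theorem verifies_of_queries (hM : M.IsWord x) (hl : IsLabel S label M x)
    (hs : ∀ i < M.size, ∀ j < M.size,
      (M.SameName i j ↔ ∃ a, At x i (encodeName a) ∧ At x j (encodeName a)))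
    (hr : ∀ i < M.size, ∀ j < M.size, (M.RegexAt i j ↔ ∃ R : RegularExpression S,
      At x i (encodeRegex R) ∧ j = i + (encodeRegex R).length))
    (ha : ∀ i < M.size, ∀ e < M.size,
      (M.AtomsAt i e ↔ ∃ l : List (Atom S), At x i (l.flatMap encodeAtom ++ [.endQuery]) ∧
        e = i + (l.flatMap encodeAtom).length))
    (hq : ∀ i < M.size, ∀ e < M.size, (M.QueryFrom i e ↔ ∃ (d : List Name) (l : List (Atom S)),
      At x i (d.flatMap (fun x => Token.distinguished :: encodeName x) ++
        l.flatMap encodeAtom ++ [.endQuery]) ∧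
      e = i + (d.flatMap (fun x => Token.distinguished :: encodeName x)).length +
        (l.flatMap encodeAtom).length))
    {Q₁ Q₂ : CRPQ S} (hx : x = encodeQuery Q₁ ++ encodeQuery Q₂)
    (hv : ∀ e f, M.SyntaxCorrect x S → QueryAt x 0 e Q₁ → QueryAt x (e + 1) f Q₂ →
      M.VerifiesQueries x fragment Q₁ Q₂ e f) : M.Verifies label fragment := by
  have hc : M.SyntaxCorrect x S := ⟨hM, fun hi hj => hs _ hi _ hj, fun hi hj => hr _ hi _ hj⟩
  obtain ⟨e, f, h1, h2, h3⟩ := queryAt_append hx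
  have h4 := hv e f hc h1 h2
  have l1 := h1.eq_end
  have l2 := h2.eq_end
  have hQ : ∀ {s e} {Q : CRPQ S}, s < M.size → e < M.size → QueryAt x s e Q → M.QueryFrom s e :=
    fun {s e Q} hs he hQ => (hq _ hs _ he).2 ⟨Q.distinguished, Q.atoms, hQ.query, hQ.end_eq⟩
  have h0 : 0 < M.size := hM.lt_size (by omega)
  have he : e < M.size := hM.lt_size (by omega)
  have hs' : e + 1 < M.size := hM.lt_size (by omega)
  have hf : f < M.size := hM.lt_size (by omega)
  refine ⟨0, h0, e, he, e + 1, hs', f, hf, f + 1, hM.lt_size (by omega), ⟨rfl, rfl, rfl, ?_⟩,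
    ⟨sameNameSpec_of_iff hM hs, regexSpec_of_iff hM hl hr, atomsSpec_of_iff hc ha,
      querySpec_of_iff hc ha hq⟩, ⟨hQ h0 he h1, hQ hs' hf h2⟩,
    ⟨h1.distinguishedOccur hc, h2.distinguishedOccur hc⟩, h4.fragment,
    ⟨h4.component₁, h4.component₂⟩, h4.satisfies⟩
  rintro ⟨a, -, ha⟩
  rw [hM.tok, List.getElem?_eq_none (by omega)] at ha
  simp at ha

/-- The second certificate consists of the true syntax tables together with a homomorphism of `Q₂`
that containment provides whenever the first certificate describes an answer of `Q₁`. -/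
theorem exists_verifies {d : ℕ} (hd : d ≠ 0) (hC : C ⊆ classDisjunctionStar S)
    (hl : ∀ {M : Model} {x : List Token}, M.IsWord x → IsLabel S label M x)
    (hfrag : ∀ {M : Model} {x : List Token} {s f : ℕ} {Q : CRPQ S}, M.SyntaxCorrect x S →
      QueryAt x s f Q → (fragment M s f ↔ Q.InFragment C)) {Q₁ Q₂ : CRPQ S}
    (hQ₁ : Q₁.ComponentsDistinguished) (hQ₂ : Q₂.ComponentsDistinguished)
    (hQC : Q₂.InFragment C) (hQ : Q₁.Contained Q₂)
    (hx : x = encodeQuery Q₁ ++ encodeQuery Q₂) (y : List Bool) :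
    ∃ z : List Bool, z.length ≤ 8 * ((x.length + 2) ^ d) ^ 4 ∧
      (wordStructure d x y z).model.Verifies label fragment := by
  classical
  let N := (x.length + 2) ^ d
  have hN : 2 ≤ N := (Nat.le_self_pow hd _).trans' (by omega)
  have : NeZero N := ⟨by omega⟩
  -- The knowledge base and the first assignment do not depend on `z`, so they are available before
  -- `z` is built.
  let M₀ := (wordStructure d x y []).model
  let K : KB S (Fin N) := M₀.kb x S
  let Good : (Name → Fin N) × (Name → Fin N) → Prop := fun t =>
    (∀ a ∈ Q₁.vars, ∀ {p : ℕ}, At x p (encodeName a) → M₀.MapsTo false p (t.1 a)) ∧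
      Q₂.IsEmbedding K t.2 ∧ Q₁.distinguished.map t.1 = Q₂.distinguished.map t.2
  -- Whether the first certificate is valid is only decided with `z` in hand, so the pair is fixed
  -- beforehand, with an arbitrary default.
  obtain ⟨t, ht⟩ : ∃ t, (∃ t, Good t) → Good t := by
    by_cases h : ∃ t, Good t
    · exact ⟨h.choose, fun _ => h.choose_spec⟩
    · exact ⟨(fun _ => 0, fun _ => 0), fun h' => absurd h' h⟩
  obtain ⟨z, hz, hzZ⟩ := exists_certificate N fun c i j u v => match c with
    | 0 => ∃ a, At x i (encodeName a) ∧ At x j (encodeName a)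
    | 1 => ∃ R : RegularExpression S, At x i (encodeRegex R) ∧ j = i + (encodeRegex R).length
    | 2 => ∃ l : List (Atom S), At x i (l.flatMap encodeAtom ++ [.endQuery]) ∧
        j = i + (l.flatMap encodeAtom).length
    | 3 => ∃ (d : List Name) (l : List (Atom S)),
      At x i (d.flatMap (fun x => Token.distinguished :: encodeName x) ++
        l.flatMap encodeAtom ++ [.endQuery]) ∧
      j = i + (d.flatMap (fun x => Token.distinguished :: encodeName x)).length +
        (l.flatMap encodeAtom).length
    | 4 => ∃ a, At x i (encodeName a) ∧ (t.2 a : ℕ) = j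
    | 5 => HasPath (M := M₀) K x i j u v
    | _ => ∃ d d', (∀ a ∈ d, a ∈ {a | a ∈ Q₁.distinguished}) ∧ TupleAt x i d ∧ TupleAt x j d' ∧
        d.map t.1 = d'.map t.2
  refine ⟨z, hz.le, ?_⟩
  have hM := wordStructure_isWord hd x y z
  refine verifies_of_queries hM (hl hM) (fun i hi j hj => hzZ 0 (by omega) i hi j hj i hi j hj)
    (fun i hi j hj => hzZ 1 (by omega) i hi j hj i hi j hj)
    (fun i hi j hj => hzZ 2 (by omega) i hi j hj i hi j hj)
    (fun i hi j hj => hzZ 3 (by omega) i hi j hj i hi j hj) hx fun e f hc h1 h2 =>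
    ⟨hc, h1, h2, (hfrag hc h2).2 hQC, h1.componentSpec hc hQ₁, h2.componentSpec hc hQ₂, ?_⟩
  intro hsat
  obtain ⟨μ, hμ, hμ1, hμ2⟩ := hsat.exists_embedding hc h1
  obtain ⟨ν, hν, hμν⟩ := hQ (Fin N) K ⟨μ, hμ, rfl⟩
  obtain ⟨g1, g2, g3⟩ := ht ⟨(μ, ν), hμ2, hν, hμν⟩
  have l1 := h1.eq_end
  have l2 := h2.eq_end
  have l3 := h2.le_length
  have hst : ∀ i < N, ∀ j < N, ((wordStructure d x y z).model.SameTuple i j ↔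
      ∃ d d', (∀ a ∈ d, a ∈ {a | a ∈ Q₁.distinguished}) ∧ TupleAt x i d ∧ TupleAt x j d' ∧
        d.map t.1 = d'.map t.2) := fun i hi j hj => hzZ 6 (by omega) i hi j hj i hi j hj
  have hmap : ∀ p < N, ∀ u < N, ((wordStructure d x y z).model.MapsTo true p u ↔
      ∃ a, At x p (encodeName a) ∧ (t.2 a : ℕ) = u) :=
    fun i hi j hj => hzZ 4 (by omega) i hi j hj i hi j hj
  refine ⟨satisfies_of_embedding hc h2 (μ := t.2)
    (fun q hq u hu v hv r hr => hzZ 5 (by omega) q hq u hu v hv r hr) hmap ?_,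
    sameTupleSpec_of_iff hc (D := {a | a ∈ Q₁.distinguished}) ?_ ?_ hst,
    (hst 0 (by omega) (e + 1) (hM.lt_size (by omega))).2
      ⟨_, _, fun a ha => ha, h1.tupleAt, h2.tupleAt, g3⟩⟩
  · intro A hA
    obtain ⟨w, hw, hp⟩ := g2 A hA
    exact exists_short_path hN (hC (hQC A hA)) hw hp
  · exact fun p hp a ha hpa => g1 a (Q₁.distinguished_occurs a ha) hpa
  · exact fun p hp a hpa => (hmap p hp _ (Fin.is_lt _)).2 ⟨a, hpa, rfl⟩

theorem exists_at_of_infix {i : ℕ} {l l' : List Token} (h : At x i l) (h' : l' <:+: l) :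
    ∃ j, At x j l' := by
  obtain ⟨s, t, rfl⟩ := h'
  exact ⟨_, (at_append.1 (at_append.1 h).1).2⟩

/-- Different first certificates test different conditions: components of `Q₁` and `Q₂` test the
condition on components, and a small counterexample tests containment. -/
theorem contained_of_verifies {d : ℕ} (hd : d ≠ 0)
    (hfrag : ∀ {M : Model} {x : List Token} {s f : ℕ} {Q : CRPQ S}, M.SyntaxCorrect x S →
      QueryAt x s f Q → (fragment M s f ↔ Q.InFragment C))
    (hcounter : ∀ Q₁ Q₂ : CRPQ S, Q₂.InFragment C → Q₂.ComponentsDistinguished →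
      ¬ Q₁.Contained Q₂ →
      ∃ (K : KB S (Fin (((encodeQuery Q₁ ++ encodeQuery Q₂).length + 2) ^ d)))
        (μ : Name → Fin (((encodeQuery Q₁ ++ encodeQuery Q₂).length + 2) ^ d)),
        (∀ A ∈ Q₁.atoms, ∃ w ∈ A.regex.matches',
          w.length < ((encodeQuery Q₁ ++ encodeQuery Q₂).length + 2) ^ d ∧
            K.Path (μ A.source) w (μ A.target)) ∧
        (∀ ν, Q₂.IsEmbedding K ν → Q₁.distinguished.map μ ≠ Q₂.distinguished.map ν) ∧
        ∀ u a v, (u, a, v) ∈ K.edges → ∃ A ∈ Q₁.atoms,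
          Token.symbol :: encodeName a <:+: encodeRegex A.regex)
    {Q₁ Q₂ : CRPQ S} (hx : x = encodeQuery Q₁ ++ encodeQuery Q₂)
    (h : ∀ y : List Bool, y.length ≤ 8 * ((x.length + 2) ^ d) ^ 4 → ∃ (z : List Bool) (e f : ℕ),
      (wordStructure d x y z).model.VerifiesQueries x fragment Q₁ Q₂ e f) :
    Q₁.ComponentsDistinguished ∧ Q₂.InFragment C ∧ Q₂.ComponentsDistinguished ∧
      Q₁.Contained Q₂ := by
  have hset : ∀ (Q : CRPQ S) (a : Name), ∃ y : List Bool, y.length ≤ 8 * ((x.length + 2) ^ d) ^ 4 ∧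
      ∀ z p, p < (x.length + 2) ^ d → ((wordStructure d x y z).model.InSet p ↔
        ∃ b, At x p (encodeName b) ∧ Q.graph.Reachable a b) := by
    intro Q a
    obtain ⟨y, hy, hyZ⟩ := exists_certificate ((x.length + 2) ^ d) fun _ p _ _ _ =>
      ∃ b, At x p (encodeName b) ∧ Q.graph.Reachable a b
    exact ⟨y, hy.le, fun z p hp => hyZ 6 (by omega) p hp p hp p hp p hp⟩
  have hc₁ : Q₁.ComponentsDistinguished := by
    intro a ha
    obtain ⟨y, hy, hyZ⟩ := hset Q₁ a
    obtain ⟨z, e, f, hv⟩ := h y hy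
    exact hv.query₁.exists_distinguished_reachable hv.syntaxCorrect hv.component₁ ha (hyZ z)
  have hc₂ : Q₂.ComponentsDistinguished := by
    intro a ha
    obtain ⟨y, hy, hyZ⟩ := hset Q₂ a
    obtain ⟨z, e, f, hv⟩ := h y hy
    exact hv.query₂.exists_distinguished_reachable hv.syntaxCorrect hv.component₂ ha (hyZ z)
  have hf : Q₂.InFragment C := by
    obtain ⟨z, e, f, hv⟩ := h [] (by simp)
    exact (hfrag hv.syntaxCorrect hv.query₂).1 hv.fragment
  refine ⟨hc₁, hf, hc₂, ?_⟩
  by_contra hcon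
  have := hcounter Q₁ Q₂ hf hc₂ hcon
  rw [← hx] at this
  obtain ⟨K, μ, hμ, hν, hK⟩ := this
  -- For the premise `Satisfies false` only relations 4, 5 and 7 of the first certificate matter.
  obtain ⟨y, hy, hyZ⟩ := exists_certificate ((x.length + 2) ^ d) fun c i j u v => match c with
    | 4 => ∃ a, At x i (encodeName a) ∧ (μ a : ℕ) = j
    | 5 => HasPath (M := (wordStructure d x [] []).model) K x i j u v
    | _ => ∃ (hj : j < (x.length + 2) ^ d) (hu : u < (x.length + 2) ^ d) (a : S),
      At x (i + 1) (encodeName a) ∧ (⟨j, hj⟩, a, ⟨u, hu⟩) ∈ K.edges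
  obtain ⟨z, e, f, hv⟩ := h y hy.le
  have hM := wordStructure_isWord hd x y z
  have hedges : ((wordStructure d x y z).model.kb x S).edges = K.edges := by
    ext ⟨u, a, v⟩
    have hedge : ∀ p < (x.length + 2) ^ d, ((wordStructure d x y z).model.Edge p u v ↔
        ∃ (hj : u < (x.length + 2) ^ d) (hu : v < (x.length + 2) ^ d) (a : S),
          At x (p + 1) (encodeName a) ∧ (⟨u, hj⟩, a, ⟨v, hu⟩) ∈ K.edges) :=
      fun p hp => hyZ 7 (by omega) p hp u u.2 v v.2 v v.2
    constructor
    · rintro ⟨p, hp, -, h2, h3⟩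
      obtain ⟨_, _, b, hb, hb'⟩ := (hedge p hp).1 h3
      obtain rfl : a = b := Subtype.ext (h2.name_unique hb)
      exact hb'
    · intro huv
      obtain ⟨A, hA, hAa⟩ := hK u a v huv
      obtain ⟨i, -, -, hi⟩ := hv.query₁.exists_position_atom hA
      obtain ⟨p, hp⟩ := exists_at_of_infix (atomPositions_of_at hi).regex hAa
      have hlt := hp.add_length_le (by simp)
      have hp' := hM.lt_size (i := p) (by omega)
      obtain ⟨h1, h2⟩ := at_cons.1 hp
      exact ⟨p, hp', h1, h2, (hedge p hp').2 ⟨u.2, v.2, a, h2, huv⟩⟩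
  have hkb : (wordStructure d x y z).model.kb x S = K := KB.eq_of_edges hedges
  obtain ⟨h1, h2, h3⟩ := hv.satisfies <| satisfies_of_embedding hv.syntaxCorrect hv.query₁ (μ := μ)
    (fun q hq u hu v hv r hr => by rw [hkb]; exact hyZ 5 (by omega) q hq u hu v hv r hr)
    (fun i hi j hj => hyZ 4 (by omega) i hi j hj i hi j hj) (by rw [hkb]; exact hμ)
  obtain ⟨ν, hν1, hν2, -⟩ := h1.exists_embedding hv.syntaxCorrect hv.query₂
  rw [hkb] at hν1
  have l1 := hv.query₁.eq_end
  have l2 := hv.query₂.eq_end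
  have l3 := hv.query₂.le_length
  refine hν ν hν1 (h2.map_eq hv.syntaxCorrect (μ := μ) ?_ hν2 _ (hM.lt_size (by omega))
    (hM.lt_size (by omega)) hv.query₁.tupleAt hv.query₂.tupleAt h3)
  intro p u a hp hu hpu
  have hlt := hM.lt_size (i := p) (by have := hp.add_length_le (encodeName_ne_nil _); omega)
  obtain ⟨b, hb, rfl⟩ := (hyZ 4 (by omega) p hlt u hu p hlt u hu).1 hpu
  rw [hp.name_unique hb]

end Model

/-! ### Membership in the second level of the hierarchy -/

open Model

theorem inPiTwoP_containmentProblem {S : Set Name} (hS : S.Finite ∨ S = Set.univ)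
    {C : Set (RegularExpression S)} (hC : C ⊆ classDisjunctionStar S)
    {fragment : Model → ℕ → ℕ → Prop}
    (hdef : ∀ {k : ℕ} (i j : Fin k), Definable k fun M e => fragment M (e i) (e j))
    (hfrag : ∀ {M : Model} {x : List Token} {s f : ℕ} {Q : CRPQ S}, M.SyntaxCorrect x S →
      QueryAt x s f Q → (fragment M s f ↔ Q.InFragment C)) :
    InPiTwoP (containmentProblem (S := S) {Q₁ | Q₁.ComponentsDistinguished}
      {Q₂ | Q₂.InFragment C ∧ Q₂.ComponentsDistinguished}) := by
  obtain ⟨label, hlabel, hl⟩ := exists_isLabel hS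
  obtain ⟨φ, hφ⟩ := Definable.verifies hlabel hdef (k := 0)
  obtain ⟨d, hd, hcounter⟩ := exists_small_counterexample
  have hd0 : d ≠ 0 := by omega
  refine inPiTwoP_of_formula d (8 * ((Polynomial.X + 2) ^ d) ^ 4) φ fun x => ?_
  simp only [hφ _ Fin.elim0 (Fin.elim0 ·), Polynomial.eval_mul, Polynomial.eval_pow,
    Polynomial.eval_add, Polynomial.eval_X, Polynomial.eval_ofNat]
  constructor
  · rintro ⟨Q₁, hQ₁, Q₂, ⟨hQC, hQ₂⟩, hx, hQ⟩ y -
    exact exists_verifies hd0 hC hl hfrag hQ₁ hQ₂ hQC hQ hx y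
  · intro h
    have hdec : ∀ y : List Bool, y.length ≤ 8 * ((x.length + 2) ^ d) ^ 4 →
        ∃ (Q₁ Q₂ : CRPQ S) (z : List Bool) (e f : ℕ), x = encodeQuery Q₁ ++ encodeQuery Q₂ ∧
          (wordStructure d x y z).model.VerifiesQueries x fragment Q₁ Q₂ e f := by
      intro y hy
      obtain ⟨z, -, hz⟩ := h y hy
      have hM := wordStructure_isWord hd0 x y z
      obtain ⟨Q₁, Q₂, e, f, hx, hv⟩ := hz.exists_queries hM (hl hM)
      exact ⟨Q₁, Q₂, z, e, f, hx, hv⟩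
    obtain ⟨Q₁, Q₂, -, -, -, hx, -⟩ := hdec [] (by simp)
    obtain ⟨h1, h2, h3, h4⟩ := contained_of_verifies hd0 hfrag
      (fun Q₁ Q₂ hf => hcounter Q₁ Q₂ fun A hA => hC (hf A hA)) hx fun y hy => by
        obtain ⟨Q₁', Q₂', z, e, f, hx', hv⟩ := hdec y hy
        -- The queries are decoded separately for each `y`; unique readability shows that they are
        -- always the same.
        obtain ⟨rfl, h2⟩ := encodeQuery_append_inj (hx.symm.trans hx')
        obtain ⟨rfl, -⟩ := encodeQuery_append_inj (s := []) (t := []) (by simpa using h2)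
        exact ⟨z, e, f, hv⟩
    exact ⟨Q₁, h1, Q₂, ⟨h2, h3⟩, hx, h4⟩

end CRPQContainment

theorem mainTheorem12 (S : Set CRPQContainment.Name) (hS : S.Finite ∨ S = Set.univ) :
    CRPQContainment.InPiTwoP
      (CRPQContainment.containmentProblem (S := S)
        {Q₁ | Q₁.ComponentsDistinguished}
        {Q₂ | Q₂.InFragment (CRPQContainment.classA S) ∧ Q₂.ComponentsDistinguished}) ∧
    CRPQContainment.InPiTwoP
      (CRPQContainment.containmentProblem (S := S)
        {Q₁ | Q₁.ComponentsDistinguished}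
        {Q₂ | Q₂.InFragment (CRPQContainment.classSymbolStar S) ∧
          Q₂.ComponentsDistinguished}) := by
  refine ⟨CRPQContainment.inPiTwoP_containmentProblem hS (fun R hR => .inl hR)
    CRPQContainment.Definable.disjunctionFragment fun h hQ => hQ.disjunctionFragment_iff h,
    CRPQContainment.inPiTwoP_containmentProblem hS ?_
      CRPQContainment.Definable.symbolStarFragment fun h hQ => hQ.symbolStarFragment_iff h⟩
  rintro R ⟨a, rfl | rfl⟩
  · exact .inl (.symbol a)
  · exact .inr ⟨a, rfl⟩
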